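/- Let $\mathcal X\subset\mathbb R^d$ and let $x_1,\dots,x_n\in\mathcal X$ be pairwise distinct design points ($n\ge 0$). For $\sigma^2>0$ and $\phi=(\phi_1,\dots,\phi_d)$ with all $\phi_k>0$, put $\Sigma_0(x,x')=\sigma^2\exp\bigl(-\sum_{k=1}^d\phi_k(x^{(k)}-x'^{(k)})^2\bigr)$ and $G_0=\mathcal{GP}(0,\Sigma_0)$, a Gaussian process over $\mathcal X$. **The $\infty$-GP model.** The hyperparameters are $\Theta=(\Theta^{(1)},\Theta^{(2)})$ with $\Theta^{(1)}=(\beta,\tau^2)$ and $\Theta^{(2)}=(\nu,\sigma^2,\phi)$. A priori $\beta\sim N(\beta_0,\Sigma_\beta)$ on $\mathbb R^d$ ($\Sigma_\beta$ positive semidefinite), $\tau^2\sim\mathrm{IGamma}(a_\tau,b_\tau)$, $\sigma^2\sim\mathrm{IGamma}(a_\sigma,b_\sigma)$, $\phi\sim U((0,b_\phi]^d)$ and $\nu\sim\mathrm{Gamma}(a_\nu,b_\nu)$ (shape and rate), independently, with all of $a_\tau,b_\tau,a_\sigma,b_\sigma,b_\phi,a_\nu,b_\nu$ positive. Given $\Theta$,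 the sticks $V_1,V_2,\dots$ are i.i.d. $\mathrm{Beta}(1,\nu)$ and, independently of them, the surfaces of a sequence $(\eta^{(l)})_{l\ge1}$ over $\mathcal X$ are i.i.d. with law $G_0$; put $w_l=V_l\prod_{r<l}(1-V_r)$. Given all this, the indices $c_1,c_2,\dots$ are i.i.d. with $P(c_i=l)=w_l$, so that $\eta^{(c_i)}(x)$ is a draw from $G_x=\sum_l w_l\delta_{\eta^{(l)}(x)}$. Given all this, the noise variables $\epsilon_1,\epsilon_2,\dots$ are i.i.d. $N(0,\tau^2)$. The $i$-th observation, taken at a point $x\in\mathcal X$, is $y(x)=\beta^\top x+\eta^{(c_i)}(x)+\epsilon_i$. Number the surfaces realized by the observations as $\xi^{(1)},\xi^{(2)},\dots$ in order of first appearance, and let $z_i$ be the number of the surface of the $i$-th observation, so $\xi^{(z_i)}=\eta^{(c_i)}$. Let $K_n$ be the number of surfaces realized by the first $n$ observations, $n_j=\#\{i\le n: z_i=j\}$, $\bm\xi_{1:n}(x_{1:n})=(\xi^{(j)}(x_i))_{j\le K_n,\,i\le n}$ and $\bm z_{1:n}=(z_1,\dots,z_n)$. Let $\mathcal H_n=\{(x_i,y(x_i))\}_{i\le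 n}$ be the data, and write $[Y\mid X]$ for the regular conditional distribution of $Y$ given $X$ (identities between such distributions hold almost surely). **Proposition.** Let $x_{n+1}\in\mathcal X$ be any further point, at which the $(n+1)$-st observation is taken. Then $$[y(x_{n+1})\mid\mathcal H_n]=\int A\;[\Theta^{(1)},\xi^{(z_{n+1})}(x_{n+1})\mid\mathcal H_n]=\int\!\!\int A\; B\; C,$$ and in particular $[\Theta^{(1)},\xi^{(z_{n+1})}(x_{n+1})\mid\mathcal H_n]=\int B\;C$ (with $\Theta^{(2)},\bm\xi_{1:n}(x_{1:n}),\bm z_{1:n}$ integrated out), where * $A=[y(x_{n+1})\mid\Theta^{(1)},\xi^{(z_{n+1})}(x_{n+1})]=N\bigl(x_{n+1}^\top\beta+\xi^{(z_{n+1})}(x_{n+1}),\,\tau^2\bigr)$; * $B=[\xi^{(z_{n+1})}(x_{n+1})\mid\bm\xi_{1:n}(x_{1:n}),\bm z_{1:n},\Theta^{(2)}]=\frac{\nu}{\nu+n}N(0,\sigma^2)+\sum_{j=1}^{K_n}\frac{n_j}{\nu+n}N\bigl(\mu_n^{(j)}(x_{n+1}),\sigma_n^2(x_{n+1})\bigr)$,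 with $\mu_n^{(j)}(x)=\Sigma_0(x,x_{1:n})\Sigma_0(x_{1:n},x_{1:n})^{-1}\xi^{(j)}(x_{1:n})$ and $\sigma_n^2(x)=\sigma^2-\Sigma_0(x,x_{1:n})\Sigma_0(x_{1:n},x_{1:n})^{-1}\Sigma_0(x_{1:n},x)$; * $C=[\Theta,\bm\xi_{1:n}(x_{1:n}),\bm z_{1:n}\mid\mathcal H_n]$ is the joint posterior of the hyperparameters and the latent variables. Term $B$ also holds for the new surface as a process over $\mathcal X$: given $\bm\xi_{1:n}(x_{1:n}),\bm z_{1:n},\Theta^{(2)}$, with probability $\frac{\nu}{\nu+n}$ one has $z_{n+1}=K_n+1$ and the surface $\xi^{(z_{n+1})}$ follows $G_0$, and with probability $\frac{n_j}{\nu+n}$ one has $z_{n+1}=j$ and the surface follows the Gaussian process with mean function $\mu_n^{(j)}$ and covariance function $\Sigma_0(x,x')-\Sigma_0(x,x_{1:n})\Sigma_0(x_{1:n},x_{1:n})^{-1}\Sigma_0(x_{1:n},x')$ ($j\le K_n$), in the sense of the joint law of $z_{n+1}$ and the values at any finitely many points; and the posterior of $\Theta^{(1)}$, $z_{n+1}$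 and these values given $\mathcal H_n$ is the integral of this law against $C$. -/

import Mathlib

open MeasureTheory ProbabilityTheory

noncomputable section

namespace InfiniteGP

/-! ### Parameters and priors -/

/-- First-layer hyperparameters `Θ⁽¹⁾ = (β, τ²)`. -/
abbrev FirstLayer (d : ℕ) : Type := EuclideanSpace ℝ (Fin d) × ℝ

/-- Second-layer hyperparameters `Θ⁽²⁾ = (ν, σ², φ)`. -/
abbrev SecondLayer (d : ℕ) : Type := ℝ × ℝ × (Fin d → ℝ)

/-- The concentration parameter `ν`. -/
def SecondLayer.nu {d : ℕ} (θ : SecondLayer d) : ℝ := θ.1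

/-- The variance `σ²` of the baseline Gaussian process. -/
def SecondLayer.sigmaSq {d : ℕ} (θ : SecondLayer d) : ℝ := θ.2.1

/-- The length-scale parameters `φ = (φ₁, …, φ_d)`. -/
def SecondLayer.phi {d : ℕ} (θ : SecondLayer d) : Fin d → ℝ := θ.2.2

instance instStandardBorelSpaceHyper (d : ℕ) :
    StandardBorelSpace (FirstLayer d × SecondLayer d) := inferInstance

/-- Constants of the hyperprior. -/
structure HyperPrior (d : ℕ) where
  beta0 : EuclideanSpace ℝ (Fin d)
  SigmaBeta : Matrix (Fin d) (Fin d) ℝ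
  posSemidef_SigmaBeta : SigmaBeta.PosSemidef
  (aTau bTau aSigma bSigma aNu bNu bPhi : ℝ)
  aTau_pos : 0 < aTau
  bTau_pos : 0 < bTau
  aSigma_pos : 0 < aSigma
  bSigma_pos : 0 < bSigma
  aNu_pos : 0 < aNu
  bNu_pos : 0 < bNu
  bPhi_pos : 0 < bPhi

/-- Inverse-Gamma distribution with shape `a` and scale `b`: the law of `1 / X` where `X` has the
Gamma distribution with shape `a` and rate `b`. -/
def inverseGammaMeasure (a b : ℝ) : Measure ℝ := (gammaMeasure a b).map (fun t => t⁻¹)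

/-- Uniform distribution on the cube `(0, b]^d`. -/
def uniformCube (d : ℕ) (b : ℝ) : Measure (Fin d → ℝ) :=
  ProbabilityTheory.cond volume (Set.univ.pi fun _ => Set.Ioc 0 b)

/-- The prior of `Θ⁽¹⁾`: `β ∼ N(β₀, Σ_β)` and `τ² ∼ IGamma(a_τ, b_τ)`, independent. -/
def HyperPrior.first {d : ℕ} (h : HyperPrior d) : Measure (FirstLayer d) :=
  (multivariateGaussian h.beta0 h.SigmaBeta).prod (inverseGammaMeasure h.aTau h.bTau)

/-- The prior of `Θ⁽²⁾`: `ν ∼ Gamma(a_ν, b_ν)`, `σ² ∼ IGamma(a_σ, b_σ)`, `φ ∼ U((0, b_φ]^d)`,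
independent. -/
def HyperPrior.second {d : ℕ} (h : HyperPrior d) : Measure (SecondLayer d) :=
  (gammaMeasure h.aNu h.bNu).prod
    ((inverseGammaMeasure h.aSigma h.bSigma).prod (uniformCube d h.bPhi))

/-! ### The baseline Gaussian process and kriging -/

section Kriging

variable {d m n : ℕ} {S : Set (EuclideanSpace ℝ (Fin d))}

/-- Covariance function `Σ₀(p, q) = σ² exp(-∑ₖ φₖ (p⁽ᵏ⁾ - q⁽ᵏ⁾)²)` of the baseline process. -/
def baseCov (θ : SecondLayer d) (p q : S) : ℝ :=
  θ.sigmaSq * Real.exp (-∑ k, θ.phi k * (p.1 k - q.1 k) ^ 2)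

/-- Covariance matrix `Σ₀(p_{1:m}, p_{1:m})`. -/
def gram (θ : SecondLayer d) (p : Fin m → S) : Matrix (Fin m) (Fin m) ℝ :=
  Matrix.of fun a b => baseCov θ (p a) (p b)

/-- The marginal at `p₁, …, p_m` of the baseline `G₀ = GP(0, σ² ρ_φ)`. -/
def baseGP (θ : SecondLayer d) (p : Fin m → S) : Measure (EuclideanSpace ℝ (Fin m)) :=
  multivariateGaussian 0 (gram θ p)

/-- The vector `Σ₀(p, x_{1:n})`. -/
def crossCov (θ : SecondLayer d) (x : Fin n → S) (p : S) : Fin n → ℝ :=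
  fun i => baseCov θ p (x i)

/-- Kriging mean `Σ₀(p, x_{1:n}) Σ₀(x_{1:n}, x_{1:n})⁻¹ v`, where `v` is the vector of the values
of a surface at `x_{1:n}`. -/
def krigMean (θ : SecondLayer d) (x : Fin n → S) (v : Fin n → ℝ) (p : S) : ℝ :=
  crossCov θ x p ⬝ᵥ ((gram θ x)⁻¹.mulVec v)

/-- Kriging covariance `Σ₀(p, q) - Σ₀(p, x_{1:n}) Σ₀(x_{1:n}, x_{1:n})⁻¹ Σ₀(x_{1:n}, q)`. -/
def krigCov (θ : SecondLayer d) (x : Fin n → S) (p q : S) : ℝ :=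
  baseCov θ p q - crossCov θ x p ⬝ᵥ ((gram θ x)⁻¹.mulVec (crossCov θ x q))

/-- Kriging variance `σ_n²(p) = σ² - Σ₀(p, x_{1:n}) Σ₀(x_{1:n}, x_{1:n})⁻¹ Σ₀(x_{1:n}, p)`. -/
def krigVar (θ : SecondLayer d) (x : Fin n → S) (p : S) : ℝ :=
  θ.sigmaSq - crossCov θ x p ⬝ᵥ ((gram θ x)⁻¹.mulVec (crossCov θ x p))

/-- The marginal at `p₁, …, p_m` of the kriging process `GP(μ_n, σ_n²)` given the values `v` of a
surface at `x_{1:n}`. -/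
def krigGP (θ : SecondLayer d) (x : Fin n → S) (v : Fin n → ℝ) (p : Fin m → S) :
    Measure (EuclideanSpace ℝ (Fin m)) :=
  multivariateGaussian (WithLp.toLp 2 fun a => krigMean θ x v (p a))
    (Matrix.of fun a b => krigCov θ x (p a) (p b))

end Kriging

/-! ### Stick-breaking, and surface assignments in order of appearance -/

/-- Stick-breaking weight `w_l = V_l ∏_{r < l} (1 - V_r)` (sticks are numbered from `0`). -/
def stickWeight (v : ℕ → ℝ) (l : ℕ) : ℝ := v l * ∏ r ∈ Finset.range l, (1 - v r)

/-- The distribution `∑_l w_l δ_l` on the indices of the surfaces. -/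
def stickMeasure (v : ℕ → ℝ) : Measure ℕ :=
  Measure.sum fun l => ENNReal.ofReal (stickWeight v l) • Measure.dirac l

/-- The distinct values among `c 0, …, c (n - 1)`, listed in order of first appearance. -/
def appearance (c : ℕ → ℕ) : ℕ → List ℕ
  | 0 => []
  | n + 1 => if c n ∈ appearance c n then appearance c n else appearance c n ++ [c n]

/-- The rank, counted from `0`, of the value `c i` in the order of first appearance. -/
def appearanceLabel (c : ℕ → ℕ) (i : ℕ) : ℕ := (appearance c (i + 1)).idxOf (c i)

/-- `K_n`: the number of distinct surfaces in the assignments `z_{1:n}`. -/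
def numSurfaces {n : ℕ} (z : Fin n → ℕ) : ℕ := (Finset.univ.image z).card

/-- `n_j = #{i : z_i = j}`. -/
def surfaceCount {n : ℕ} (z : Fin n → ℕ) (j : ℕ) : ℕ := (Finset.univ.filter fun i => z i = j).card

/-! ### The model -/

/-- Random variables that follow the `∞`-GP model over the decision space `S`: sequential sampling
from a spatial Dirichlet process with baseline `GP(0, σ² ρ_φ)`, Gaussian noise and hyperpriors.
The `i`-th latent value is drawn from `G_{x_i} = ∑_l w_l δ_{ξ^{(l)}(x_i)}`, which is done by drawing
the index `l` of the surface (`stickIndex i`) with probabilities `w_l`. -/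
structure Model {d : ℕ} (h : HyperPrior d) (S : Set (EuclideanSpace ℝ (Fin d)))
    {Ω : Type*} [MeasurableSpace Ω] (P : Measure Ω) [IsProbabilityMeasure P] where
  /-- `Θ⁽¹⁾ = (β, τ²)` -/
  first : Ω → FirstLayer d
  /-- `Θ⁽²⁾ = (ν, σ², φ)` -/
  second : Ω → SecondLayer d
  /-- the sticks `V_r` -/
  stick : ℕ → Ω → ℝ
  /-- the surfaces `ξ^{(l)}` -/
  surface : ℕ → S → Ω → ℝ
  /-- the index of the surface on which the `i`-th observation is realized -/
  stickIndex : ℕ → Ω → ℕ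
  /-- the noise `ε_i` -/
  noise : ℕ → Ω → ℝ
  measurable_first : Measurable first
  measurable_second : Measurable second
  measurable_stick : ∀ r, Measurable (stick r)
  measurable_surface : ∀ l p, Measurable (surface l p)
  measurable_stickIndex : ∀ i, Measurable (stickIndex i)
  measurable_noise : ∀ i, Measurable (noise i)
  /-- The hyperparameters follow their prior. -/
  law_hyper : P.map (fun ω => (first ω, second ω)) = h.first.prod h.second
  /-- Given the hyperparameters, the sticks are i.i.d. `Beta(1, ν)`, the surfaces are i.i.d.
  `GP(0, σ² ρ_φ)`, and the sticks are independent of the surfaces. -/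
  law_stick_surface : ∀ (L m : ℕ) (p : Fin m → S),
    ∀ᵐ θ ∂(P.map fun ω => (first ω, second ω)),
      condDistrib
        (fun ω => ((fun r : Fin L => stick r ω),
          (fun l : Fin L => (WithLp.toLp 2 fun a => surface l (p a) ω : EuclideanSpace ℝ (Fin m)))))
        (fun ω => (first ω, second ω)) P θ
      = (Measure.pi fun _ : Fin L => betaMeasure 1 θ.2.nu).prod
          (Measure.pi fun _ : Fin L => baseGP θ.2 p)
  /-- Given the hyperparameters, sticks and surfaces, the indices are i.i.d. with probabilities
  `w_l`. -/
  law_stickIndex : ∀ m : ℕ,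
    ∀ᵐ c ∂(P.map fun ω => ((first ω, second ω), (fun r => stick r ω), fun l p => surface l p ω)),
      condDistrib (fun ω => fun i : Fin m => stickIndex i ω)
        (fun ω => ((first ω, second ω), (fun r => stick r ω), fun l p => surface l p ω)) P c
      = Measure.pi fun _ : Fin m => stickMeasure c.2.1
  /-- Given everything else, the noise variables are i.i.d. `N(0, τ²)`. -/
  law_noise : ∀ m : ℕ,
    ∀ᵐ c ∂(P.map fun ω => ((first ω, second ω), (fun r => stick r ω), (fun l p => surface l p ω),
        fun i => stickIndex i ω)),
      condDistrib (fun ω => fun i : Fin m => noise i ω)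
        (fun ω => ((first ω, second ω), (fun r => stick r ω), (fun l p => surface l p ω),
          fun i => stickIndex i ω)) P c
      = Measure.pi fun _ : Fin m => gaussianReal 0 c.1.1.2.toNNReal

namespace Model

variable {d : ℕ} {h : HyperPrior d} {S : Set (EuclideanSpace ℝ (Fin d))}
  {Ω : Type*} [MeasurableSpace Ω] {P : Measure Ω} [IsProbabilityMeasure P]

/-- The latent value at the point `p` on the surface assigned to the `i`-th observation (counted
from `0`), that is `ξ^{(z_i)}(p)`. -/
def latent (M : Model h S P) (i : ℕ) (p : S) (ω : Ω) : ℝ := M.surface (M.stickIndex i ω) p ω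

/-- The `i`-th observation when it is taken at the point `p`: `βᵀp + ξ^{(z_i)}(p) + ε_i`. -/
def obs (M : Model h S P) (i : ℕ) (p : S) (ω : Ω) : ℝ :=
  inner ℝ (M.first ω).1 p.1 + M.latent i p ω + M.noise i ω

/-- The data `H_n = ((x_1, y(x_1)), …, (x_n, y(x_n)))`. -/
def data {n : ℕ} (M : Model h S P) (x : Fin n → S) (ω : Ω) : Fin n → S × ℝ :=
  fun i => (x i, M.obs i (x i) ω)

/-- The surface assignment of the `i`-th observation, where the realized surfaces are numbered
`0, 1, 2, …` in order of first appearance. -/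
def assignment (M : Model h S P) (i : ℕ) (ω : Ω) : ℕ := appearanceLabel (fun k => M.stickIndex k ω) i

/-- The surface assignments `z_{1:n}`. -/
def assignments (M : Model h S P) (n : ℕ) (ω : Ω) : Fin n → ℕ := fun i => M.assignment i ω

/-- The table `ξ_{1:n}(x_{1:n}) = (ξ^{(j)}(x_i))`, whose `j`-th row holds the values at
`x_1, …, x_n` of the `j`-th realized surface; the rows `j ≥ K_n` are unused and filled with zeros. -/
def table {n : ℕ} (M : Model h S P) (x : Fin n → S) (ω : Ω) : Fin n → Fin n → ℝ :=
  fun j i => ((appearance (fun k => M.stickIndex k ω) n)[(j : ℕ)]?).elim 0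
    fun l => M.surface l (x i) ω

end Model

/-! ### The finite Gaussian process mixture -/

section Mixture

variable {d m n : ℕ} {S : Set (EuclideanSpace ℝ (Fin d))}

/-- The mixture `ν/(ν+n) N(0, σ²) + ∑_{j < K_n} n_j/(ν+n) N(μ_n^{(j)}(p), σ_n²(p))`: the finite
Gaussian process mixture evaluated at `p`. Here `t` is the table of the values of the realized
surfaces and `z` the vector of surface assignments. -/
def gpMixture (θ : SecondLayer d) (x : Fin n → S) (t : Fin n → Fin n → ℝ) (z : Fin n → ℕ)
    (p : S) : Measure ℝ :=
  ENNReal.ofReal (θ.nu / (θ.nu + n)) • gaussianReal 0 θ.sigmaSq.toNNReal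
    + ∑ j ∈ Finset.univ.filter (fun j : Fin n => (j : ℕ) < numSurfaces z),
        ENNReal.ofReal (surfaceCount z j / (θ.nu + n)) •
          gaussianReal (krigMean θ x (t j) p) (krigVar θ x p).toNNReal

/-- The urn scheme followed by kriging at `p₁, …, p_m`: with probability `ν/(ν+n)` the new surface
(number `K_n`), drawn from `G₀`; with probability `n_j/(ν+n)` the realized surface `j`, which
follows `GP(μ_n^{(j)}, σ_n²)`. A measure on pairs (surface number, values at `p₁, …, p_m`). -/
def urnKriging (θ : SecondLayer d) (x : Fin n → S) (t : Fin n → Fin n → ℝ) (z : Fin n → ℕ)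
    (p : Fin m → S) : Measure (ℕ × EuclideanSpace ℝ (Fin m)) :=
  ENNReal.ofReal (θ.nu / (θ.nu + n)) • (Measure.dirac (numSurfaces z)).prod (baseGP θ p)
    + ∑ j ∈ Finset.univ.filter (fun j : Fin n => (j : ℕ) < numSurfaces z),
        ENNReal.ofReal (surfaceCount z j / (θ.nu + n)) •
          (Measure.dirac (j : ℕ)).prod (krigGP θ x (t j) p)

end Mixture

end InfiniteGP

end

/-!
Integrating out the sticks, the probability that classes of sizes `n_j` sit on prescribed sticks is
a product of Beta moments. Summed over the injections of the `K` classes into the sticks it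
satisfies a recursion on the first stick, which carries either no class or exactly one. The only
solution is `ν ^ K * ∏ j, Γ(n_j) * Γ(ν) / Γ(ν + n)`, which is therefore the probability of any word
`z_1, …, z_n` labelled in order of appearance. Its ratios for `n + 1` and `n` observations are the
urn weights `ν / (ν + n)` and `n_j / (ν + n)`.

Whichever sticks carry the classes, the realized surfaces are independent draws from `G₀`. Hence,
given `Θ` and the labels, they are independent Gaussian processes, and the law of a surface given
its values at `x_{1:n}` follows from writing its values at new points as the kriging mean plus a
residual that is independent of those values. As `Σ₀(x_{1:n}, x_{1:n})` must be invertible, one uses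
that the characters `exp ⟨u, ·⟩` at distinct points `u` are linearly independent.

Given the latents, the data are a function of the noise, which is independent of the next surface;
so the law of the next surface given the latents does not change when the data are added, and it
can be integrated against the posterior of the latents.
-/

noncomputable section

namespace InfiniteGP

/-! ### Conditional distributions -/

section CondDistrib

open scoped ENNReal

variable {Ω α β γ δ : Type*} [MeasurableSpace Ω] [MeasurableSpace α] [MeasurableSpace β]
  [MeasurableSpace γ] [MeasurableSpace δ] {P : Measure Ω} {X : Ω → α} {Y : Ω → β} {D : Ω → δ}

theorem isSFiniteKernel_of_isFiniteMeasure (κ : Kernel α β) [∀ a, IsFiniteMeasure (κ a)] :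
    IsSFiniteKernel κ := by
  have mass_meas : Measurable fun a => κ a Set.univ := κ.measurable_coe .univ
  let normalized : Kernel α β :=
    { toFun := fun a => (κ a Set.univ)⁻¹ • κ a
      measurable' := Measure.measurable_of_measurable_coe _ fun s meas_s => by
        simp only [Measure.smul_apply, smul_eq_mul]
        exact mass_meas.inv.mul (κ.measurable_coe meas_s) }
  have : IsFiniteKernel normalized := ⟨1, ENNReal.one_lt_top, fun a => ENNReal.inv_mul_le_one _⟩
  have factor : κ = normalized.withDensity fun a _ => ((κ a Set.univ).toNNReal : ℝ≥0∞) := by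
    ext a s _
    rw [Kernel.withDensity_apply' _ (by fun_prop), setLIntegral_const,
      ENNReal.coe_toNNReal (measure_ne_top _ _)]
    change κ a s = κ a Set.univ * ((κ a Set.univ)⁻¹ * κ a s)
    rcases eq_or_ne (κ a Set.univ) 0 with h | h
    · simp [measure_mono_null (Set.subset_univ s) h]
    · rw [← mul_assoc, ENNReal.mul_inv_cancel h (measure_ne_top _ _), one_mul]
  rw [factor]
  infer_instance

theorem hasCondDistrib_of_lintegral [SFinite P] {κ : Kernel α β} [IsSFiniteKernel κ]
    (hX : Measurable X) (hY : Measurable Y)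
    (h : ∀ f : α × β → ℝ≥0∞, Measurable f →
      ∫⁻ ω, f (X ω, Y ω) ∂P = ∫⁻ ω, ∫⁻ y, f (X ω, y) ∂κ (X ω) ∂P) :
    HasCondDistrib Y X κ P where
  map_eq := Measure.ext_of_lintegral _ fun f hf => by
    rw [lintegral_map hf (hX.prodMk hY), h f hf, Measure.lintegral_compProd hf,
      lintegral_map hf.lintegral_kernel_prod_right' hX]

theorem lintegral_of_hasCondDistrib [SFinite P] {κ : Kernel α β} [IsSFiniteKernel κ]
    (hXY : HasCondDistrib Y X κ P) {f : α × β → ℝ≥0∞} (hf : Measurable f) :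
    ∫⁻ ω, f (X ω, Y ω) ∂P = ∫⁻ ω, ∫⁻ y, f (X ω, y) ∂κ (X ω) ∂P := by
  rw [← lintegral_map' hf.aemeasurable hXY.aemeasurable, hXY.map_eq, Measure.lintegral_compProd hf,
    lintegral_map' hf.lintegral_kernel_prod_right'.aemeasurable hXY.aemeasurable_fst]

theorem hasCondDistrib_of_condDistrib_ae_eq [IsFiniteMeasure P] [StandardBorelSpace β] [Nonempty β]
    {κ : Kernel α β} [IsSFiniteKernel κ] (hX : AEMeasurable X P) (hY : AEMeasurable Y P)
    (h : condDistrib Y X P =ᵐ[P.map X] κ) : HasCondDistrib Y X κ P where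
  map_eq := by rw [← compProd_map_condDistrib hY, Measure.compProd_congr h]

theorem hasCondDistrib_condDistrib [IsFiniteMeasure P] [StandardBorelSpace β] [Nonempty β]
    (hX : AEMeasurable X P) (hY : AEMeasurable Y P) : HasCondDistrib Y X (condDistrib Y X P) P :=
  hasCondDistrib_of_condDistrib_ae_eq hX hY .rfl

theorem ae_isProbabilityMeasure_of_hasCondDistrib [IsFiniteMeasure P] {κ : Kernel α β}
    [IsSFiniteKernel κ] (h : HasCondDistrib Y X κ P) :
    ∀ᵐ a ∂P.map X, IsProbabilityMeasure (κ a) := by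
  have mass : (fun a => κ a Set.univ) =ᵐ[P.map X] fun _ => 1 := by
    refine ae_eq_of_forall_setLIntegral_eq_of_sigmaFinite (κ.measurable_coe .univ)
      measurable_const fun s hs _ => ?_
    rw [← Measure.compProd_apply_prod hs .univ, ← h.map_eq,
      Measure.map_apply_of_aemeasurable h.aemeasurable (hs.prod .univ), setLIntegral_one,
      Measure.map_apply_of_aemeasurable h.aemeasurable_fst hs, Set.mk_preimage_prod]
    simp
  filter_upwards [mass] with a ha using ⟨ha⟩

theorem exists_isMarkovKernel_ae_eq [Nonempty β] {μ : Measure α} {κ : Kernel α β}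
    (h : ∀ᵐ a ∂μ, IsProbabilityMeasure (κ a)) :
    ∃ η : Kernel α β, IsMarkovKernel η ∧ κ =ᵐ[μ] η := by
  classical
  have hs : MeasurableSet {a | κ a Set.univ = 1} :=
    κ.measurable_coe .univ (measurableSet_singleton 1)
  let η := Kernel.piecewise hs κ (Kernel.const α (Measure.dirac (Classical.arbitrary β)))
  refine ⟨η, ⟨fun a => ?_⟩, ?_⟩
  · rw [Kernel.piecewise_apply]
    split_ifs with ha
    exacts [⟨ha⟩, inferInstance]
  · filter_upwards [h] with a ha
    rw [Kernel.piecewise_apply]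
    exact (if_pos (show κ a Set.univ = 1 from measure_univ)).symm

theorem condDistrib_ae_eq_of_hasCondDistrib [IsFiniteMeasure P] [StandardBorelSpace β] [Nonempty β]
    {κ : Kernel α β} [IsSFiniteKernel κ] (h : HasCondDistrib Y X κ P) :
    condDistrib Y X P =ᵐ[P.map X] κ := by
  obtain ⟨η, _, hη⟩ := exists_isMarkovKernel_ae_eq (ae_isProbabilityMeasure_of_hasCondDistrib h)
  have := condDistrib_ae_eq_of_measure_eq_compProd X h.aemeasurable_snd
    (h.map_eq.trans (Measure.compProd_congr hη))
  exact this.trans hη.symm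

theorem hasCondDistrib_prodMk {κ : Kernel δ α} {η : Kernel (δ × α) β}
    (hX : HasCondDistrib X D κ P) (hY : HasCondDistrib Y (fun ω => (D ω, X ω)) η P) :
    HasCondDistrib (fun ω => (X ω, Y ω)) D (κ ⊗ₖ η) P where
  aemeasurable := hX.aemeasurable_fst.prodMk (hX.aemeasurable_snd.prodMk hY.aemeasurable_snd)
  map_eq := by
    rw [← Measure.compProd_assoc', ← hX.map_eq, ← hY.map_eq,
      AEMeasurable.map_map_of_aemeasurable MeasurableEquiv.prodAssoc.measurable.aemeasurable
        hY.aemeasurable]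
    rfl

theorem hasCondDistrib_of_prodMk {κ : Kernel δ α} {η : Kernel (δ × α) β}
    (hX : HasCondDistrib X D κ P)
    (hXY : HasCondDistrib (fun ω => (X ω, Y ω)) D (κ ⊗ₖ η) P) :
    HasCondDistrib Y (fun ω => (D ω, X ω)) η P where
  aemeasurable := hX.aemeasurable.prodMk hXY.aemeasurable_snd.snd
  map_eq := by
    rw [hX.map_eq, ← Measure.compProd_assoc, ← hXY.map_eq,
      AEMeasurable.map_map_of_aemeasurable MeasurableEquiv.prodAssoc.symm.measurable.aemeasurable
        hXY.aemeasurable]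
    rfl

theorem compProd_prodMkRight (κ : Kernel α β) [IsSFiniteKernel κ] (η : Kernel α γ)
    [IsSFiniteKernel η] : κ ⊗ₖ η.prodMkRight β = κ ×ₖ η := by
  ext a s hs
  rw [Kernel.compProd_apply hs, Kernel.prod_apply, Measure.prod_apply hs]
  rfl

theorem hasCondDistrib_prodMkRight_symm [SFinite P] {κ : Kernel α β} [IsSFiniteKernel κ]
    {η : Kernel α γ} [IsSFiniteKernel η] {Z : Ω → γ} (hY : HasCondDistrib Y X κ P)
    (hZ : HasCondDistrib Z X η P)
    (hZ' : HasCondDistrib Z (fun ω => (X ω, Y ω)) (η.prodMkRight β) P) :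
    HasCondDistrib Y (fun ω => (X ω, Z ω)) (κ.prodMkRight γ) P := by
  refine hasCondDistrib_of_prodMk hZ ?_
  have swap : (κ ⊗ₖ η.prodMkRight β).map Prod.swap = η ⊗ₖ κ.prodMkRight γ := by
    rw [compProd_prodMkRight, compProd_prodMkRight, Kernel.map_prod_swap]
  exact swap ▸ (hasCondDistrib_prodMk hY hZ').comp_left measurable_swap

theorem hasCondDistrib_comp_prodMk [SFinite P] {κ : Kernel α β} [IsSFiniteKernel κ]
    {η : Kernel α γ} [IsSFiniteKernel η] (h : HasCondDistrib Y X κ P) {φ : α × β → γ}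
    (hφ : Measurable φ) (hη : ∀ᵐ ω ∂P, η (X ω) = (κ (X ω)).map fun b => φ (X ω, b)) :
    HasCondDistrib (fun ω => φ (X ω, Y ω)) X η P where
  aemeasurable := h.aemeasurable_fst.prodMk (hφ.comp_aemeasurable h.aemeasurable)
  map_eq := by
    have hX := h.aemeasurable_fst
    have hφY : AEMeasurable (fun ω => φ (X ω, Y ω)) P := hφ.comp_aemeasurable h.aemeasurable
    refine Measure.ext_of_lintegral _ fun f hf => ?_
    have disintegration := lintegral_of_hasCondDistrib h (f := fun c => f (c.1, φ c)) (by fun_prop)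
    rw [lintegral_map' hf.aemeasurable (hX.prodMk hφY), Measure.lintegral_compProd hf,
      lintegral_map' hf.lintegral_kernel_prod_right'.aemeasurable hX, disintegration]
    refine lintegral_congr_ae ?_
    filter_upwards [hη] with ω hω
    rw [hω, lintegral_map (by fun_prop) (by fun_prop)]

theorem lintegral_of_condDistrib_ae_eq [IsFiniteMeasure P] [StandardBorelSpace β] [Nonempty β]
    (hX : Measurable X) (hY : Measurable Y) {κ : α → Measure β}
    (h : ∀ᵐ a ∂P.map X, condDistrib Y X P a = κ a) {f : α × β → ℝ≥0∞} (hf : Measurable f) :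
    ∫⁻ ω, f (X ω, Y ω) ∂P = ∫⁻ ω, ∫⁻ y, f (X ω, y) ∂κ (X ω) ∂P := by
  rw [lintegral_of_hasCondDistrib (hasCondDistrib_condDistrib hX.aemeasurable hY.aemeasurable) hf]
  refine lintegral_congr_ae ?_
  filter_upwards [ae_of_ae_map hX.aemeasurable h] with ω hω
  rw [hω]

theorem map_compProd_eq_bind {μ : Measure α} [SFinite μ] {κ : Kernel α β} [IsSFiniteKernel κ]
    {φ : α × β → γ} (hφ : Measurable φ) :
    (μ ⊗ₘ κ).map φ = μ.bind fun a => (κ a).map fun b => φ (a, b) := by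
  have map_section : ∀ a s, MeasurableSet s →
      (κ a).map (fun b => φ (a, b)) s = κ a (Prod.mk a ⁻¹' (φ ⁻¹' s)) := fun a s hs =>
    Measure.map_apply (hφ.comp measurable_prodMk_left) hs
  have meas : Measurable fun a => (κ a).map fun b => φ (a, b) :=
    Measure.measurable_of_measurable_coe _ fun s hs => by
      simp_rw [map_section _ s hs]
      exact Kernel.measurable_kernel_prodMk_left (hφ hs)
  ext s hs
  rw [Measure.map_apply hφ hs, Measure.compProd_apply (hφ hs),
    Measure.bind_apply hs meas.aemeasurable]
  simp_rw [map_section _ s hs]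

theorem bind_map_bind {μ : Measure α} {κ : Kernel α β} {φ : α × β → γ} [SFinite μ]
    [IsSFiniteKernel κ] (hφ : Measurable φ) (η : Kernel γ δ) :
    (μ.bind fun a => (κ a).map fun b => φ (a, b)).bind η
      = μ.bind fun a => (κ a).bind fun b => η (φ (a, b)) := by
  rw [← map_compProd_eq_bind hφ]
  ext s hs
  have meas : Measurable fun c : α × β => η (φ c) s := (η.measurable_coe hs).comp hφ
  have inner : ∀ a t, MeasurableSet t →
      ((κ a).bind fun b => η (φ (a, b))) t = ∫⁻ b, η (φ (a, b)) t ∂κ a := fun a t ht =>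
    Measure.bind_apply ht (η.measurable.comp (hφ.comp measurable_prodMk_left)).aemeasurable
  have outer : Measurable fun a => (κ a).bind fun b => η (φ (a, b)) :=
    Measure.measurable_of_measurable_coe _ fun t ht => by
      simp_rw [inner _ t ht]
      exact ((η.measurable_coe ht).comp hφ).lintegral_kernel_prod_right'
  rw [Measure.bind_apply hs η.aemeasurable, lintegral_map (η.measurable_coe hs) hφ,
    Measure.lintegral_compProd meas, Measure.bind_apply hs outer.aemeasurable]
  simp_rw [inner _ s hs]

theorem condDistrib_ae_eq_bind [IsFiniteMeasure P] [StandardBorelSpace α] [Nonempty α]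
    [StandardBorelSpace γ] [Nonempty γ] {κ : Kernel α β} [IsSFiniteKernel κ]
    (hX : AEMeasurable X P) (hY : HasCondDistrib Y (fun ω => (D ω, X ω)) (κ.prodMkLeft δ) P)
    {φ : α × β → γ} (hφ : Measurable φ) :
    ∀ᵐ H ∂P.map D, condDistrib (fun ω => φ (X ω, Y ω)) D P H
      = (condDistrib X D P H).bind fun a => (κ a).map fun b => φ (a, b) := by
  have hXY := (hasCondDistrib_prodMk
    (hasCondDistrib_condDistrib hY.aemeasurable_fst.fst hX) hY).comp_left hφ
  filter_upwards [condDistrib_ae_eq_of_hasCondDistrib hXY] with H hH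
  refine hH.trans ?_
  rw [Kernel.map_apply _ hφ, Kernel.compProd_apply_eq_compProd_sectR, Kernel.sectR_prodMkLeft,
    map_compProd_eq_bind hφ]

end CondDistrib

/-! ### Measurability in the parameters -/

section Measurability

open scoped ENNReal

variable {γ α β : Type*} [MeasurableSpace γ] [MeasurableSpace α] [MeasurableSpace β]

theorem measurable_map_param (μ : Measure α) [SFinite μ] {f : γ → α → β}
    (hf : Measurable (Function.uncurry f)) : Measurable fun c => μ.map (f c) := by
  have : (fun c => μ.map (f c)) = fun c => (μ.map (Prod.mk c)).map (Function.uncurry f) :=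
    funext fun c => (Measure.map_map hf measurable_prodMk_left).symm
  rw [this]
  exact (Measure.measurable_map _ hf).comp Measurable.map_prodMk_left

theorem measurable_dirac_prod (a : α) {μ : γ → Measure β} (hμ : Measurable μ)
    [∀ c, SFinite (μ c)] : Measurable fun c => (Measure.dirac a).prod (μ c) := by
  simp_rw [Measure.dirac_prod]
  exact (Measure.measurable_map _ measurable_prodMk_left).comp hμ

theorem measurable_smul_measure {w : γ → ℝ≥0∞} (hw : Measurable w) {μ : γ → Measure α}
    (hμ : Measurable μ) : Measurable fun c => w c • μ c :=
  Measure.measurable_of_measurable_coe _ fun _ hs =>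
    hw.mul ((Measure.measurable_coe hs).comp hμ)

theorem measurable_measure_pi {ι : Type*} [Fintype ι] {α : ι → Type*}
    [∀ i, MeasurableSpace (α i)] {μ : ∀ i, γ → Measure (α i)}
    [∀ i c, IsProbabilityMeasure (μ i c)] (hμ : ∀ i, Measurable (μ i)) :
    Measurable fun c => Measure.pi fun i => μ i c := by
  refine Measurable.measure_of_isPiSystem_of_isProbabilityMeasure generateFrom_pi.symm
    isPiSystem_pi ?_
  rintro _ ⟨s, hs, rfl⟩
  simp_rw [Measure.pi_pi]
  exact Finset.measurable_prod _ fun i _ =>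
    (Measure.measurable_coe (hs i (Set.mem_univ i))).comp (hμ i)

variable {m : ℕ}

open scoped MatrixOrder in
theorem isClosed_setOf_nonneg_matrix : IsClosed {a : Matrix (Fin m) (Fin m) ℝ | 0 ≤ a} := by
  simp only [Matrix.nonneg_iff_posSemidef, Matrix.posSemidef_iff_dotProduct_mulVec, Set.ofPred_and,
    Set.ofPred_forall]
  refine IsClosed.inter ?_ (isClosed_iInter fun x => ?_)
  · exact isClosed_eq (by fun_prop) continuous_id
  · exact isClosed_le continuous_const (by fun_prop)

open scoped MatrixOrder Matrix.Norms.L2Operator in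
theorem measurable_sqrt_apply {Q : γ → Matrix (Fin m) (Fin m) ℝ}
    (hQ : ∀ i j, Measurable fun c => Q c i j) (i j : Fin m) :
    Measurable fun c => CFC.sqrt (Q c) i j := by
  classical
  let sqrt (a : Fin m → Fin m → ℝ) (i j : Fin m) : ℝ :=
    CFC.sqrt (Matrix.of a : Matrix (Fin m) (Fin m) ℝ) i j
  let nonneg : Set (Fin m → Fin m → ℝ) :=
    {a | 0 ≤ (Matrix.of a : Matrix (Fin m) (Fin m) ℝ)}
  have closed : IsClosed nonneg := isClosed_setOf_nonneg_matrix
  have cont : ContinuousOn sqrt nonneg :=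
    CFC.continuousOn_sqrt (A := Matrix (Fin m) (Fin m) ℝ)
  have extend : sqrt = nonneg.piecewise sqrt 0 := by
    ext a i j
    by_cases ha : a ∈ nonneg
    · rw [Set.piecewise_eq_of_mem _ _ _ ha]
    · rw [Set.piecewise_eq_of_notMem _ _ _ ha]
      simp only [sqrt]
      rw [CFC.sqrt_of_not_nonneg ha]
      rfl
  have meas : Measurable sqrt := by
    rw [extend]
    exact cont.measurable_piecewise continuousOn_const closed.measurableSet
  have entries : Measurable fun c i j => Q c i j :=
    measurable_pi_lambda _ fun i => measurable_pi_lambda _ fun j => hQ i j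
  exact measurable_pi_iff.1 (measurable_pi_iff.1 (meas.comp entries) i) j

open scoped MatrixOrder in
theorem measurable_multivariateGaussian {μ : γ → EuclideanSpace ℝ (Fin m)} (hμ : Measurable μ)
    {Q : γ → Matrix (Fin m) (Fin m) ℝ} (hQ : ∀ i j, Measurable fun c => Q c i j) :
    Measurable fun c => multivariateGaussian (μ c) (Q c) := by
  refine measurable_map_param _ ((hμ.comp measurable_fst).add ((WithLp.measurable_toLp 2 _).comp
    (measurable_pi_lambda _ fun i => ?_)))
  change Measurable fun p : γ × EuclideanSpace ℝ (Fin m) => ∑ j, CFC.sqrt (Q p.1) i j * p.2 j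
  exact Finset.measurable_sum _ fun j _ =>
    ((measurable_sqrt_apply hQ i j).comp measurable_fst).mul (by fun_prop)

theorem measurable_gaussianReal_toNNReal {μ v : γ → ℝ} (hμ : Measurable μ) (hv : Measurable v) :
    Measurable fun c => gaussianReal (μ c) (v c).toNNReal :=
  measurable_gaussianReal.comp (hμ.prodMk hv.real_toNNReal)

theorem measurable_matrix_inv_apply {Q : γ → Matrix (Fin m) (Fin m) ℝ}
    (hQ : ∀ i j, Measurable fun c => Q c i j) (i j : Fin m) :
    Measurable fun c => (Q c)⁻¹ i j := by
  simp_rw [Matrix.inv_def, Matrix.smul_apply, smul_eq_mul, Ring.inverse_eq_inv',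
    Matrix.adjugate_apply, Matrix.det_apply]
  refine Measurable.mul (Measurable.inv (Finset.measurable_sum _ fun s _ => ?_))
    (Finset.measurable_sum _ fun s _ => ?_)
  · exact (Finset.measurable_prod _ fun i _ => hQ _ _).const_smul _
  · refine (Finset.measurable_prod _ fun k _ => ?_).const_smul (Equiv.Perm.sign s)
    by_cases h : s k = j
    · simp [h, Matrix.updateRow_apply]
    · simpa [h, Matrix.updateRow_apply] using hQ _ _

theorem measurable_dotProduct_inv_mulVec {Q : γ → Matrix (Fin m) (Fin m) ℝ}
    (hQ : ∀ i j, Measurable fun c => Q c i j) {u v : γ → Fin m → ℝ} (hu : Measurable u)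
    (hv : Measurable v) : Measurable fun c => u c ⬝ᵥ (Q c)⁻¹.mulVec (v c) := by
  simp only [dotProduct, Matrix.mulVec]
  exact Finset.measurable_sum _ fun i _ => (measurable_pi_iff.1 hu i).mul
    (Finset.measurable_sum _ fun j _ =>
      (measurable_matrix_inv_apply hQ i j).mul (measurable_pi_iff.1 hv j))

end Measurability

section Kernels

variable {d m n : ℕ} {S : Set (EuclideanSpace ℝ (Fin d))}

theorem measurable_nu : Measurable (SecondLayer.nu (d := d)) := measurable_fst

theorem measurable_sigmaSq : Measurable (SecondLayer.sigmaSq (d := d)) :=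
  measurable_fst.comp measurable_snd

theorem measurable_baseCov (p q : S) : Measurable fun θ : SecondLayer d => baseCov θ p q := by
  unfold baseCov SecondLayer.sigmaSq SecondLayer.phi
  fun_prop

theorem measurable_crossCov (x : Fin n → S) (p : S) :
    Measurable fun θ : SecondLayer d => crossCov θ x p :=
  measurable_pi_lambda _ fun i => measurable_baseCov p (x i)

theorem measurable_krigMean (x : Fin n → S) (p : S) :
    Measurable fun c : SecondLayer d × (Fin n → ℝ) => krigMean c.1 x c.2 p :=
  measurable_dotProduct_inv_mulVec
    (fun i j => (measurable_baseCov (x i) (x j)).comp measurable_fst)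
    ((measurable_crossCov x p).comp measurable_fst) measurable_snd

theorem measurable_krigCov (x : Fin n → S) (p q : S) :
    Measurable fun θ : SecondLayer d => krigCov θ x p q :=
  (measurable_baseCov p q).sub (measurable_dotProduct_inv_mulVec
    (fun i j => measurable_baseCov (x i) (x j)) (measurable_crossCov x p)
    (measurable_crossCov x q))

theorem measurable_krigVar (x : Fin n → S) (p : S) :
    Measurable fun θ : SecondLayer d => krigVar θ x p :=
  measurable_sigmaSq.sub (measurable_dotProduct_inv_mulVec
    (fun i j => measurable_baseCov (x i) (x j)) (measurable_crossCov x p)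
    (measurable_crossCov x p))

theorem measurable_baseGP (p : Fin m → S) : Measurable fun θ : SecondLayer d => baseGP θ p :=
  measurable_multivariateGaussian measurable_const fun _ _ => measurable_baseCov _ _

theorem measurable_krigGP (x : Fin n → S) (p : Fin m → S) :
    Measurable fun c : SecondLayer d × (Fin n → ℝ) => krigGP c.1 x c.2 p :=
  measurable_multivariateGaussian
    ((WithLp.measurable_toLp 2 _).comp (measurable_pi_lambda _ fun _ => measurable_krigMean x _))
    fun _ _ => (measurable_krigCov x _ _).comp measurable_fst

instance (θ : SecondLayer d) (p : Fin m → S) : IsProbabilityMeasure (baseGP θ p) :=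
  inferInstanceAs (IsProbabilityMeasure (multivariateGaussian _ _))

instance (θ : SecondLayer d) (x : Fin n → S) (v : Fin n → ℝ) (p : Fin m → S) :
    IsProbabilityMeasure (krigGP θ x v p) :=
  inferInstanceAs (IsProbabilityMeasure (multivariateGaussian _ _))

theorem measurable_urnKriging (x : Fin n → S) (z : Fin n → ℕ) (p : Fin m → S) :
    Measurable fun c : (Fin n → Fin n → ℝ) × SecondLayer d => urnKriging c.2 x c.1 z p := by
  have := measurable_nu (d := d)
  have new : Measurable fun c : (Fin n → Fin n → ℝ) × SecondLayer d =>
      (Measure.dirac (numSurfaces z)).prod (baseGP c.2 p) :=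
    (measurable_dirac_prod _ (measurable_baseGP p)).comp measurable_snd
  have realized : ∀ j : Fin n, Measurable fun c : (Fin n → Fin n → ℝ) × SecondLayer d =>
      (Measure.dirac (j : ℕ)).prod (krigGP c.2 x (c.1 j) p) := fun j =>
    (measurable_dirac_prod (j : ℕ) (measurable_krigGP x p)).comp
      (f := fun c : (Fin n → Fin n → ℝ) × SecondLayer d => (c.2, c.1 j)) (by fun_prop)
  exact .add (measurable_smul_measure (by fun_prop) new) (Finset.measurable_sum
    (Finset.univ.filter fun j : Fin n => (j : ℕ) < numSurfaces z) fun j _ =>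
    measurable_smul_measure
      (w := fun c => ENNReal.ofReal (surfaceCount z j / (c.2.nu + n))) (by fun_prop) (realized j))

theorem measurable_gpMixture (x : Fin n → S) (z : Fin n → ℕ) (p : S) :
    Measurable fun c : (Fin n → Fin n → ℝ) × SecondLayer d => gpMixture c.2 x c.1 z p := by
  have := measurable_nu (d := d)
  have new : Measurable fun c : (Fin n → Fin n → ℝ) × SecondLayer d =>
      gaussianReal 0 c.2.sigmaSq.toNNReal :=
    measurable_gaussianReal_toNNReal measurable_const (measurable_sigmaSq.comp measurable_snd)
  have realized : ∀ j : Fin n, Measurable fun c : (Fin n → Fin n → ℝ) × SecondLayer d =>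
      gaussianReal (krigMean c.2 x (c.1 j) p) (krigVar c.2 x p).toNNReal := fun j =>
    measurable_gaussianReal_toNNReal
      ((measurable_krigMean x p).comp
        (f := fun c : (Fin n → Fin n → ℝ) × SecondLayer d => (c.2, c.1 j)) (by fun_prop))
      ((measurable_krigVar x p).comp measurable_snd)
  exact .add (measurable_smul_measure (by fun_prop) new) (Finset.measurable_sum
    (Finset.univ.filter fun j : Fin n => (j : ℕ) < numSurfaces z) fun j _ =>
    measurable_smul_measure
      (w := fun c => ENNReal.ofReal (surfaceCount z j / (c.2.nu + n))) (by fun_prop) (realized j))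

/-- The values of `K` independent surfaces with law `G₀` at `p₁, …, p_m`, as a kernel in
`Θ⁽²⁾`. -/
def baseKernel (K : ℕ) (p : Fin m → S) :
    Kernel (SecondLayer d) (Fin K → EuclideanSpace ℝ (Fin m)) where
  toFun θ := Measure.pi fun _ => baseGP θ p
  measurable' := measurable_measure_pi fun _ => measurable_baseGP p

instance (K : ℕ) (p : Fin m → S) : IsMarkovKernel (baseKernel K p) :=
  ⟨fun θ => inferInstanceAs (IsProbabilityMeasure (Measure.pi fun _ => baseGP θ p))⟩

/-- The urn scheme followed by kriging, as a kernel in the table of realized values, the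
assignments and `Θ⁽²⁾`. It is a finite measure for every value of `Θ⁽²⁾`, but its mass is not
bounded, since `ν` ranges over all reals. -/
def urnKernel (x : Fin n → S) (p : Fin m → S) :
    Kernel ((Fin n → Fin n → ℝ) × (Fin n → ℕ) × SecondLayer d)
      (ℕ × EuclideanSpace ℝ (Fin m)) where
  toFun c := urnKriging c.2.2 x c.1 c.2.1 p
  measurable' := (measurable_from_prod_countable_left
      (f := fun c : ((Fin n → Fin n → ℝ) × SecondLayer d) × (Fin n → ℕ) =>
        urnKriging c.1.2 x c.1.1 c.2 p) fun z => measurable_urnKriging x z p).comp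
    (f := fun c : (Fin n → Fin n → ℝ) × (Fin n → ℕ) × SecondLayer d => ((c.1, c.2.2), c.2.1))
    (by fun_prop)

instance (x : Fin n → S) (p : Fin m → S) : IsSFiniteKernel (urnKernel x p) := by
  have : ∀ c, IsFiniteMeasure (urnKernel x p c) := fun c => by
    change IsFiniteMeasure (urnKriging c.2.2 x c.1 c.2.1 p)
    constructor
    simp [urnKriging]
  exact isSFiniteKernel_of_isFiniteMeasure _

/-- Term B of the predictive distribution, as a kernel in the table of realized values, the
assignments and `Θ⁽²⁾`. -/
def mixtureKernel (x : Fin n → S) (p : S) :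
    Kernel ((Fin n → Fin n → ℝ) × (Fin n → ℕ) × SecondLayer d) ℝ where
  toFun c := gpMixture c.2.2 x c.1 c.2.1 p
  measurable' := (measurable_from_prod_countable_left
      (f := fun c : ((Fin n → Fin n → ℝ) × SecondLayer d) × (Fin n → ℕ) =>
        gpMixture c.1.2 x c.1.1 c.2 p) fun z => measurable_gpMixture x z p).comp
    (f := fun c : (Fin n → Fin n → ℝ) × (Fin n → ℕ) × SecondLayer d => ((c.1, c.2.2), c.2.1))
    (by fun_prop)

instance (x : Fin n → S) (p : S) : IsSFiniteKernel (mixtureKernel x p) := by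
  have : ∀ c, IsFiniteMeasure (mixtureKernel x p c) := fun c => by
    change IsFiniteMeasure (gpMixture c.2.2 x c.1 c.2.1 p)
    constructor
    simp [gpMixture]
  exact isSFiniteKernel_of_isFiniteMeasure _

/-- Term A of the predictive distribution, as a kernel in `Θ⁽¹⁾` and the value of the surface at
`p`. -/
def obsKernel (p : S) : Kernel (FirstLayer d × ℝ) ℝ where
  toFun c := gaussianReal (inner ℝ p.1 c.1.1 + c.2) c.1.2.toNNReal
  measurable' := measurable_gaussianReal_toNNReal (by fun_prop) (by fun_prop)

instance (p : S) : IsMarkovKernel (obsKernel p) :=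
  ⟨fun c => inferInstanceAs
    (IsProbabilityMeasure (gaussianReal (inner ℝ p.1 c.1.1 + c.2) c.1.2.toNNReal))⟩

/-- The law of the first `m` noise variables, as a kernel in `Θ⁽¹⁾`. -/
def noiseKernel (d m : ℕ) : Kernel (FirstLayer d) (Fin m → ℝ) where
  toFun θ := Measure.pi fun _ => gaussianReal 0 θ.2.toNNReal
  measurable' := measurable_measure_pi fun _ =>
    measurable_gaussianReal_toNNReal measurable_const measurable_snd

instance (d m : ℕ) : IsMarkovKernel (noiseKernel d m) :=
  ⟨fun θ => inferInstanceAs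
    (IsProbabilityMeasure (Measure.pi fun _ => gaussianReal 0 θ.2.toNNReal))⟩

end Kernels

/-! ### Kriging -/

section GaussKernel

variable {E : Type*} [NormedAddCommGroup E] {ι : Type*} [Fintype ι]

/-- The Gaussian kernel `exp (-‖u - v‖² / 2)`, to which the covariance function `Σ₀` reduces after
rescaling the coordinates. -/
def gaussKernel (u v : E) : ℝ := Real.exp (-‖u - v‖ ^ 2 / 2)

theorem gaussKernel_comm (u v : E) : gaussKernel u v = gaussKernel v u := by
  rw [gaussKernel, gaussKernel, norm_sub_rev]

theorem gaussKernel_self (u : E) : gaussKernel u u = 1 := by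
  simp [gaussKernel]

variable [InnerProductSpace ℝ E]

theorem gaussKernel_eq_mul_exp_inner (u v : E) :
    gaussKernel u v
      = Real.exp (-‖v‖ ^ 2 / 2) * (Real.exp (-‖u‖ ^ 2 / 2) * Real.exp (inner ℝ u v)) := by
  rw [gaussKernel, norm_sub_sq_real, ← Real.exp_add, ← Real.exp_add]
  congr 1
  ring

theorem integrable_cos_inner [MeasurableSpace E] [BorelSpace E] [SecondCountableTopology E]
    (μ : Measure E) [IsFiniteMeasure μ] (t : E) : Integrable (fun w => Real.cos (inner ℝ w t)) μ :=
  .of_bound (Measurable.aestronglyMeasurable (by fun_prop)) 1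
    (ae_of_all _ fun w => by simpa using Real.abs_cos_le_one _)

theorem exp_neg_norm_sq_eq_integral_cos [FiniteDimensional ℝ E] [MeasurableSpace E] [BorelSpace E]
    (t : E) : Real.exp (-‖t‖ ^ 2 / 2) = ∫ w, Real.cos (inner ℝ w t) ∂stdGaussian E := by
  have integrable_exp : Integrable (fun w : E => Complex.exp (inner ℝ w t * Complex.I))
      (stdGaussian E) :=
    .of_bound (Measurable.aestronglyMeasurable (by fun_prop)) 1
      (ae_of_all _ fun w => by rw [Complex.norm_exp_ofReal_mul_I])
  have re_charFun := congrArg Complex.re (charFun_stdGaussian t)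
  rw [charFun_apply, ← RCLike.re_to_complex, ← integral_re integrable_exp] at re_charFun
  simp only [RCLike.re_to_complex, Complex.exp_ofReal_mul_I_re] at re_charFun
  rw [re_charFun]
  norm_cast

theorem sum_mul_cos_sub (c a : ι → ℝ) :
    ∑ i, ∑ j, c i * c j * Real.cos (a i - a j)
      = (∑ i, c i * Real.cos (a i)) ^ 2 + (∑ i, c i * Real.sin (a i)) ^ 2 := by
  simp_rw [sq, Finset.sum_mul_sum, ← Finset.sum_add_distrib, Real.cos_sub]
  exact Finset.sum_congr rfl fun i _ => Finset.sum_congr rfl fun j _ => by ring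

theorem sum_gaussKernel_nonneg [FiniteDimensional ℝ E] (s : ι → E) (c : ι → ℝ) :
    0 ≤ ∑ i, ∑ j, c i * c j * gaussKernel (s i) (s j) := by
  borelize E
  have integrable_term : ∀ i j, Integrable
      (fun w => c i * c j * Real.cos (inner ℝ w (s i) - inner ℝ w (s j))) (stdGaussian E) :=
    fun i j => by
      simp_rw [← inner_sub_right]
      exact (integrable_cos_inner _ _).const_mul _
  calc 0 ≤ ∫ w, (∑ i, c i * Real.cos (inner ℝ w (s i))) ^ 2
        + (∑ i, c i * Real.sin (inner ℝ w (s i))) ^ 2 ∂stdGaussian E :=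
      integral_nonneg fun w => by positivity
    _ = ∑ i, ∑ j, c i * c j * gaussKernel (s i) (s j) := by
      simp_rw [← sum_mul_cos_sub]
      rw [integral_finsetSum _ fun i _ => integrable_finsetSum _ fun j _ => integrable_term i j]
      refine Finset.sum_congr rfl fun i _ => ?_
      rw [integral_finsetSum _ fun j _ => integrable_term i j]
      refine Finset.sum_congr rfl fun j _ => ?_
      simp_rw [← inner_sub_right]
      rw [integral_const_mul, ← exp_neg_norm_sq_eq_integral_cos, gaussKernel]

-- Adding the point `y` with weight `-b`, where `b` is the sum, makes the quadratic form `-b²`.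
theorem sum_mul_gaussKernel_eq_zero [FiniteDimensional ℝ E] {s : ι → E} {c : ι → ℝ}
    (h : ∑ i, ∑ j, c i * c j * gaussKernel (s i) (s j) = 0) (y : E) :
    ∑ i, c i * gaussKernel (s i) y = 0 := by
  set b := ∑ i, c i * gaussKernel (s i) y with hb
  have augmented :=
    sum_gaussKernel_nonneg (ι := Option ι) (fun o => o.elim y s) (fun o => o.elim (-b) c)
  have row : ∑ i, -b * c i * gaussKernel y (s i) = -b * b := by
    conv_rhs => rw [hb, Finset.mul_sum]
    exact Finset.sum_congr rfl fun i _ => by rw [gaussKernel_comm]; ring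
  have column : ∑ i, c i * -b * gaussKernel (s i) y = -b * b := by
    conv_rhs => rw [hb, Finset.mul_sum]
    exact Finset.sum_congr rfl fun i _ => by ring
  simp only [Fintype.sum_option, Option.elim, Finset.sum_add_distrib, h, row, column,
    gaussKernel_self] at augmented
  nlinarith [sq_nonneg b]

/-- The character `exp ⟨u, ·⟩` of the additive group of `E`; distinct characters are linearly
independent. -/
def expInnerChar (u : E) : Multiplicative E →* ℝ where
  toFun y := Real.exp (inner ℝ u y.toAdd)
  map_one' := by simp
  map_mul' a b := by rw [toAdd_mul, inner_add_right, Real.exp_add]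

theorem expInnerChar_injective : Function.Injective (expInnerChar (E := E)) := fun _ _ h =>
  ext_inner_right ℝ fun y => Real.exp_injective (DFunLike.congr_fun h (Multiplicative.ofAdd y))

theorem eq_zero_of_sum_gaussKernel_eq_zero [FiniteDimensional ℝ E] {s : ι → E}
    (hs : Function.Injective s) {c : ι → ℝ}
    (h : ∑ i, ∑ j, c i * c j * gaussKernel (s i) (s j) = 0) : c = 0 := by
  have independent := Fintype.linearIndependent_iff.1
    ((linearIndependent_monoidHom (Multiplicative E) ℝ).comp (expInnerChar ∘ s)
      (expInnerChar_injective.comp hs))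
  have combination : ∑ i, (c i * Real.exp (-‖s i‖ ^ 2 / 2)) • ⇑(expInnerChar (s i)) = 0 := by
    funext y
    have := sum_mul_gaussKernel_eq_zero h y.toAdd
    simp_rw [gaussKernel_eq_mul_exp_inner, mul_left_comm (c _) (Real.exp (-‖y.toAdd‖ ^ 2 / 2)),
      ← Finset.mul_sum] at this
    simpa [expInnerChar, mul_assoc] using this
  funext i
  exact (mul_eq_zero.1 (independent _ combination i)).resolve_right (Real.exp_pos _).ne'

end GaussKernel

section Kriging

variable {d m n : ℕ} {S : Set (EuclideanSpace ℝ (Fin d))}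

/-- The range of `Θ⁽²⁾` that carries the prior: `ν`, `σ²` and all `φ_k` are positive. -/
def SecondLayer.Admissible (θ : SecondLayer d) : Prop :=
  0 < θ.nu ∧ 0 < θ.sigmaSq ∧ ∀ k, 0 < θ.phi k

theorem baseCov_self (θ : SecondLayer d) (p : S) : baseCov θ p p = θ.sigmaSq := by
  simp [baseCov]

theorem baseCov_comm (θ : SecondLayer d) (p q : S) : baseCov θ p q = baseCov θ q p := by
  simp only [baseCov, sub_sq_comm]

/-- The coordinates `√(2 φ_k) p⁽ᵏ⁾`, in which `Σ₀` becomes the Gaussian kernel. -/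
def rescale (θ : SecondLayer d) (p : S) : EuclideanSpace ℝ (Fin d) :=
  WithLp.toLp 2 fun k => √(2 * θ.phi k) * p.1 k

theorem baseCov_eq_gaussKernel {θ : SecondLayer d} (hφ : ∀ k, 0 < θ.phi k) (p q : S) :
    baseCov θ p q = θ.sigmaSq * gaussKernel (rescale θ p) (rescale θ q) := by
  rw [baseCov, gaussKernel, EuclideanSpace.real_norm_sq_eq, neg_div, Finset.sum_div]
  congr 3
  refine Finset.sum_congr rfl fun k _ => ?_
  rw [show (rescale θ p - rescale θ q) k = √(2 * θ.phi k) * (p.1 k - q.1 k) by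
    simp [rescale, mul_sub], mul_pow, Real.sq_sqrt (by have := hφ k; positivity)]
  ring

theorem rescale_injective {θ : SecondLayer d} (hφ : ∀ k, 0 < θ.phi k) :
    Function.Injective (rescale θ : S → _) := fun p q h => by
  ext k
  have coord_eq : √(2 * θ.phi k) * p.1 k = √(2 * θ.phi k) * q.1 k :=
    congrArg (fun v : EuclideanSpace ℝ (Fin d) => v k) h
  exact mul_left_cancel₀ (Real.sqrt_pos.2 (by have := hφ k; positivity)).ne' coord_eq

theorem dotProduct_gram_mulVec {θ : SecondLayer d} (hφ : ∀ k, 0 < θ.phi k) (p : Fin m → S)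
    (c : Fin m → ℝ) : c ⬝ᵥ (gram θ p).mulVec c
      = θ.sigmaSq * ∑ i, ∑ j, c i * c j * gaussKernel (rescale θ (p i)) (rescale θ (p j)) := by
  simp only [dotProduct, Matrix.mulVec, gram, Matrix.of_apply, Finset.mul_sum,
    baseCov_eq_gaussKernel hφ]
  exact Finset.sum_congr rfl fun i _ => Finset.sum_congr rfl fun j _ => by ring

theorem isHermitian_gram (θ : SecondLayer d) (p : Fin m → S) : (gram θ p).IsHermitian := by
  ext i j
  simp [gram, baseCov_comm θ (p j)]

theorem posSemidef_gram {θ : SecondLayer d} (hθ : θ.Admissible) (p : Fin m → S) :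
    (gram θ p).PosSemidef := by
  refine Matrix.posSemidef_iff_dotProduct_mulVec.2 ⟨isHermitian_gram θ p, fun c => ?_⟩
  rw [star_trivial, dotProduct_gram_mulVec hθ.2.2]
  exact mul_nonneg hθ.2.1.le (sum_gaussKernel_nonneg _ c)

theorem posDef_gram {θ : SecondLayer d} (hθ : θ.Admissible) {x : Fin n → S}
    (hx : Function.Injective x) : (gram θ x).PosDef := by
  refine Matrix.posDef_iff_dotProduct_mulVec.2 ⟨isHermitian_gram θ x, fun c hc => ?_⟩
  rw [star_trivial, dotProduct_gram_mulVec hθ.2.2]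
  refine mul_pos hθ.2.1 ((sum_gaussKernel_nonneg _ c).lt_of_ne' fun h => hc ?_)
  exact eq_zero_of_sum_gaussKernel_eq_zero ((rescale_injective hθ.2.2).comp hx) h

/-- The matrix `Σ₀(x_{1:n}, p_{1:m})`. -/
def crossGram (θ : SecondLayer d) (x : Fin n → S) (p : Fin m → S) : Matrix (Fin n) (Fin m) ℝ :=
  Matrix.of fun i a => baseCov θ (x i) (p a)

/-- Covariance matrix of the kriging process at `p₁, …, p_m`. -/
def krigGram (θ : SecondLayer d) (x : Fin n → S) (p : Fin m → S) : Matrix (Fin m) (Fin m) ℝ :=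
  Matrix.of fun a b => krigCov θ x (p a) (p b)

theorem crossCov_eq_col (θ : SecondLayer d) (x : Fin n → S) (p : Fin m → S) (a : Fin m) :
    crossCov θ x (p a) = (crossGram θ x p).col a :=
  funext fun i => baseCov_comm θ (p a) (x i)

theorem krigGram_eq (θ : SecondLayer d) (x : Fin n → S) (p : Fin m → S) :
    krigGram θ x p
      = gram θ p - (crossGram θ x p).conjTranspose * (gram θ x)⁻¹ * crossGram θ x p := by
  ext a b
  rw [krigGram, Matrix.of_apply, krigCov, crossCov_eq_col, crossCov_eq_col, Matrix.mul_assoc]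
  rfl

theorem krigMean_eq (θ : SecondLayer d) (x : Fin n → S) (p : Fin m → S) (v : Fin n → ℝ) :
    (fun a => krigMean θ x v (p a))
      = (crossGram θ x p).conjTranspose.mulVec ((gram θ x)⁻¹.mulVec v) := by
  funext a
  rw [krigMean, crossCov_eq_col]
  rfl

theorem krigMean_dotProduct (θ : SecondLayer d) (x : Fin n → S) (p : Fin m → S) (v : Fin n → ℝ)
    (t : Fin m → ℝ) : (fun a => krigMean θ x v (p a)) ⬝ᵥ t
      = v ⬝ᵥ ((gram θ x)⁻¹ * crossGram θ x p).mulVec t := by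
  have inv_symm : (gram θ x)⁻¹.transpose = (gram θ x)⁻¹ := (isHermitian_gram θ x).inv
  rw [krigMean_eq, Matrix.conjTranspose_eq_transpose_of_trivial, Matrix.mulVec_transpose,
    ← Matrix.dotProduct_mulVec, ← Matrix.mulVec_mulVec, Matrix.dotProduct_mulVec v,
    ← Matrix.mulVec_transpose, inv_symm]

theorem gram_append (θ : SecondLayer d) (x : Fin n → S) (p : Fin m → S) :
    (gram θ (Fin.append x p)).submatrix finSumFinEquiv finSumFinEquiv
      = Matrix.fromBlocks (gram θ x) (crossGram θ x p) (crossGram θ x p).conjTranspose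
          (gram θ p) := by
  ext i j
  rcases i with i | i <;> rcases j with j | j <;>
    simp [gram, crossGram, baseCov_comm θ (p _) (x _)]

theorem posSemidef_krigGram {θ : SecondLayer d} (hθ : θ.Admissible) {x : Fin n → S}
    (hx : Function.Injective x) (p : Fin m → S) : (krigGram θ x p).PosSemidef := by
  have posDef := posDef_gram hθ hx
  have := posDef.isUnit.invertible
  rw [krigGram_eq, ← Matrix.PosDef.fromBlocks₁₁ _ _ posDef, ← gram_append]
  exact (posSemidef_gram hθ _).submatrix _

theorem dotProduct_gram_append {θ : SecondLayer d} (hθ : θ.Admissible) {x : Fin n → S}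
    (hx : Function.Injective x) (p : Fin m → S) (s : Fin n → ℝ) (t : Fin m → ℝ) :
    Fin.append s t ⬝ᵥ (gram θ (Fin.append x p)).mulVec (Fin.append s t)
      = (s + ((gram θ x)⁻¹ * crossGram θ x p).mulVec t)
          ⬝ᵥ (gram θ x).mulVec (s + ((gram θ x)⁻¹ * crossGram θ x p).mulVec t)
        + t ⬝ᵥ (krigGram θ x p).mulVec t := by
  have := (posDef_gram hθ hx).isUnit.invertible
  have append_eq : Fin.append s t ∘ finSumFinEquiv = Sum.elim s t := by
    funext i
    rcases i with i | i <;> simp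
  have schur :=
    Matrix.schur_complement_eq₁₁ (crossGram θ x p) (gram θ p) s t (isHermitian_gram θ x)
  simp only [star_trivial, ← Matrix.dotProduct_mulVec, ← krigGram_eq, ← gram_append] at schur
  rw [← schur, Matrix.submatrix_mulVec_equiv, ← append_eq, Function.comp_assoc,
    Equiv.self_comp_symm, Function.comp_id, comp_equiv_dotProduct_comp_equiv]

theorem inner_eq_dotProduct {ι : Type*} [Fintype ι] (u v : EuclideanSpace ℝ ι) :
    inner ℝ u v = (u : ι → ℝ) ⬝ᵥ v := by
  rw [EuclideanSpace.inner_eq_star_dotProduct, star_trivial, dotProduct_comm]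

theorem map_multivariateGaussian_comp {ι κ : Type*} [Fintype ι] [DecidableEq ι] [Fintype κ]
    [DecidableEq κ] {Q : Matrix ι ι ℝ} (hQ : Q.PosSemidef) (σ : κ → ι) :
    (multivariateGaussian 0 Q).map (fun e => (WithLp.toLp 2 fun a => e (σ a) : EuclideanSpace ℝ κ))
      = multivariateGaussian 0 (Q.submatrix σ σ) := by
  have meas : Measurable fun e : EuclideanSpace ℝ ι =>
      (WithLp.toLp 2 fun a => e (σ a) : EuclideanSpace ℝ κ) := by fun_prop
  have := Measure.isProbabilityMeasure_map (μ := multivariateGaussian 0 Q) meas.aemeasurable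
  refine Measure.ext_of_charFun (funext fun t => ?_)
  let s : EuclideanSpace ℝ ι := WithLp.toLp 2 fun i => ∑ a, if σ a = i then t a else 0
  have dotProduct_s (u : ι → ℝ) : u ⬝ᵥ s = ∑ a, u (σ a) * t a := by
    simp only [dotProduct, s, Finset.mul_sum]
    rw [Finset.sum_comm]
    exact Finset.sum_congr rfl fun a _ => by simp
  have inner_map (e : EuclideanSpace ℝ ι) :
      inner ℝ (WithLp.toLp 2 fun a => e (σ a) : EuclideanSpace ℝ κ) t = inner ℝ e s := by
    rw [inner_eq_dotProduct, inner_eq_dotProduct, dotProduct_s]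
    rfl
  have quadratic : s ⬝ᵥ Q.mulVec s = t ⬝ᵥ (Q.submatrix σ σ).mulVec t := by
    simp_rw [dotProduct_comm _ (Matrix.mulVec _ _)]
    rw [dotProduct_s]
    simp_rw [Matrix.mulVec, dotProduct_s]
    rfl
  rw [charFun_apply, integral_map meas.aemeasurable (Measurable.aestronglyMeasurable (by fun_prop))]
  simp_rw [inner_map]
  rw [← charFun_apply, charFun_multivariateGaussian hQ,
    charFun_multivariateGaussian (hQ.submatrix σ), quadratic]
  simp only [inner_zero_right]

theorem map_baseGP_comp {k : ℕ} {θ : SecondLayer d} (hθ : θ.Admissible) (q : Fin k → S)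
    (σ : Fin m → Fin k) :
    (baseGP θ q).map (fun e => (WithLp.toLp 2 fun a => e (σ a) : EuclideanSpace ℝ (Fin m)))
      = baseGP θ (q ∘ σ) :=
  map_multivariateGaussian_comp (posSemidef_gram hθ q) σ

/-- The values at `x_{1:n}` and `p_{1:m}` obtained from a pair (values at `x_{1:n}`, residuals at
`p_{1:m}`) by adding the residuals to the kriging means. -/
def krigMap (θ : SecondLayer d) (x : Fin n → S) (p : Fin m → S)
    (e : EuclideanSpace ℝ (Fin n) × EuclideanSpace ℝ (Fin m)) : EuclideanSpace ℝ (Fin (n + m)) :=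
  WithLp.toLp 2 (Fin.append e.1 fun a => krigMean θ x e.1 (p a) + e.2 a)

theorem measurable_krigMean_right (θ : SecondLayer d) (x : Fin n → S) (p : S) :
    Measurable fun v => krigMean θ x v p :=
  (measurable_krigMean x p).comp measurable_prodMk_left

theorem measurable_krigMap (θ : SecondLayer d) (x : Fin n → S) (p : Fin m → S) :
    Measurable (krigMap θ x p) := by
  refine (WithLp.measurable_toLp 2 _).comp (measurable_pi_lambda _ fun i => ?_)
  refine Fin.addCases (fun i => ?_) (fun a => ?_) i
  · simp only [Fin.append_left]
    fun_prop
  · simp only [Fin.append_right]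
    exact ((measurable_krigMean_right θ x (p a)).comp (by fun_prop)).add (by fun_prop)

theorem inner_krigMap (θ : SecondLayer d) (x : Fin n → S) (p : Fin m → S)
    (e : EuclideanSpace ℝ (Fin n) × EuclideanSpace ℝ (Fin m)) (s : Fin n → ℝ) (r : Fin m → ℝ) :
    inner ℝ (krigMap θ x p e) (WithLp.toLp 2 (Fin.append s r))
      = inner ℝ e.1 (WithLp.toLp 2 (s + ((gram θ x)⁻¹ * crossGram θ x p).mulVec r))
        + inner ℝ e.2 (WithLp.toLp 2 r) := by
  have split : (Fin.append e.1 fun a => krigMean θ x e.1 (p a) + e.2 a) ⬝ᵥ Fin.append s r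
      = e.1 ⬝ᵥ s + ((fun a => krigMean θ x e.1 (p a)) ⬝ᵥ r + e.2 ⬝ᵥ r) := by
    simp [dotProduct, Fin.sum_univ_add, add_mul, Finset.sum_add_distrib]
  simp_rw [inner_eq_dotProduct, krigMap]
  rw [split, krigMean_dotProduct, dotProduct_add, add_assoc]

theorem baseGP_append {θ : SecondLayer d} (hθ : θ.Admissible) {x : Fin n → S}
    (hx : Function.Injective x) (p : Fin m → S) :
    baseGP θ (Fin.append x p)
      = ((baseGP θ x).prod (multivariateGaussian 0 (krigGram θ x p))).map (krigMap θ x p) := by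
  have meas := measurable_krigMap θ x p
  have := Measure.isProbabilityMeasure_map (μ := (baseGP θ x).prod
    (multivariateGaussian 0 (krigGram θ x p))) meas.aemeasurable
  refine Measure.ext_of_charFun (funext fun t => ?_)
  obtain ⟨s, r, rfl⟩ : ∃ s r, t = WithLp.toLp 2 (Fin.append s r) :=
    ⟨fun i => t (Fin.castAdd m i), fun a => t (Fin.natAdd n a), by
      rw [Fin.append_castAdd_natAdd]⟩
  let w := s + ((gram θ x)⁻¹ * crossGram θ x p).mulVec r
  rw [charFun_apply (μ := Measure.map _ _),
    integral_map meas.aemeasurable (Measurable.aestronglyMeasurable (by fun_prop))]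
  simp_rw [inner_krigMap, Complex.ofReal_add, add_mul, Complex.exp_add]
  rw [integral_prod_mul
      (fun u : EuclideanSpace ℝ (Fin n) => Complex.exp (inner ℝ u (WithLp.toLp 2 w) * Complex.I))
      (fun u : EuclideanSpace ℝ (Fin m) => Complex.exp (inner ℝ u (WithLp.toLp 2 r) * Complex.I)),
    ← charFun_apply, ← charFun_apply, baseGP, baseGP,
    charFun_multivariateGaussian (posSemidef_gram hθ _),
    charFun_multivariateGaussian (posSemidef_gram hθ _),
    charFun_multivariateGaussian (posSemidef_krigGram hθ hx p), ← Complex.exp_add,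
    dotProduct_gram_append hθ hx p s r]
  congr 1
  simp only [inner_zero_right, Complex.ofReal_zero, zero_mul, zero_sub, Complex.ofReal_add, w]
  ring

theorem krigGP_eq_map (θ : SecondLayer d) (x : Fin n → S) (v : Fin n → ℝ) (p : Fin m → S) :
    krigGP θ x v p = (multivariateGaussian 0 (krigGram θ x p)).map
      fun z => WithLp.toLp 2 (fun a => krigMean θ x v (p a)) + z := by
  rw [krigGP, multivariateGaussian, multivariateGaussian,
    Measure.map_map (by fun_prop) (by fun_prop)]
  congr 1
  funext z
  simp [krigGram]

/-- The values at `x_{1:n}`, out of the values at `x_{1:n}` and `p_{1:m}`; without the Euclidean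
structure, since they enter `krigMean` as a coefficient vector. -/
def leftPart (n m : ℕ) (e : EuclideanSpace ℝ (Fin (n + m))) : Fin n → ℝ :=
  fun i => e (Fin.castAdd m i)

/-- The values at `p_{1:m}`, out of the values at `x_{1:n}` and `p_{1:m}`. -/
def rightPart (n m : ℕ) (e : EuclideanSpace ℝ (Fin (n + m))) : EuclideanSpace ℝ (Fin m) :=
  WithLp.toLp 2 fun a => e (Fin.natAdd n a)

@[fun_prop]
theorem measurable_leftPart : Measurable (leftPart n m) := by
  unfold leftPart
  fun_prop

@[fun_prop]
theorem measurable_rightPart : Measurable (rightPart n m) := by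
  unfold rightPart
  fun_prop

theorem leftPart_krigMap (θ : SecondLayer d) (x : Fin n → S) (p : Fin m → S)
    (e : EuclideanSpace ℝ (Fin n) × EuclideanSpace ℝ (Fin m)) :
    leftPart n m (krigMap θ x p e) = e.1 := by
  funext i
  simp [leftPart, krigMap]

theorem rightPart_krigMap (θ : SecondLayer d) (x : Fin n → S) (p : Fin m → S)
    (e : EuclideanSpace ℝ (Fin n) × EuclideanSpace ℝ (Fin m)) :
    rightPart n m (krigMap θ x p e) = WithLp.toLp 2 (fun a => krigMean θ x e.1 (p a)) + e.2 := by
  ext i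
  simp [rightPart, krigMap]

theorem map_rightPart_baseGP {θ : SecondLayer d} (hθ : θ.Admissible) (x : Fin n → S)
    (p : Fin m → S) : (baseGP θ (Fin.append x p)).map (rightPart n m) = baseGP θ p := by
  have := map_baseGP_comp hθ (Fin.append x p) (Fin.natAdd n)
  rwa [show Fin.append x p ∘ Fin.natAdd n = p by ext; simp] at this

/-- The kriging process at `p₁, …, p_m`, as a kernel in the values of the surface at `x_{1:n}`. -/
def krigKernel (θ : SecondLayer d) (x : Fin n → S) (p : Fin m → S) :
    Kernel (Fin n → ℝ) (EuclideanSpace ℝ (Fin m)) where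
  toFun v := krigGP θ x v p
  measurable' :=
    (measurable_krigGP x p).comp (g := fun c : SecondLayer d × (Fin n → ℝ) => krigGP c.1 x c.2 p)
      (f := fun v => (θ, v)) measurable_prodMk_left

instance (θ : SecondLayer d) (x : Fin n → S) (p : Fin m → S) :
    IsMarkovKernel (krigKernel θ x p) :=
  ⟨fun v => inferInstanceAs (IsProbabilityMeasure (krigGP θ x v p))⟩

theorem hasCondDistrib_krigKernel {θ : SecondLayer d} (hθ : θ.Admissible) {x : Fin n → S}
    (hx : Function.Injective x) (p : Fin m → S) :
    HasCondDistrib (rightPart n m) (leftPart n m) (krigKernel θ x p)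
      (baseGP θ (Fin.append x p)) := by
  have residual : HasCondDistrib Prod.snd Prod.fst
      ((Kernel.const (Fin n → ℝ) (multivariateGaussian 0 (krigGram θ x p))).comap WithLp.ofLp
        (by fun_prop))
      ((baseGP θ x).prod (multivariateGaussian 0 (krigGram θ x p))) :=
    ⟨by fun_prop, by
      rw [show (fun e : EuclideanSpace ℝ (Fin n) × EuclideanSpace ℝ (Fin m) => (e.1, e.2)) = id
        from rfl, Measure.map_id, ← Measure.fst, Measure.fst_prod]
      exact Measure.compProd_const.symm⟩
  have add_mean : Measurable fun c : (Fin n → ℝ) × EuclideanSpace ℝ (Fin m) =>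
      WithLp.toLp 2 (fun a => krigMean θ x c.1 (p a)) + c.2 := by
    have := fun a => measurable_krigMean_right θ x (p a)
    fun_prop
  have joint := hasCondDistrib_comp_prodMk (η := krigKernel θ x p)
    (κ := Kernel.const _ (multivariateGaussian 0 (krigGram θ x p))) residual.comp_right add_mean
    (.of_forall fun c => krigGP_eq_map θ x _ p)
  have meas := measurable_krigMap θ x p
  constructor
  · exact (measurable_leftPart.prodMk measurable_rightPart).aemeasurable
  · rw [baseGP_append hθ hx, Measure.map_map (by fun_prop) meas,
      Measure.map_map measurable_leftPart meas]
    convert joint.map_eq using 3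
    · exact Prod.ext (leftPart_krigMap θ x p _) (rightPart_krigMap θ x p _)
    · exact funext (leftPart_krigMap θ x p)

theorem map_baseGP_eval {θ : SecondLayer d} (hθ : θ.Admissible) (p : Fin m → S) (a : Fin m) :
    (baseGP θ p).map (fun u => u a) = gaussianReal 0 θ.sigmaSq.toNNReal := by
  rw [baseGP, (measurePreserving_eval_multivariateGaussian (posSemidef_gram hθ p)).map_eq]
  simp [gram, baseCov_self]

theorem map_krigGP_eval {θ : SecondLayer d} (hθ : θ.Admissible) {x : Fin n → S}
    (hx : Function.Injective x) (v : Fin n → ℝ) (p : Fin m → S) (a : Fin m) :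
    (krigGP θ x v p).map (fun u => u a)
      = gaussianReal (krigMean θ x v (p a)) (krigVar θ x (p a)).toNNReal := by
  have marginal := (measurePreserving_eval_multivariateGaussian
    (μ := WithLp.toLp 2 fun a => krigMean θ x v (p a))
    (posSemidef_krigGram hθ hx p) (i := a)).map_eq
  rwa [show krigGram θ x p a a = krigVar θ x (p a) by
    simp [krigGram, krigVar, krigCov, baseCov_self]] at marginal

theorem gpMixture_eq_map {θ : SecondLayer d} (hθ : θ.Admissible) {x : Fin n → S}
    (hx : Function.Injective x) (t : Fin n → Fin n → ℝ) (z : Fin n → ℕ) (p : S) :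
    gpMixture θ x t z p = (urnKriging θ x t z fun _ : Fin 1 => p).map fun u => u.2 0 := by
  have meas : Measurable fun u : ℕ × EuclideanSpace ℝ (Fin 1) => u.2 0 := by fun_prop
  have map_dirac_prod (k : ℕ) (μ : Measure (EuclideanSpace ℝ (Fin 1))) [SFinite μ] :
      ((Measure.dirac k).prod μ).map (fun u : ℕ × EuclideanSpace ℝ (Fin 1) => u.2 0)
        = μ.map fun u => u 0 := by
    rw [Measure.dirac_prod, Measure.map_map meas measurable_prodMk_left]
    rfl
  rw [gpMixture, urnKriging, Measure.map_add _ _ meas, ← Measure.mapₗ_apply_of_measurable meas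
    (Finset.sum _ _), map_sum]
  simp_rw [Measure.mapₗ_apply_of_measurable meas, Measure.map_smul, map_dirac_prod,
    map_baseGP_eval hθ, map_krigGP_eval hθ hx]

end Kriging

/-! ### Stick-breaking moments -/

section BetaMoment

/-- The mixed moment `E[V ^ s (1 - V) ^ t]` of `V ∼ Beta(1, ν)`. -/
def betaMoment (ν : ℝ) (s t : ℕ) : ENNReal :=
  ∫⁻ v, ENNReal.ofReal (v ^ s * (1 - v) ^ t) ∂betaMeasure 1 ν

theorem betaPDF_mul_pow_mul_pow {ν : ℝ} (hν : 0 < ν) (s t : ℕ) (v : ℝ) :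
    betaPDF 1 ν v * ENNReal.ofReal (v ^ s * (1 - v) ^ t)
      = ENNReal.ofReal (beta (s + 1) (ν + t) / beta 1 ν) * betaPDF (s + 1) (ν + t) v := by
  have beta_ν := beta_pos one_pos hν
  have beta_st := beta_pos (show (0 : ℝ) < s + 1 by positivity) (show (0 : ℝ) < ν + t by positivity)
  rw [betaPDF_eq, betaPDF_eq]
  split_ifs with hv
  · have := hv.1
    have := sub_pos.2 hv.2
    rw [← ENNReal.ofReal_mul (by positivity), ← ENNReal.ofReal_mul (by positivity),
      add_sub_cancel_right, Real.rpow_natCast, sub_self, Real.rpow_zero,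
      show ν + t - 1 = ν - 1 + t by ring, Real.rpow_add (sub_pos.2 hv.2), Real.rpow_natCast]
    congr 1
    field_simp
  · simp

theorem betaMoment_eq {ν : ℝ} (hν : 0 < ν) (s t : ℕ) :
    betaMoment ν s t = ENNReal.ofReal
      (ν * Real.Gamma (s + 1) * Real.Gamma (ν + t) / Real.Gamma (ν + s + t + 1)) := by
  have density : betaMoment ν s t
      = ∫⁻ v, betaPDF 1 ν v * ENNReal.ofReal (v ^ s * (1 - v) ^ t) := by
    rw [betaMoment, betaMeasure, lintegral_withDensity_eq_lintegral_mul _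
      (by unfold betaPDF; fun_prop) (by fun_prop)]
    rfl
  have := Real.Gamma_pos_of_pos hν
  have := Real.Gamma_pos_of_pos (show 0 < ν + s + t + 1 by positivity)
  simp_rw [density, betaPDF_mul_pow_mul_pow hν]
  rw [lintegral_const_mul' _ _ ENNReal.ofReal_ne_top,
    lintegral_betaPDF_eq_one (by positivity) (by positivity), mul_one, beta, beta, Real.Gamma_one,
    one_mul, add_comm 1 ν, Real.Gamma_add_one hν.ne',
    show (s : ℝ) + 1 + (ν + t) = ν + s + t + 1 by ring]
  congr 1
  field_simp

theorem betaMoment_zero_left {ν : ℝ} (hν : 0 < ν) (t : ℕ) :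
    betaMoment ν 0 t = ENNReal.ofReal (ν / (ν + t)) := by
  have ht : (0 : ℝ) < ν + t := by positivity
  have := (Real.Gamma_pos_of_pos ht).ne'
  rw [betaMoment_eq hν]
  simp only [Nat.cast_zero, zero_add, add_zero, Real.Gamma_one, mul_one]
  rw [Real.Gamma_add_one ht.ne']
  congr 1
  field_simp

theorem ae_betaMeasure_mem_Icc (ν : ℝ) : ∀ᵐ v ∂betaMeasure 1 ν, v ∈ Set.Icc 0 1 := by
  rw [betaMeasure, ae_withDensity_iff (by unfold betaPDF; fun_prop)]
  refine ae_of_all _ fun v hv => ?_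
  rw [betaPDF_eq] at hv
  split_ifs at hv with h
  · exact ⟨h.1.le, h.2.le⟩
  · simp at hv

end BetaMoment

section FirstStick

variable {ι : Type*} [DecidableEq ι]

/-- Put the class `j` on the first stick and the others on the sticks after it. -/
def insertFirst (j : ι) (a : {i // i ≠ j} → ℕ) (i : ι) : ℕ :=
  if h : i = j then 0 else a ⟨i, h⟩ + 1

theorem insertFirst_self (j : ι) (a : {i // i ≠ j} → ℕ) : insertFirst j a j = 0 := by
  simp [insertFirst]

theorem insertFirst_coe (j : ι) (a : {i // i ≠ j} → ℕ) (i : {i // i ≠ j}) :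
    insertFirst j a i = a i + 1 := by
  simp [insertFirst, i.2]

theorem insertFirst_injective (j : ι) (a : {i // i ≠ j} ↪ ℕ) :
    Function.Injective (insertFirst j a) := fun i k h => by
  by_cases hi : i = j <;> by_cases hk : k = j
  · rw [hi, hk]
  · simp [insertFirst, hi, hk] at h
  · simp [insertFirst, hi, hk] at h
  · simpa [insertFirst, hi, hk] using h

/-- Encodes an injection of the classes into the sticks by the class on the first stick, if any,
and the sticks of the other classes, which are renumbered from `0`. -/
def firstStick : ((ι ↪ ℕ) ⊕ Σ j : ι, ({i // i ≠ j} ↪ ℕ)) → (ι ↪ ℕ)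
  | Sum.inl a => ⟨fun j => a j + 1, fun _ _ h => a.injective (Nat.succ_injective h)⟩
  | Sum.inr ⟨j, a⟩ => ⟨insertFirst j a, insertFirst_injective j a⟩

theorem firstStick_inl (a : ι ↪ ℕ) : ⇑(firstStick (Sum.inl a)) = fun j => a j + 1 := rfl

theorem firstStick_inr (j : ι) (a : {i // i ≠ j} ↪ ℕ) :
    ⇑(firstStick (Sum.inr ⟨j, a⟩)) = insertFirst j a := rfl

theorem firstStick_injective : Function.Injective (firstStick (ι := ι)) := by
  rintro (a | ⟨j, a⟩) (b | ⟨k, b⟩) h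
  · congr 1
    ext i
    simpa [firstStick_inl] using DFunLike.congr_fun h i
  · simpa [firstStick_inl, firstStick_inr, insertFirst] using DFunLike.congr_fun h k
  · simpa [firstStick_inl, firstStick_inr, insertFirst] using DFunLike.congr_fun h j
  · obtain rfl : j = k := by
      by_contra hne
      simpa [firstStick_inr, insertFirst, hne] using DFunLike.congr_fun h j
    congr 2
    ext i
    simpa [firstStick_inr, insertFirst_coe] using DFunLike.congr_fun h (i : ι)

theorem firstStick_surjective : Function.Surjective (firstStick (ι := ι)) := by
  intro a
  by_cases h : ∃ j, a j = 0
  · obtain ⟨j, hj⟩ := h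
    have ne_zero : ∀ i, i ≠ j → a i ≠ 0 := fun i hi h0 => hi (a.injective (h0.trans hj.symm))
    refine ⟨Sum.inr ⟨j, fun i => a i - 1, fun i k hik => ?_⟩, DFunLike.ext _ _ fun i => ?_⟩
    · exact Subtype.ext (a.injective (Nat.pred_inj (Nat.pos_of_ne_zero (ne_zero i i.2))
        (Nat.pos_of_ne_zero (ne_zero k k.2)) hik))
    · rw [firstStick_inr]
      by_cases hi : i = j
      · rw [hi, insertFirst_self, hj]
      · rw [insertFirst_coe j _ ⟨i, hi⟩]
        exact Nat.succ_pred_eq_of_ne_zero (ne_zero i hi)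
  · push Not at h
    refine ⟨Sum.inl ⟨fun i => a i - 1, fun i k hik => ?_⟩, DFunLike.ext _ _ fun i => ?_⟩
    · exact a.injective (Nat.pred_inj (Nat.pos_of_ne_zero (h i)) (Nat.pos_of_ne_zero (h k)) hik)
    · rw [firstStick_inl]
      exact Nat.succ_pred_eq_of_ne_zero (h i)

theorem tsum_embedding_eq_firstStick (f : (ι ↪ ℕ) → ENNReal) :
    ∑' a, f a = (∑' a, f (firstStick (.inl a)))
      + ∑' (j) (a : {i // i ≠ j} ↪ ℕ), f (firstStick (.inr ⟨j, a⟩)) := by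
  rw [← (Equiv.ofBijective _ ⟨firstStick_injective, firstStick_surjective⟩).tsum_eq f,
    ENNReal.summable.tsum_sum ENNReal.summable, ENNReal.tsum_sigma']
  rfl

theorem forall_firstStick_inl_lt_iff (a : ι ↪ ℕ) (L : ℕ∞) :
    (∀ j, (firstStick (.inl a) j : ℕ∞) < L + 1) ↔ ∀ j, (a j : ℕ∞) < L := by
  simp [firstStick_inl]

theorem forall_firstStick_inr_lt_iff (j : ι) (a : {i // i ≠ j} ↪ ℕ) (L : ℕ∞) :
    (∀ i, (firstStick (.inr ⟨j, a⟩) i : ℕ∞) < L + 1) ↔ ∀ i, (a i : ℕ∞) < L := by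
  rw [firstStick_inr]
  refine ⟨fun h i => ?_, fun h i => ?_⟩
  · simpa [insertFirst_coe, ENat.add_lt_add_iff_right] using h i
  · by_cases hi : i = j
    · simp [hi, insertFirst_self]
    · simpa [insertFirst_coe j a ⟨i, hi⟩, ENat.add_lt_add_iff_right] using h ⟨i, hi⟩

end FirstStick

section PartitionProbability

variable {ι : Type*} [Fintype ι]

theorem lt_sup_add_one (a : ι → ℕ) (j : ι) : a j < Finset.univ.sup fun j => a j + 1 :=
  Finset.le_sup (f := fun j => a j + 1) (Finset.mem_univ j)

/-- Probability, up to the sticks from `L` on, that the classes `j`, of sizes `m j`, are realized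
on the sticks `a j`. -/
def stickProd (ν : ℝ) (m a : ι → ℕ) (L : ℕ) : ENNReal :=
  ∏ r ∈ Finset.range L,
    betaMoment ν (∑ j, if a j = r then m j else 0) (∑ j, if r < a j then m j else 0)

/-- Probability that the classes `j`, of sizes `m j`, are realized on the sticks `a j`. -/
def stickProb (ν : ℝ) (m a : ι → ℕ) : ENNReal :=
  stickProd ν m a (Finset.univ.sup fun j => a j + 1)

theorem stickProd_eq_stickProb {ν : ℝ} (hν : 0 < ν) (m a : ι → ℕ) {L : ℕ} (hL : ∀ j, a j < L) :
    stickProd ν m a L = stickProb ν m a := by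
  refine (Finset.prod_subset (Finset.range_subset_range.2 (Finset.sup_le fun j _ => hL j))
    fun r _ hr => ?_).symm
  have above : ∀ j, a j < r := fun j =>
    (lt_sup_add_one a j).trans_le (not_lt.1 (Finset.mem_range.not.1 hr))
  simp [fun j => (above j).ne, fun j => (above j).not_gt, betaMoment_zero_left hν, hν.ne']

theorem stickProd_succ (ν : ℝ) (m a : ι → ℕ) (L : ℕ) :
    stickProd ν m (fun j => a j + 1) (L + 1) = betaMoment ν 0 (∑ j, m j) * stickProd ν m a L := by
  unfold stickProd
  rw [Finset.prod_range_succ', mul_comm]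
  simp

theorem stickProb_succ {ν : ℝ} (hν : 0 < ν) (m a : ι → ℕ) :
    stickProb ν m (fun j => a j + 1) = betaMoment ν 0 (∑ j, m j) * stickProb ν m a := by
  rw [← stickProd_eq_stickProb hν m a (lt_sup_add_one a), ← stickProd_succ,
    stickProd_eq_stickProb hν m _ fun j => Nat.succ_lt_succ (lt_sup_add_one a j)]

/-- The exchangeable partition probability function of the Dirichlet process: the probability of a
partition into classes of sizes `m j`. -/
def partitionProb (ν : ℝ) (m : ι → ℕ) : ENNReal :=
  ENNReal.ofReal (ν ^ Fintype.card ι * (∏ j, Real.Gamma (m j)) * Real.Gamma ν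
    / Real.Gamma (ν + (∑ j, m j : ℕ)))

theorem partitionProb_ne_top (ν : ℝ) (m : ι → ℕ) : partitionProb ν m ≠ ⊤ := ENNReal.ofReal_ne_top

theorem ofReal_div_add_sum_ofReal_div_eq_one {ν : ℝ} (hν : 0 < ν) (m : ι → ℕ) :
    ENNReal.ofReal (ν / (ν + (∑ i, m i : ℕ)))
      + ∑ j, ENNReal.ofReal (m j / (ν + (∑ i, m i : ℕ))) = 1 := by
  have total_pos : (0 : ℝ) < ν + (∑ i, m i : ℕ) := by positivity
  rw [← ENNReal.ofReal_sum_of_nonneg fun j _ => by positivity, ← ENNReal.ofReal_add (by positivity)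
    (Finset.sum_nonneg fun j _ => by positivity), ← Finset.sum_div, ← add_div, ← Nat.cast_sum,
    div_self total_pos.ne', ENNReal.ofReal_one]

open Classical in
/-- Probability that classes of sizes `m j` are realized on distinct sticks before the stick `L`. -/
def partitionSum (ν : ℝ) (m : ι → ℕ) (L : ℕ∞) : ENNReal :=
  ∑' a : ι ↪ ℕ, if ∀ j, (a j : ℕ∞) < L then stickProb ν m a else 0

theorem partitionSum_of_isEmpty [IsEmpty ι] {ν : ℝ} (hν : 0 < ν) (m : ι → ℕ) (L : ℕ∞) :
    partitionSum ν m L = partitionProb ν m := by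
  simp [partitionSum, partitionProb, stickProb, stickProd, (Real.Gamma_pos_of_pos hν).ne']

theorem stickProd_insertFirst [DecidableEq ι] (ν : ℝ) (m : ι → ℕ) (j : ι)
    (a : {i // i ≠ j} → ℕ) (L : ℕ) :
    stickProd ν m (insertFirst j a) (L + 1)
      = betaMoment ν (m j) (∑ i : {i // i ≠ j}, m i)
        * stickProd ν (fun i : {i // i ≠ j} => m i) a L := by
  unfold stickProd
  rw [Finset.prod_range_succ', mul_comm]
  simp_rw [Fintype.sum_eq_add_sum_subtype_ne _ j, insertFirst_self, insertFirst_coe]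
  simp

theorem stickProb_insertFirst [DecidableEq ι] {ν : ℝ} (hν : 0 < ν) (m : ι → ℕ) (j : ι)
    (a : {i // i ≠ j} → ℕ) :
    stickProb ν m (insertFirst j a)
      = betaMoment ν (m j) (∑ i : {i // i ≠ j}, m i)
        * stickProb ν (fun i : {i // i ≠ j} => m i) a := by
  rw [← stickProd_eq_stickProb hν _ a (lt_sup_add_one a), ← stickProd_insertFirst,
    stickProd_eq_stickProb hν m _ fun i => ?_]
  by_cases hi : i = j
  · simp [hi, insertFirst_self]
  · rw [insertFirst_coe j a ⟨i, hi⟩]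
    exact Nat.succ_lt_succ (lt_sup_add_one a _)

theorem partitionSum_add_one [DecidableEq ι] {ν : ℝ} (hν : 0 < ν) (m : ι → ℕ) (L : ℕ∞) :
    partitionSum ν m (L + 1) = ENNReal.ofReal (ν / (ν + (∑ j, m j : ℕ))) * partitionSum ν m L
      + ∑ j, betaMoment ν (m j) (∑ i : {i // i ≠ j}, m i)
          * partitionSum ν (fun i : {i // i ≠ j} => m i) L := by
  unfold partitionSum
  rw [tsum_embedding_eq_firstStick]
  simp_rw [forall_firstStick_inl_lt_iff,
    forall_firstStick_inr_lt_iff, firstStick_inl, firstStick_inr, stickProb_succ hν,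
    stickProb_insertFirst hν, tsum_fintype, ← betaMoment_zero_left hν, ← ENNReal.tsum_mul_left,
    mul_ite, mul_zero]

theorem Gamma_add_add_one {ν : ℝ} (hν : 0 < ν) (s t : ℕ) :
    Real.Gamma (ν + s + t + 1) = (ν + (s + t : ℕ)) * Real.Gamma (ν + (s + t : ℕ)) := by
  rw [← Real.Gamma_add_one (by positivity)]
  push_cast
  ring_nf

theorem betaMoment_mul_partitionProb [DecidableEq ι] {ν : ℝ} (hν : 0 < ν) {m : ι → ℕ}
    (hm : ∀ j, 0 < m j) (j : ι) :
    betaMoment ν (m j) (∑ i : {i // i ≠ j}, m i) * partitionProb ν (fun i : {i // i ≠ j} => m i)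
      = ENNReal.ofReal (m j / (ν + (∑ i, m i : ℕ))) * partitionProb ν m := by
  have Gamma_class_pos : ∀ i, 0 < Real.Gamma (m i) := fun i =>
    Real.Gamma_pos_of_pos (Nat.cast_pos.2 (hm i))
  have class_pos : (0 : ℝ) < m j := Nat.cast_pos.2 (hm j)
  set k : ℕ := ∑ i : {i // i ≠ j}, m i with hk
  have total : ∑ i, m i = m j + k := Fintype.sum_eq_add_sum_subtype_ne _ j
  have card : Fintype.card ι = Fintype.card {i // i ≠ j} + 1 := by
    have := Fintype.card_pos_iff.2 ⟨j⟩
    rw [Fintype.card_subtype_compl, Fintype.card_subtype_eq]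
    omega
  have := Real.Gamma_pos_of_pos (show (0 : ℝ) < ν + k by positivity)
  have :=
    Real.Gamma_pos_of_pos (show (0 : ℝ) < ν + (m j + k : ℕ) by positivity)
  have := Gamma_class_pos j
  rw [betaMoment_eq hν, partitionProb, partitionProb, total, card, ← hk,
    Fintype.prod_eq_mul_prod_subtype_ne _ j, Gamma_add_add_one hν,
    Real.Gamma_add_one class_pos.ne', ← ENNReal.ofReal_mul (by positivity),
    ← ENNReal.ofReal_mul (by positivity)]
  congr 1
  field_simp
  ring

theorem partitionSum_natCast_le {ν : ℝ} (hν : 0 < ν) {m : ι → ℕ} (hm : ∀ j, 0 < m j) (L : ℕ) :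
    partitionSum ν m L ≤ partitionProb ν m := by
  classical
  induction L generalizing ι with
  | zero =>
    rcases isEmpty_or_nonempty ι with hι | hι
    · exact (partitionSum_of_isEmpty hν m _).le
    · simp [partitionSum]
  | succ L ih =>
    rw [Nat.cast_succ, partitionSum_add_one hν]
    calc _ ≤ ENNReal.ofReal (ν / (ν + (∑ i, m i : ℕ))) * partitionProb ν m
          + ∑ j, betaMoment ν (m j) (∑ i : {i // i ≠ j}, m i)
            * partitionProb ν (fun i : {i // i ≠ j} => m i) := by
          gcongr with j
          · exact ih hm
          · exact ih fun i => hm i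
      _ = partitionProb ν m := by
          simp_rw [betaMoment_mul_partitionProb hν hm, ← Finset.sum_mul, ← add_mul,
            ofReal_div_add_sum_ofReal_div_eq_one hν, one_mul]

theorem partitionSum_top_le {ν : ℝ} (hν : 0 < ν) {m : ι → ℕ} (hm : ∀ j, 0 < m j) :
    partitionSum ν m ⊤ ≤ partitionProb ν m := by
  rw [partitionSum, ENNReal.tsum_eq_iSup_sum]
  refine iSup_le fun s => ?_
  set L : ℕ := s.sup fun a => Finset.univ.sup fun j => a j + 1
  refine le_trans ?_ (partitionSum_natCast_le hν hm L)
  refine le_trans (Finset.sum_le_sum fun a ha => ?_) (ENNReal.sum_le_tsum s)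
  have below_L : ∀ j, (a j : ℕ∞) < (L : ℕ∞) := fun j => Nat.cast_lt.2 <|
    (lt_sup_add_one a j).trans_le
      (Finset.le_sup (f := fun a : ι ↪ ℕ => Finset.univ.sup fun j => a j + 1) ha)
  rw [if_pos below_L]
  split_ifs <;> simp

theorem eq_of_eq_mul_add_mul {w c S q : ENNReal} (hwc : w + c = 1) (hc : c ≠ 0) (hS : S ≠ ⊤)
    (h : S = w * S + c * q) : S = q := by
  have w_ne_top : w ≠ ⊤ := fun hw => by simp [hw] at hwc
  have c_ne_top : c ≠ ⊤ := fun hc => by simp [hc] at hwc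
  have : w * S + c * S = w * S + c * q := by rw [← h, ← add_mul, hwc, one_mul]
  exact (ENNReal.mul_right_inj hc c_ne_top).1
    ((ENNReal.add_right_inj (ENNReal.mul_ne_top w_ne_top hS)).1 this)

theorem partitionSum_top {ν : ℝ} (hν : 0 < ν) {m : ι → ℕ} (hm : ∀ j, 0 < m j) :
    partitionSum ν m ⊤ = partitionProb ν m := by
  classical
  induction hk : Fintype.card ι generalizing ι with
  | zero =>
    have := Fintype.card_eq_zero_iff.1 hk
    exact partitionSum_of_isEmpty hν m _
  | succ k ih =>
    obtain ⟨j₀⟩ : Nonempty ι := Fintype.card_pos_iff.1 (by omega)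
    have card_ne (j : ι) : Fintype.card {i // i ≠ j} = k := by
      rw [Fintype.card_subtype_compl, Fintype.card_subtype_eq, hk, Nat.add_sub_cancel]
    have recursion := partitionSum_add_one hν m ⊤
    simp_rw [top_add, fun j : ι => ih (ι := {i // i ≠ j}) (fun i => hm i) (card_ne j),
      betaMoment_mul_partitionProb hν hm, ← Finset.sum_mul] at recursion
    refine eq_of_eq_mul_add_mul (ofReal_div_add_sum_ofReal_div_eq_one hν m) (fun h0 => ?_)
      (ne_top_of_le_ne_top (partitionProb_ne_top ν m) (partitionSum_top_le hν hm)) recursion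
    have weight_pos : (0 : ℝ) < m j₀ / (ν + (∑ i, m i : ℕ)) :=
      div_pos (Nat.cast_pos.2 (hm j₀)) (by positivity)
    exact (ENNReal.ofReal_pos.2 weight_pos).ne' (Finset.sum_eq_zero_iff.1 h0 j₀ (Finset.mem_univ _))

theorem tsum_stickProb {ν : ℝ} (hν : 0 < ν) {m : ι → ℕ} (hm : ∀ j, 0 < m j) :
    ∑' a : ι ↪ ℕ, stickProb ν m a = partitionProb ν m := by
  simp [← partitionSum_top hν hm, partitionSum]

theorem partitionProb_of_eq_add_one {ν : ℝ} (hν : 0 < ν) {m m' : ι → ℕ} (hm : ∀ j, 0 < m j)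
    {j : ι} (hj : m' j = m j + 1) (h : ∀ i ≠ j, m' i = m i) :
    partitionProb ν m' = ENNReal.ofReal (m j / (ν + (∑ i, m i : ℕ))) * partitionProb ν m := by
  classical
  have total : ((∑ i, m' i : ℕ) : ℝ) = (∑ i, m i : ℕ) + 1 := by
    rw [Fintype.sum_eq_add_sum_subtype_ne m' j, hj, Fintype.sum_eq_add_sum_subtype_ne m j,
      Fintype.sum_congr _ _ fun i : {i // i ≠ j} => h i.1 i.2]
    push_cast
    ring
  have prod_Gamma : ∏ i, Real.Gamma (m' i) = m j * ∏ i, Real.Gamma (m i) := by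
    rw [Fintype.prod_eq_mul_prod_subtype_ne (fun i => Real.Gamma (m' i)) j, hj,
      Fintype.prod_eq_mul_prod_subtype_ne (fun i => Real.Gamma (m i)) j,
      Fintype.prod_congr _ _ fun i : {i // i ≠ j} => congrArg (fun k : ℕ => Real.Gamma k)
        (h i.1 i.2), Nat.cast_add_one, Real.Gamma_add_one (Nat.cast_ne_zero.2 (hm j).ne'),
      mul_assoc]
  have total_pos : (0 : ℝ) < ν + (∑ i, m i : ℕ) := by positivity
  rw [partitionProb, partitionProb, ← ENNReal.ofReal_mul (by positivity), total, prod_Gamma,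
    ← add_assoc, Real.Gamma_add_one total_pos.ne']
  congr 1
  field_simp

theorem partitionProb_snoc {ν : ℝ} (hν : 0 < ν) {K : ℕ} {m : Fin K → ℕ} {m' : Fin (K + 1) → ℕ}
    (h : ∀ j, m' (Fin.castSucc j) = m j) (hl : m' (Fin.last K) = 1) :
    partitionProb ν m' = ENNReal.ofReal (ν / (ν + (∑ i, m i : ℕ))) * partitionProb ν m := by
  have total_pos : (0 : ℝ) < ν + (∑ i, m i : ℕ) := by positivity
  rw [partitionProb, partitionProb, ← ENNReal.ofReal_mul (by positivity), Fin.sum_univ_castSucc,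
    Fin.prod_univ_castSucc, hl]
  simp only [h, Nat.cast_one, Real.Gamma_one, mul_one, Fintype.card_fin]
  rw [Nat.cast_succ, ← add_assoc, Real.Gamma_add_one total_pos.ne']
  congr 1
  field_simp
  ring

end PartitionProbability

section StickMoments

/-- Extend finitely many sticks by zero. -/
def extendStick {L : ℕ} (v : Fin L → ℝ) (r : ℕ) : ℝ := if h : r < L then v ⟨r, h⟩ else 0

theorem measurable_extendStick {L : ℕ} (r : ℕ) :
    Measurable fun v : Fin L → ℝ => extendStick v r := by
  unfold extendStick
  split_ifs <;> fun_prop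

theorem extendStick_coe {L : ℕ} (v : Fin L → ℝ) (r : Fin L) : extendStick v r = v r := by
  simp [extendStick]

theorem extendStick_mem_Icc {L : ℕ} {v : Fin L → ℝ} (hv : ∀ r, v r ∈ Set.Icc 0 1) (r : ℕ) :
    extendStick v r ∈ Set.Icc 0 1 := by
  unfold extendStick
  split_ifs
  · exact hv _
  · simp

theorem measurable_stickWeight (l : ℕ) : Measurable fun v : ℕ → ℝ => stickWeight v l := by
  unfold stickWeight
  fun_prop

theorem stickWeight_congr {v w : ℕ → ℝ} {l : ℕ} (h : ∀ r ≤ l, v r = w r) :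
    stickWeight v l = stickWeight w l := by
  unfold stickWeight
  rw [h l le_rfl, Finset.prod_congr rfl fun r hr => by rw [h r (Finset.mem_range.1 hr).le]]

theorem stickWeight_nonneg {v : ℕ → ℝ} (hv : ∀ r, v r ∈ Set.Icc 0 1) (l : ℕ) :
    0 ≤ stickWeight v l :=
  mul_nonneg (hv l).1 (Finset.prod_nonneg fun r _ => sub_nonneg.2 (hv r).2)

theorem stickWeight_eq_prod (v : ℕ → ℝ) {l L : ℕ} (hl : l < L) :
    stickWeight v l = ∏ r ∈ Finset.range L,
      ((if l = r then v r else 1) * if r < l then 1 - v r else 1) := by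
  rw [Finset.prod_mul_distrib, Finset.prod_ite_eq, if_pos (Finset.mem_range.2 hl), stickWeight,
    ← Finset.prod_filter]
  congr 2
  ext r
  simp only [Finset.mem_range, Finset.mem_filter]
  omega

theorem lintegral_pi_prod {κ : Type*} [Fintype κ] {α : Type*} [MeasurableSpace α]
    (μ : Measure α) [IsProbabilityMeasure μ] {f : κ → α → ENNReal} (hf : ∀ i, Measurable (f i)) :
    ∫⁻ v, ∏ i, f i (v i) ∂(Measure.pi fun _ : κ => μ) = ∏ i, ∫⁻ x, f i x ∂μ := by
  rw [lintegral_prod_eq_prod_lintegral_of_indepFun Finset.univ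
    (fun i (v : κ → α) => f i (v i)) (iIndepFun_pi (μ := fun _ : κ => μ)
      fun i => (hf i).aemeasurable) fun i => (hf i).comp (measurable_pi_apply i)]
  exact Finset.prod_congr rfl fun i _ =>
    (measurePreserving_eval (fun _ : κ => μ) i).lintegral_comp (hf i)

theorem map_pi_comp_embedding {ι κ : Type*} [Fintype ι] [Fintype κ] {α : Type*}
    [MeasurableSpace α] (μ : Measure α) [IsProbabilityMeasure μ] {a : ι → κ}
    (ha : Function.Injective a) :
    (Measure.pi fun _ : κ => μ).map (fun e j => e (a j)) = Measure.pi fun _ : ι => μ := by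
  have independent := (iIndepFun_pi (μ := fun _ : κ => μ) (X := fun _ => id)
    fun _ => aemeasurable_id).precomp ha
  refine ((iIndepFun_iff_map_fun_eq_pi_map (f := fun j (e : κ → α) => e (a j))
    (μ := Measure.pi fun _ => μ) fun i => (measurable_pi_apply _).aemeasurable).1
      independent).trans ?_
  congr 1
  exact funext fun i => (measurePreserving_eval (fun _ : κ => μ) (a i)).map_eq

variable {ι : Type*} {N : ℕ}

/-- Number of the positions of a word which carry the letter `j`. -/
def letterCount [DecidableEq ι] (z : Fin N → ι) (j : ι) : ℕ :=
  (Finset.univ.filter fun i => z i = j).card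

variable [Fintype ι]

theorem prod_comp_eq_prod_pow_letterCount [DecidableEq ι] {R : Type*} [CommMonoid R]
    (z : Fin N → ι) (f : ι → R) :
    ∏ i, f (z i) = ∏ j, f j ^ letterCount z j := by
  rw [← Finset.prod_fiberwise Finset.univ z]
  refine Finset.prod_congr rfl fun j _ => ?_
  rw [letterCount, ← Finset.prod_const]
  exact Finset.prod_congr rfl fun i hi => by rw [(Finset.mem_filter.1 hi).2]

theorem prod_stickWeight_pow {L : ℕ} (v : ℕ → ℝ) (m : ι → ℕ) {a : ι → ℕ} (ha : ∀ j, a j < L) :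
    ∏ j, stickWeight v (a j) ^ m j = ∏ r ∈ Finset.range L,
      v r ^ (∑ j, if a j = r then m j else 0) * (1 - v r) ^ (∑ j, if r < a j then m j else 0) := by
  simp_rw [stickWeight_eq_prod v (ha _), ← Finset.prod_pow]
  rw [Finset.prod_comm]
  refine Finset.prod_congr rfl fun r _ => ?_
  simp_rw [mul_pow, Finset.prod_mul_distrib, ← Finset.prod_pow_eq_pow_sum, ite_pow, one_pow,
    pow_ite, pow_zero]

theorem lintegral_prod_stickWeight [DecidableEq ι] {ν : ℝ} (hν : 0 < ν) {L : ℕ}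
    (z : Fin N → ι) {a : ι → ℕ} (ha : ∀ j, a j < L) :
    ∫⁻ v, ∏ i, ENNReal.ofReal (stickWeight (extendStick v) (a (z i)))
        ∂(Measure.pi fun _ : Fin L => betaMeasure 1 ν)
      = stickProb ν (letterCount z) a := by
  have := isProbabilityMeasureBeta one_pos hν
  have sticks_mem : ∀ᵐ v ∂(Measure.pi fun _ : Fin L => betaMeasure 1 ν), ∀ r, v r ∈ Set.Icc 0 1 :=
    ae_all_iff.2 fun r => (Measure.quasiMeasurePreserving_eval
      (μ := fun _ : Fin L => betaMeasure 1 ν) r).ae (ae_betaMeasure_mem_Icc ν)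
  rw [← stickProd_eq_stickProb hν _ a ha, stickProd, ← Fin.prod_univ_eq_prod_range
    (fun r => betaMoment ν (∑ j, if a j = r then letterCount z j else 0)
      (∑ j, if r < a j then letterCount z j else 0)) L]
  unfold betaMoment
  rw [← lintegral_pi_prod (betaMeasure 1 ν)
    (f := fun (r : Fin L) v => ENNReal.ofReal (v ^ (∑ j, if a j = r then letterCount z j else 0)
      * (1 - v) ^ (∑ j, if r < a j then letterCount z j else 0))) fun r => by fun_prop]
  refine lintegral_congr_ae ?_
  filter_upwards [sticks_mem] with v hv
  rw [← ENNReal.ofReal_prod_of_nonneg fun i _ => stickWeight_nonneg (extendStick_mem_Icc hv) _,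
    ← ENNReal.ofReal_prod_of_nonneg fun r _ =>
      mul_nonneg (pow_nonneg (hv r).1 _) (pow_nonneg (sub_nonneg.2 (hv r).2) _),
    prod_comp_eq_prod_pow_letterCount z fun j => stickWeight (extendStick v) (a j),
    prod_stickWeight_pow _ _ ha, Finset.prod_range]
  simp_rw [extendStick_coe]

end StickMoments

/-! ### Words in order of appearance -/

section Appearance

variable {c z : ℕ → ℕ} {n N K : ℕ}

theorem appearance_succ (c : ℕ → ℕ) (n : ℕ) : appearance c (n + 1)
    = if c n ∈ appearance c n then appearance c n else appearance c n ++ [c n] := rfl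

theorem mem_appearance_iff {l : ℕ} : l ∈ appearance c n ↔ ∃ i < n, c i = l := by
  induction n with
  | zero => simp [appearance]
  | succ n ih =>
    rw [appearance_succ]
    split_ifs with h
    · rw [ih]
      refine ⟨fun ⟨i, hi, e⟩ => ⟨i, by omega, e⟩, fun ⟨i, hi, e⟩ => ?_⟩
      rcases Nat.lt_succ_iff_lt_or_eq.1 hi with hi | rfl
      · exact ⟨i, hi, e⟩
      · exact ih.1 (e ▸ h)
    · rw [List.mem_append, ih, List.mem_singleton]
      constructor
      · rintro (⟨i, hi, e⟩ | rfl)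
        · exact ⟨i, by omega, e⟩
        · exact ⟨n, by omega, rfl⟩
      · rintro ⟨i, hi, e⟩
        rcases Nat.lt_succ_iff_lt_or_eq.1 hi with hi | rfl
        · exact Or.inl ⟨i, hi, e⟩
        · exact Or.inr e.symm

theorem mem_appearance {i : ℕ} (hi : i < n) : c i ∈ appearance c n :=
  mem_appearance_iff.2 ⟨i, hi, rfl⟩

theorem nodup_appearance : (appearance c n).Nodup := by
  induction n with
  | zero => simp [appearance]
  | succ n ih =>
    rw [appearance_succ]
    split_ifs with h
    · exact ih
    · exact List.nodup_append.2 ⟨ih, List.nodup_singleton _, by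
        rintro a ha b hb rfl; exact h (List.mem_singleton.1 hb ▸ ha)⟩

theorem appearance_prefix_succ : appearance c n <+: appearance c (n + 1) := by
  rw [appearance_succ]
  split_ifs
  · exact List.prefix_rfl
  · exact List.prefix_append _ _

theorem appearance_prefix (h : n ≤ N) : appearance c n <+: appearance c N := by
  induction N, h using Nat.le_induction with
  | base => exact List.prefix_rfl
  | succ N _ ih => exact ih.trans appearance_prefix_succ

theorem appearance_congr (h : ∀ i < n, c i = z i) : appearance c n = appearance z n := by
  induction n with
  | zero => rfl
  | succ n ih =>
    rw [appearance_succ, appearance_succ, ih fun i hi => h i (by omega), h n (by omega)]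

theorem idxOf_appearance {i : ℕ} (hi : i < n) :
    (appearance c n).idxOf (c i) = appearanceLabel c i := by
  obtain ⟨t, ht⟩ := appearance_prefix (c := c) (Nat.succ_le_of_lt hi)
  rw [appearanceLabel, ← ht, List.idxOf_append_of_mem (mem_appearance (Nat.lt_succ_self i))]

theorem appearanceLabel_lt_length {i : ℕ} (hi : i < n) :
    appearanceLabel c i < (appearance c n).length := by
  rw [← idxOf_appearance hi]
  exact List.idxOf_lt_length_of_mem (mem_appearance hi)

theorem getElem_appearanceLabel {i : ℕ} (hi : i < n) :
    (appearance c n)[appearanceLabel c i]'(appearanceLabel_lt_length hi) = c i := by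
  simp only [← idxOf_appearance hi, List.getElem_idxOf]

theorem appearance_appearanceLabel :
    appearance (appearanceLabel c) n = List.range (appearance c n).length := by
  induction n with
  | zero => simp [appearance]
  | succ n ih =>
    rw [appearance_succ, ih, appearance_succ c]
    by_cases h : c n ∈ appearance c n
    · have label_lt : appearanceLabel c n < (appearance c n).length := by
        rw [appearanceLabel, appearance_succ, if_pos h]
        exact List.idxOf_lt_length_of_mem h
      rw [if_pos h, if_pos (List.mem_range.2 label_lt)]
    · have label_eq : appearanceLabel c n = (appearance c n).length := by
        rw [appearanceLabel, appearance_succ, if_neg h, List.idxOf_append_of_notMem h]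
        simp
      rw [if_neg h, label_eq, if_neg (by simp), List.length_append, List.length_singleton,
        List.range_succ]

theorem lt_of_appearance_eq_range (hz : appearance z N = List.range K) {i : ℕ} (hi : i < N) :
    z i < K :=
  List.mem_range.1 (hz ▸ mem_appearance hi)

theorem exists_eq_of_appearance_eq_range (hz : appearance z N = List.range K) (j : Fin K) :
    ∃ i : Fin N, z i = j := by
  obtain ⟨i, hi, e⟩ := mem_appearance_iff.1 (hz ▸ List.mem_range.2 j.2)
  exact ⟨⟨i, hi⟩, e⟩

/-- A word in order of appearance, as a map from its positions onto its `K` letters. -/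
def letters (hz : appearance z N = List.range K) (i : Fin N) : Fin K :=
  ⟨z i, lt_of_appearance_eq_range hz i.2⟩

theorem appearance_map (hz : appearance z N = List.range K) (a : Fin K ↪ ℕ)
    (h : ∀ i, c i.1 = a (letters hz i)) (k : ℕ) (hk : k ≤ N) :
    appearance c k = (appearance z k).map fun j => if hj : j < K then a ⟨j, hj⟩ else 0 := by
  have letter_eq : ∀ i, i < N → c i = if hj : z i < K then a ⟨z i, hj⟩ else 0 := fun i hi => by
    rw [dif_pos (lt_of_appearance_eq_range hz hi)]
    exact h ⟨i, hi⟩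
  induction k with
  | zero => simp [appearance]
  | succ k ih =>
    have ih := ih (by omega)
    have mem_iff : c k ∈ appearance c k ↔ z k ∈ appearance z k := by
      rw [mem_appearance_iff, mem_appearance_iff]
      refine exists_congr fun i => and_congr_right fun hi => ?_
      rw [show c i = _ from h ⟨i, by omega⟩, show c k = _ from h ⟨k, by omega⟩,
        a.injective.eq_iff]
      simp [letters]
    rw [appearance_succ, appearance_succ]
    by_cases hzk : z k ∈ appearance z k
    · rw [if_pos (mem_iff.2 hzk), if_pos hzk, ih]
    · rw [if_neg (mt mem_iff.1 hzk), if_neg hzk, ih, letter_eq k (by omega), List.map_append,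
        List.map_singleton]

theorem appearance_eq_of_letters (hz : appearance z N = List.range K) (a : Fin K ↪ ℕ)
    (h : ∀ i, c i.1 = a (letters hz i)) : appearance c N = List.ofFn a := by
  rw [appearance_map hz a h N le_rfl, hz]
  refine List.ext_getElem (by simp) fun j hj _ => ?_
  have : j < K := by simpa using hj
  simp [this]

theorem appearanceLabel_eq_of_letters (hz : appearance z N = List.range K) (a : Fin K ↪ ℕ)
    (h : ∀ i, c i.1 = a (letters hz i)) {i : ℕ} (hi : i < N) : appearanceLabel c i = z i := by
  rw [← idxOf_appearance hi, appearance_eq_of_letters hz a h, show c i = _ from h ⟨i, hi⟩]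
  have idxOf_letter := (List.nodup_ofFn.2 a.injective).idxOf_getElem (letters hz ⟨i, hi⟩) (by simp)
  simpa [letters] using idxOf_letter

theorem forall_appearanceLabel_eq_iff (hz : appearance z N = List.range K) :
    (∀ i < N, appearanceLabel c i = z i) ↔ ∃ a : Fin K ↪ ℕ, ∀ i, c i.1 = a (letters hz i) := by
  refine ⟨fun h => ?_, fun ⟨a, ha⟩ i hi => appearanceLabel_eq_of_letters hz a ha hi⟩
  have length_eq : (appearance c N).length = K := by
    have := appearance_appearanceLabel (c := c) (n := N)
    rw [appearance_congr h, hz] at this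
    simpa using congrArg List.length this.symm
  refine ⟨⟨fun j => (appearance c N)[(j : ℕ)]'(length_eq.symm ▸ j.2),
    fun j k hjk => ?_⟩, fun i => ?_⟩
  · exact Fin.ext ((nodup_appearance.getElem_inj_iff).1 hjk)
  · change c i = (appearance c N)[z i]'_
    rw [← getElem_appearanceLabel (c := c) i.2]
    simp only [h i i.2]
    rfl

theorem letters_unique (hz : appearance z N = List.range K) {a b : Fin K ↪ ℕ}
    (ha : ∀ i, c i.1 = a (letters hz i)) (hb : ∀ i, c i.1 = b (letters hz i)) : a = b := by
  ext j
  obtain ⟨i, hi⟩ := exists_eq_of_appearance_eq_range hz j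
  have hj : letters hz i = j := Fin.ext hi
  rw [← hj, ← ha, ← hb]

theorem numSurfaces_eq_length (z : ℕ → ℕ) (n : ℕ) :
    numSurfaces (fun i : Fin n => z i) = (appearance z n).length := by
  rw [numSurfaces, ← List.toFinset_card_of_nodup nodup_appearance]
  congr 1
  ext l
  simp only [Finset.mem_image, Finset.mem_univ, true_and, List.mem_toFinset, mem_appearance_iff]
  exact ⟨fun ⟨i, e⟩ => ⟨i, i.2, e⟩, fun ⟨i, hi, e⟩ => ⟨⟨i, hi⟩, e⟩⟩

theorem letterCount_letters (hz : appearance z N = List.range K) (j : Fin K) :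
    letterCount (letters hz) j = surfaceCount (fun i : Fin N => z i) j := by
  unfold letterCount surfaceCount
  congr 1
  ext i
  simp [letters, Fin.ext_iff]

theorem letterCount_pos (hz : appearance z N = List.range K) (j : Fin K) :
    0 < letterCount (letters hz) j := by
  obtain ⟨i, hi⟩ := exists_eq_of_appearance_eq_range hz j
  exact Finset.card_pos.2 ⟨i, by simp [letters, Fin.ext_iff, hi]⟩

theorem sum_letterCount {ι : Type*} [Fintype ι] [DecidableEq ι] (z : Fin N → ι) :
    ∑ j, letterCount z j = N := by
  have := Finset.card_eq_sum_card_fiberwise (f := z) (s := Finset.univ) (t := Finset.univ)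
    (by simp)
  simpa [letterCount] using this.symm

/-- The word `z` followed by the letter `j`. -/
def extendWord (z : Fin n → ℕ) (j i : ℕ) : ℕ := if h : i < n then z ⟨i, h⟩ else j

theorem extendWord_coe (z : Fin n → ℕ) (j : ℕ) (i : Fin n) : extendWord z j i = z i := by
  simp [extendWord]

theorem extendWord_last (z : Fin n → ℕ) (j : ℕ) : extendWord z j n = j := by
  simp [extendWord]

theorem appearance_extendWord (z : Fin n → ℕ) (j k : ℕ) :
    appearance (extendWord z j) n = appearance (extendWord z k) n :=
  appearance_congr fun i hi => by simp [extendWord, hi]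

theorem surfaceCount_extendWord (z : Fin n → ℕ) (j k : ℕ) :
    surfaceCount (fun i : Fin (n + 1) => extendWord z j i) k
      = surfaceCount z k + if j = k then 1 else 0 := by
  unfold surfaceCount
  rw [Fin.univ_castSuccEmb, Finset.filter_cons]
  simp only [Fin.val_last, extendWord_last, Finset.filter_map, Function.comp_def,
    Fin.coe_castSuccEmb, Fin.val_castSucc, extendWord_coe]
  split_ifs <;> simp

end Appearance

section Priors

theorem ae_gammaMeasure_pos (a b : ℝ) : ∀ᵐ t ∂gammaMeasure a b, 0 < t := by
  rw [gammaMeasure, ae_withDensity_iff (show Measurable (gammaPDF a b) from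
    (measurable_gammaPDFReal a b).ennreal_ofReal)]
  filter_upwards [Measure.ae_ne volume 0] with t ne_zero pdf_ne_zero
  exact (not_lt.1 fun neg => pdf_ne_zero (gammaPDF_of_neg neg)).lt_of_ne' ne_zero

theorem ae_inverseGammaMeasure_pos (a b : ℝ) : ∀ᵐ t ∂inverseGammaMeasure a b, 0 < t := by
  rw [inverseGammaMeasure, ae_map_iff measurable_inv.aemeasurable measurableSet_Ioi]
  exact (ae_gammaMeasure_pos a b).mono fun t ht => inv_pos.2 ht

theorem ae_uniformCube_pos (d : ℕ) (b : ℝ) : ∀ᵐ φ ∂uniformCube d b, ∀ k, 0 < φ k := by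
  rw [uniformCube, ProbabilityTheory.cond]
  refine Measure.ae_smul_measure ?_ _
  filter_upwards [ae_restrict_mem (MeasurableSet.univ_pi fun _ : Fin d => measurableSet_Ioc)]
    with φ hφ k
  exact (hφ k trivial).1

theorem HyperPrior.ae_admissible {d : ℕ} (h : HyperPrior d) :
    ∀ᵐ θ ∂h.first.prod h.second, θ.2.Admissible := by
  refine Measure.quasiMeasurePreserving_snd.ae (p := SecondLayer.Admissible) ?_
  have rest_pos : ∀ᵐ r ∂(inverseGammaMeasure h.aSigma h.bSigma).prod (uniformCube d h.bPhi),
      0 < r.1 ∧ ∀ k, 0 < r.2 k :=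
    (Measure.quasiMeasurePreserving_fst.ae (ae_inverseGammaMeasure_pos _ _)).and
      (Measure.quasiMeasurePreserving_snd.ae (ae_uniformCube_pos _ _))
  exact (Measure.quasiMeasurePreserving_fst.ae (ae_gammaMeasure_pos _ _)).and
    (Measure.quasiMeasurePreserving_snd.ae rest_pos)

end Priors

theorem stickMeasure_singleton (v : ℕ → ℝ) (l : ℕ) :
    stickMeasure v {l} = ENNReal.ofReal (stickWeight v l) := by
  rw [stickMeasure, Measure.sum_apply _ (measurableSet_singleton l),
    tsum_eq_single l fun k hk => by simp [hk]]
  simp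

instance (v : ℕ → ℝ) : SigmaFinite (stickMeasure v) :=
  ⟨⟨{ set := fun l => {l}
      set_mem := fun _ => trivial
      finite := fun l => by
        rw [stickMeasure_singleton]
        exact ENNReal.ofReal_lt_top
      spanning := Set.iUnion_of_singleton ℕ }⟩⟩

theorem measurable_indicator_Gamma : Measurable ((Set.Ioi (0 : ℝ)).indicator Real.Gamma) := by
  classical
  rw [← Set.piecewise_eq_indicator]
  refine ContinuousOn.measurable_piecewise (fun s hs => ?_) continuousOn_const measurableSet_Ioi
  exact (Real.differentiableAt_Gamma fun m =>
    ((neg_nonpos.mpr m.cast_nonneg).trans_lt hs).ne').continuousAt.continuousWithinAt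

theorem exists_measurable_stickProb {ι : Type*} [Fintype ι] (m a : ι → ℕ) :
    ∃ g : ℝ → ENNReal, Measurable g ∧ ∀ ν, 0 < ν → stickProb ν m a = g ν := by
  let G := (Set.Ioi (0 : ℝ)).indicator Real.Gamma
  have meas_G : Measurable G := measurable_indicator_Gamma
  have Gamma_eq : ∀ s, 0 < s → Real.Gamma s = G s := fun s hs => (Set.indicator_of_mem hs _).symm
  refine ⟨fun ν => ∏ r ∈ Finset.range (Finset.univ.sup fun j => a j + 1), ENNReal.ofReal
    (ν * Real.Gamma ((∑ j, if a j = r then m j else 0 : ℕ) + 1)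
      * G (ν + (∑ j, if r < a j then m j else 0 : ℕ))
      / G (ν + (∑ j, if a j = r then m j else 0 : ℕ) + (∑ j, if r < a j then m j else 0 : ℕ) + 1)),
    by fun_prop, fun ν hν => ?_⟩
  unfold stickProb stickProd
  refine Finset.prod_congr rfl fun r _ => ?_
  rw [betaMoment_eq hν, Gamma_eq (ν + _) (by positivity), Gamma_eq (ν + _ + _ + _) (by positivity)]

section Pi

variable {α β γ : Type*} [MeasurableSpace α] [MeasurableSpace β] [MeasurableSpace γ] {K : ℕ}

theorem measurable_insertNth (j : Fin (K + 1)) :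
    Measurable fun c : α × (Fin K → α) => (j.insertNth c.1 c.2 : Fin (K + 1) → α) :=
  (MeasurableEquiv.piFinSuccAbove (fun _ => α) j).symm.measurable

theorem lintegral_pi_insertNth (μ : Measure α) [IsProbabilityMeasure μ] (j : Fin (K + 1))
    {f : (Fin (K + 1) → α) → ENNReal} (hf : Measurable f) :
    ∫⁻ e, f e ∂(Measure.pi fun _ => μ)
      = ∫⁻ r, ∫⁻ y, f (j.insertNth y r) ∂μ ∂(Measure.pi fun _ : Fin K => μ) := by
  have split := (measurePreserving_piFinSuccAbove (fun _ : Fin (K + 1) => μ) j).symm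
  rw [← split.lintegral_comp hf]
  exact lintegral_prod_symm _ (hf.comp (MeasurableEquiv.measurable _)).aemeasurable

theorem hasCondDistrib_pi_apply {μ : Measure α} [IsProbabilityMeasure μ] {X : α → β} {Y : α → γ}
    {κ : Kernel β γ} [IsSFiniteKernel κ] (hX : Measurable X) (hY : Measurable Y)
    (h : HasCondDistrib Y X κ μ) (j : Fin K) :
    HasCondDistrib (fun e : Fin K → α => Y (e j)) (fun e k => X (e k))
      (κ.comap (fun t => t j) (measurable_pi_apply j)) (Measure.pi fun _ => μ) := by
  obtain _ | K := K
  · exact j.elim0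
  have meas_X : Measurable fun (e : Fin (K + 1) → α) k => X (e k) := by fun_prop
  refine hasCondDistrib_of_lintegral meas_X (by fun_prop) fun f hf => ?_
  have meas_inner := hf.lintegral_kernel_prod_right'
    (κ := κ.comap (fun t : Fin (K + 1) → β => t j) (measurable_pi_apply j))
  simp only [Kernel.comap_apply] at meas_inner ⊢
  rw [lintegral_pi_insertNth _ j (by fun_prop),
    lintegral_pi_insertNth μ j (f := fun e => ∫⁻ y, f (fun k => X (e k), y) ∂κ (X (e j)))
      (meas_inner.comp meas_X)]
  refine lintegral_congr fun r => ?_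
  have comp_insertNth : ∀ a, (fun k => X ((j.insertNth a r : Fin (K + 1) → α) k))
      = (j.insertNth (X a) fun k => X (r k) : Fin (K + 1) → β) := fun a => by
    funext k
    refine Fin.succAboveCases j ?_ (fun i => ?_) k <;> simp
  simp only [comp_insertNth, Fin.insertNth_apply_same]
  exact lintegral_of_hasCondDistrib h
    (f := fun c => f ((j.insertNth c.1 fun k => X (r k) : Fin (K + 1) → β), c.2))
    (hf.comp (((measurable_insertNth j).comp
      (measurable_fst.prodMk measurable_const)).prodMk measurable_snd))

theorem lintegral_pi_castSucc_last (μ : Measure α) [IsProbabilityMeasure μ] {X : α → β}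
    {Y : α → γ} (hX : Measurable X) (hY : Measurable Y) {f : (Fin K → β) × γ → ENNReal}
    (hf : Measurable f) :
    ∫⁻ e, f (fun k => X (e (Fin.castSucc k)), Y (e (Fin.last K)))
        ∂(Measure.pi fun _ : Fin (K + 1) => μ)
      = ∫⁻ e, ∫⁻ y, f (fun k => X (e k), y) ∂μ.map Y ∂(Measure.pi fun _ : Fin K => μ) := by
  rw [lintegral_pi_insertNth _ (Fin.last K) (by fun_prop)]
  refine lintegral_congr fun r => ?_
  simp only [Fin.insertNth_apply_same, Fin.insertNth_last', Fin.snoc_castSucc]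
  rw [lintegral_map (f := fun y => f (fun k => X (r k), y)) (by fun_prop) hY]

end Pi

/-! ### The joint law of the assignments and the realized surfaces -/

namespace Model

variable {d m N K : ℕ} {h : HyperPrior d} {S : Set (EuclideanSpace ℝ (Fin d))}
  {Ω : Type*} [MeasurableSpace Ω] {P : Measure Ω} [IsProbabilityMeasure P]

/-- The hyperparameters, the sticks and the surfaces, given which the observations are drawn. -/
def environment (M : Model h S P) (ω : Ω) :
    (FirstLayer d × SecondLayer d) × (ℕ → ℝ) × (ℕ → S → ℝ) :=
  ((M.first ω, M.second ω), (fun r => M.stick r ω), fun l p => M.surface l p ω)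

/-- The values of the `l`-th surface at finitely many points. -/
def values (M : Model h S P) (q : Fin m → S) (l : ℕ) (ω : Ω) : EuclideanSpace ℝ (Fin m) :=
  WithLp.toLp 2 fun b => M.surface l (q b) ω

theorem measurable_hyper (M : Model h S P) : Measurable fun ω => (M.first ω, M.second ω) :=
  M.measurable_first.prodMk M.measurable_second

theorem measurable_environment (M : Model h S P) : Measurable M.environment :=
  M.measurable_hyper.prodMk ((measurable_pi_lambda _ M.measurable_stick).prodMk
    (measurable_pi_lambda _ fun l => measurable_pi_lambda _ fun p => M.measurable_surface l p))

theorem measurable_values (M : Model h S P) (q : Fin m → S) (l : ℕ) :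
    Measurable (M.values q l) := by
  have := fun b => M.measurable_surface l (q b)
  unfold values
  fun_prop

theorem ae_admissible (M : Model h S P) : ∀ᵐ ω ∂P, (M.second ω).Admissible := by
  have := h.ae_admissible
  rw [← M.law_hyper] at this
  exact ae_of_ae_map M.measurable_hyper.aemeasurable this

theorem measurableSet_stickIndex_eq (M : Model h S P) (b : Fin N → ℕ) :
    MeasurableSet {ω | ∀ i : Fin N, M.stickIndex i ω = b i} := by
  simp only [Set.ofPred_forall]
  exact MeasurableSet.iInter fun i => M.measurable_stickIndex i (measurableSet_singleton _)

theorem lintegral_stickIndex (M : Model h S P) (b : Fin N → ℕ)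
    {f : (FirstLayer d × SecondLayer d) × (ℕ → ℝ) × (ℕ → S → ℝ) → ENNReal} (hf : Measurable f) :
    ∫⁻ ω in {ω | ∀ i : Fin N, M.stickIndex i ω = b i}, f (M.environment ω) ∂P
      = ∫⁻ ω, f (M.environment ω)
          * ∏ i, ENNReal.ofReal (stickWeight (fun r => M.stick r ω) (b i)) ∂P := by
  have disintegration := lintegral_of_condDistrib_ae_eq M.measurable_environment
    (measurable_pi_lambda _ fun i : Fin N => M.measurable_stickIndex i) (M.law_stickIndex N)
    (f := (Prod.snd ⁻¹' {b}).indicator fun c => f c.1)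
    ((hf.comp measurable_fst).indicator (measurable_snd (measurableSet_singleton b)))
  rw [← lintegral_indicator (M.measurableSet_stickIndex_eq b)]
  refine Eq.trans (lintegral_congr fun ω => ?_) (disintegration.trans (lintegral_congr fun ω => ?_))
  · simp only [Set.indicator, Set.mem_ofPred_eq, Set.mem_preimage, Set.mem_singleton_iff,
      funext_iff]
  · change ∫⁻ c, ({b} : Set (Fin N → ℕ)).indicator (fun _ => f (M.environment ω)) c
      ∂(Measure.pi fun _ : Fin N => stickMeasure fun r => M.stick r ω) = _
    rw [lintegral_indicator (measurableSet_singleton b), lintegral_const,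
      Measure.restrict_apply_univ, Measure.pi_singleton]
    simp_rw [stickMeasure_singleton]

theorem lintegral_stick_mul_values (M : Model h S P) {L : ℕ} (q : Fin m → S)
    {f : (Fin L → ℝ) → ENNReal} (hf : Measurable f)
    {g : (FirstLayer d × SecondLayer d) × (Fin L → EuclideanSpace ℝ (Fin m)) → ENNReal}
    (hg : Measurable g) :
    ∫⁻ ω, f (fun r => M.stick r ω) * g ((M.first ω, M.second ω), fun l => M.values q l ω) ∂P
      = ∫⁻ ω, (∫⁻ v, f v ∂(Measure.pi fun _ => betaMeasure 1 (M.second ω).nu))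
          * ∫⁻ e, g ((M.first ω, M.second ω), e)
              ∂(Measure.pi fun _ => baseGP (M.second ω) q) ∂P := by
  have meas : Measurable fun ω => ((fun r : Fin L => M.stick r ω),
      fun l : Fin L => M.values q l ω) :=
    (measurable_pi_lambda _ fun r : Fin L => M.measurable_stick r).prodMk
      (measurable_pi_lambda _ fun l : Fin L => M.measurable_values q l)
  refine (lintegral_of_condDistrib_ae_eq M.measurable_hyper meas (M.law_stick_surface L m q)
    (f := fun c => f c.2.1 * g (c.1, c.2.2)) (by fun_prop)).trans (lintegral_congr_ae ?_)
  filter_upwards [M.ae_admissible] with ω hω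
  have := isProbabilityMeasureBeta one_pos hω.1
  exact lintegral_prod_mul hf.aemeasurable (hg.comp measurable_prodMk_left).aemeasurable

theorem lintegral_stickIndex_values (M : Model h S P) (z : Fin N → Fin K) (a : Fin K ↪ ℕ)
    (q : Fin m → S)
    {g : (FirstLayer d × SecondLayer d) × (Fin K → EuclideanSpace ℝ (Fin m)) → ENNReal}
    (hg : Measurable g) :
    ∫⁻ ω in {ω | ∀ i : Fin N, M.stickIndex i ω = a (z i)},
        g ((M.first ω, M.second ω), fun j => M.values q (a j) ω) ∂P
      = ∫⁻ ω, stickProb (M.second ω).nu (letterCount z) a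
          * ∫⁻ e, g ((M.first ω, M.second ω), e)
              ∂(Measure.pi fun _ : Fin K => baseGP (M.second ω) q) ∂P := by
  let L := Finset.univ.sup fun j => a j + 1
  have lt_L : ∀ j, a j < L := lt_sup_add_one a
  have meas_weight (l : ℕ) : Measurable fun v : Fin L → ℝ => stickWeight (extendStick v) l :=
    (measurable_stickWeight l).comp (measurable_pi_lambda _ fun r => measurable_extendStick r)
  have meas_prod : Measurable fun v : Fin L → ℝ =>
      ∏ i, ENNReal.ofReal (stickWeight (extendStick v) (a (z i))) :=
    Finset.measurable_prod _ fun i _ => (meas_weight _).ennreal_ofReal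
  have weights_eq (ω : Ω) : ∏ i, ENNReal.ofReal (stickWeight (fun r => M.stick r ω) (a (z i)))
      = ∏ i, ENNReal.ofReal (stickWeight (extendStick fun r : Fin L => M.stick r ω) (a (z i))) :=
    Finset.prod_congr rfl fun i _ => by
      rw [stickWeight_congr (w := extendStick fun r : Fin L => M.stick r ω) fun r hr =>
        (extendStick_coe (fun r : Fin L => M.stick r ω) ⟨r, hr.trans_lt (lt_L (z i))⟩).symm]
  calc
    _ = ∫⁻ ω, (∏ i, ENNReal.ofReal (stickWeight (extendStick fun r : Fin L => M.stick r ω)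
          (a (z i)))) * g ((M.first ω, M.second ω), fun j => M.values q (a j) ω) ∂P := by
      simp_rw [← weights_eq, mul_comm _ (g _)]
      exact M.lintegral_stickIndex (fun i => a (z i))
        (f := fun c => g (c.1, fun j => WithLp.toLp 2 fun b => c.2.2 (a j) (q b))) (by fun_prop)
    _ = _ := M.lintegral_stick_mul_values q meas_prod
      (g := fun c => g (c.1, fun j => c.2 ⟨a j, lt_L j⟩)) (by fun_prop)
    _ = _ := lintegral_congr_ae ?_
  filter_upwards [M.ae_admissible] with ω hω
  rw [lintegral_prod_stickWeight hω.1 z lt_L,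
    ← map_pi_comp_embedding (ι := Fin K) (κ := Fin L) (baseGP (M.second ω) q)
      (a := fun j => ⟨a j, lt_L j⟩) fun i j hij => a.injective (by simpa using hij),
    lintegral_map (by fun_prop) (by fun_prop)]

theorem measurable_lintegral_baseKernel (M : Model h S P) (q : Fin m → S)
    {g : (FirstLayer d × SecondLayer d) × (Fin K → EuclideanSpace ℝ (Fin m)) → ENNReal}
    (hg : Measurable g) :
    Measurable fun ω => ∫⁻ e, g ((M.first ω, M.second ω), e) ∂baseKernel K q (M.second ω) :=
  Measurable.lintegral_kernel_prod_right'
    (κ := (baseKernel K q).comap M.second M.measurable_second)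
    (f := fun c => g ((M.first c.1, M.second c.1), c.2))
    (hg.comp ((M.measurable_hyper.comp measurable_fst).prodMk measurable_snd))

theorem lintegral_assignment (M : Model h S P) {z : ℕ → ℕ} (hz : appearance z N = List.range K)
    (q : Fin m → S) {F : Ω → ENNReal}
    {g : (FirstLayer d × SecondLayer d) × (Fin K → EuclideanSpace ℝ (Fin m)) → ENNReal}
    (hg : Measurable g)
    (hF : ∀ (a : Fin K ↪ ℕ) ω, (∀ i : Fin N, M.stickIndex i ω = a (letters hz i)) →
      F ω = g ((M.first ω, M.second ω), fun j => M.values q (a j) ω)) :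
    ∫⁻ ω in {ω | ∀ i < N, M.assignment i ω = z i}, F ω ∂P
      = ∫⁻ ω, partitionProb (M.second ω).nu (letterCount (letters hz))
          * ∫⁻ e, g ((M.first ω, M.second ω), e) ∂baseKernel K q (M.second ω) ∂P := by
  have eq_iUnion : {ω | ∀ i < N, M.assignment i ω = z i}
      = ⋃ a : Fin K ↪ ℕ, {ω | ∀ i : Fin N, M.stickIndex i ω = a (letters hz i)} := by
    ext ω
    simp only [Set.mem_iUnion, Set.mem_ofPred_eq]
    exact forall_appearanceLabel_eq_iff hz
  have disjoint : Pairwise (Function.onFun Disjoint fun a : Fin K ↪ ℕ =>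
      {ω | ∀ i : Fin N, M.stickIndex i ω = a (letters hz i)}) := fun a b hab =>
    Set.disjoint_left.2 fun ω ha hb =>
      hab (letters_unique (c := fun k => M.stickIndex k ω) hz ha hb)
  have on_piece : ∀ a : Fin K ↪ ℕ,
      ∫⁻ ω in {ω | ∀ i : Fin N, M.stickIndex i ω = a (letters hz i)}, F ω ∂P
        = ∫⁻ ω, stickProb (M.second ω).nu (letterCount (letters hz)) a
          * ∫⁻ e, g ((M.first ω, M.second ω), e) ∂baseKernel K q (M.second ω) ∂P := fun a =>
    (setLIntegral_congr_fun (M.measurableSet_stickIndex_eq _) fun ω hω => hF a ω hω).trans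
      (M.lintegral_stickIndex_values (letters hz) a q hg)
  have : Countable (Fin K ↪ ℕ) := DFunLike.coe_injective.countable
  rw [eq_iUnion, lintegral_iUnion (fun a => M.measurableSet_stickIndex_eq _) disjoint]
  simp_rw [on_piece]
  rw [← lintegral_tsum]
  · refine lintegral_congr_ae ?_
    filter_upwards [M.ae_admissible] with ω hω
    rw [ENNReal.tsum_mul_right, tsum_stickProb hω.1 (letterCount_pos hz)]
  · intro a
    obtain ⟨s, meas_s, eq_s⟩ := exists_measurable_stickProb (letterCount (letters hz)) a
    exact ((meas_s.comp (measurable_nu.comp M.measurable_second)).aemeasurable.congr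
      (M.ae_admissible.mono fun ω hω => (eq_s _ hω.1).symm)).mul
        (M.measurable_lintegral_baseKernel q hg).aemeasurable

end Model

/-! ### The conditional law of the next surface -/

/-- A table with the given rows, filled with zeros. -/
def padRows {K : ℕ} (n : ℕ) (t : Fin K → Fin n → ℝ) : Fin n → Fin n → ℝ :=
  fun j i => if h : (j : ℕ) < K then t ⟨j, h⟩ i else 0

@[fun_prop]
theorem measurable_padRows {K n : ℕ} : Measurable (padRows (K := K) n) := by
  refine measurable_pi_lambda _ fun j => measurable_pi_lambda _ fun i => ?_
  unfold padRows
  split_ifs <;> fun_prop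

theorem measurable_lintegral_of_measurable {α β : Type*} [MeasurableSpace α] [MeasurableSpace β]
    {κ : α → Measure β} [∀ a, IsProbabilityMeasure (κ a)] (hκ : Measurable κ)
    {f : α × β → ENNReal} (hf : Measurable f) : Measurable fun a => ∫⁻ b, f (a, b) ∂κ a :=
  have : IsMarkovKernel (⟨κ, hκ⟩ : Kernel α β) := ⟨inferInstance⟩
  hf.lintegral_kernel_prod_right' (κ := ⟨κ, hκ⟩)

theorem lintegral_eq_tsum_fiber {Ω ι : Type*} [MeasurableSpace Ω] [Countable ι]
    [MeasurableSpace ι] [MeasurableSingletonClass ι] (μ : Measure Ω) {T : Ω → ι}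
    (hT : Measurable T) (F : Ω → ENNReal) :
    ∫⁻ ω, F ω ∂μ = ∑' i, ∫⁻ ω in {ω | T ω = i}, F ω ∂μ := by
  have cover : (⋃ i, {ω | T ω = i}) = Set.univ :=
    Set.eq_univ_of_forall fun ω => Set.mem_iUnion.2 ⟨T ω, rfl⟩
  rw [← lintegral_iUnion (s := fun i => {ω | T ω = i}) (fun i => hT (measurableSet_singleton i))
    fun i j hij => Set.disjoint_left.2 fun ω hi hj => hij (hi.symm.trans hj), cover,
    Measure.restrict_univ]

theorem lintegral_urnKriging {d m n : ℕ} {S : Set (EuclideanSpace ℝ (Fin d))}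
    (θ : SecondLayer d) (x : Fin n → S) (t : Fin n → Fin n → ℝ) (z : Fin n → ℕ) (p : Fin m → S)
    {f : ℕ × EuclideanSpace ℝ (Fin m) → ENNReal} (hf : Measurable f) :
    ∫⁻ y, f y ∂urnKriging θ x t z p
      = ENNReal.ofReal (θ.nu / (θ.nu + n)) * ∫⁻ u, f (numSurfaces z, u) ∂baseGP θ p
        + ∑ j ∈ Finset.univ.filter (fun j : Fin n => (j : ℕ) < numSurfaces z),
            ENNReal.ofReal (surfaceCount z j / (θ.nu + n))
              * ∫⁻ u, f ((j : ℕ), u) ∂krigGP θ x (t j) p := by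
  have lintegral_dirac_prod (k : ℕ) (μ : Measure (EuclideanSpace ℝ (Fin m))) [SFinite μ] :
      ∫⁻ y, f y ∂(Measure.dirac k).prod μ = ∫⁻ u, f (k, u) ∂μ := by
    rw [Measure.dirac_prod, lintegral_map hf measurable_prodMk_left]
  simp only [urnKriging, lintegral_add_measure, lintegral_smul_measure,
    lintegral_finsetSum_measure, lintegral_dirac_prod, smul_eq_mul]

theorem numSurfaces_of_appearance_eq_range {n K : ℕ} {w : Fin n → ℕ}
    (hw : appearance (extendWord w 0) n = List.range K) : numSurfaces w = K := by
  have := numSurfaces_eq_length (extendWord w 0) n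
  rw [hw, List.length_range] at this
  simpa only [extendWord_coe] using this

theorem letterCount_extendWord {n K : ℕ} {w : Fin n → ℕ}
    (hw : appearance (extendWord w 0) n = List.range K) (j : Fin K) :
    letterCount (letters hw) j = surfaceCount w j := by
  rw [letterCount_letters]
  simp_rw [extendWord_coe]

theorem letterCount_extendWord_succ {n j K K' : ℕ} {w : Fin n → ℕ}
    (hw : appearance (extendWord w 0) n = List.range K)
    (hz : appearance (extendWord w j) (n + 1) = List.range K') {i : Fin K'} {i' : Fin K}
    (hi : (i : ℕ) = i') :
    letterCount (letters hz) i = letterCount (letters hw) i' + if j = i then 1 else 0 := by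
  rw [letterCount_letters, surfaceCount_extendWord, letterCount_extendWord, hi]

theorem surfaceCount_eq_zero {n K : ℕ} {w : Fin n → ℕ}
    (hw : appearance (extendWord w 0) n = List.range K) : surfaceCount w K = 0 := by
  rw [surfaceCount, Finset.card_eq_zero, Finset.filter_eq_empty_iff]
  intro i _ hi
  have := lt_of_appearance_eq_range hw i.2
  rw [extendWord_coe, hi] at this
  exact lt_irrefl _ this

theorem appearance_extendWord_of_lt {n j K : ℕ} {w : Fin n → ℕ}
    (hw : appearance (extendWord w 0) n = List.range K) (hj : j < K) :
    appearance (extendWord w j) (n + 1) = List.range K := by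
  rw [appearance_succ, appearance_extendWord w j 0, hw, extendWord_last,
    if_pos (List.mem_range.2 hj)]

theorem appearance_extendWord_new {n K : ℕ} {w : Fin n → ℕ}
    (hw : appearance (extendWord w 0) n = List.range K) :
    appearance (extendWord w K) (n + 1) = List.range (K + 1) := by
  rw [appearance_succ, appearance_extendWord w K 0, hw, extendWord_last, if_neg (by simp),
    List.range_succ]

theorem partitionProb_realized {ν : ℝ} (hν : 0 < ν) {n j K : ℕ} {w : Fin n → ℕ}
    (hw : appearance (extendWord w 0) n = List.range K) (hj : j < K) :
    partitionProb ν (letterCount (letters (appearance_extendWord_of_lt hw hj)))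
      = partitionProb ν (letterCount (letters hw))
        * ENNReal.ofReal (surfaceCount w j / (ν + n)) := by
  rw [partitionProb_of_eq_add_one hν (letterCount_pos hw) (j := ⟨j, hj⟩)
    (by rw [letterCount_extendWord_succ hw _ rfl, if_pos rfl])
    fun i hi => by
      rw [letterCount_extendWord_succ hw _ rfl, if_neg fun h => hi (Fin.ext h.symm), add_zero],
    sum_letterCount, letterCount_extendWord, mul_comm]

theorem partitionProb_new {ν : ℝ} (hν : 0 < ν) {n K : ℕ} {w : Fin n → ℕ}
    (hw : appearance (extendWord w 0) n = List.range K) :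
    partitionProb ν (letterCount (letters (appearance_extendWord_new hw)))
      = partitionProb ν (letterCount (letters hw)) * ENNReal.ofReal (ν / (ν + n)) := by
  rw [partitionProb_snoc hν (m := letterCount (letters hw))
    (fun i => by
      rw [letterCount_extendWord_succ hw _ (Fin.val_castSucc i), Fin.val_castSucc,
        if_neg i.2.ne', add_zero])
    (by rw [letterCount_letters, surfaceCount_extendWord, Fin.val_last, if_pos rfl,
      surfaceCount_eq_zero hw]),
    sum_letterCount, mul_comm]

theorem measurable_appearanceLabel (i : ℕ) : Measurable fun c : ℕ → ℕ => appearanceLabel c i := by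
  have finite_dependence : (fun c => appearanceLabel c i)
      = fun c => appearanceLabel (extendWord (fun k : Fin (i + 1) => c k) 0) i := funext fun c => by
    have congr_lt : ∀ k < i + 1, c k = extendWord (fun k : Fin (i + 1) => c k) 0 k :=
      fun k hk => by simp [extendWord, hk]
    rw [appearanceLabel, appearanceLabel, appearance_congr congr_lt,
      ← congr_lt i (Nat.lt_succ_self i)]
  rw [finite_dependence]
  exact (measurable_of_countable fun c : Fin (i + 1) → ℕ =>
    appearanceLabel (extendWord c 0) i).comp (by fun_prop)

/-- The latent quantities `Θ`, `ξ_{1:n}(x_{1:n})` and `z_{1:n}`, whose posterior is term C. -/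
abbrev Latents (d n : ℕ) : Type :=
  (FirstLayer d × SecondLayer d) × (Fin n → Fin n → ℝ) × (Fin n → ℕ)

/-- The coordinates of the latents on which the law of the next surface depends, in the order in
which the statement lists them. -/
def urnState {d n : ℕ} (c : Latents d n) : (Fin n → Fin n → ℝ) × (Fin n → ℕ) × SecondLayer d :=
  (c.2.1, c.2.2, c.1.2)

@[fun_prop]
theorem measurable_urnState {d n : ℕ} : Measurable (urnState (d := d) (n := n)) := by
  unfold urnState
  fun_prop

/-- The values of the hyperparameters, the sticks, the surfaces and the surface indices. -/
abbrev Noiseless {d : ℕ} (S : Set (EuclideanSpace ℝ (Fin d))) : Type :=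
  (FirstLayer d × SecondLayer d) × (ℕ → ℝ) × (ℕ → S → ℝ) × (ℕ → ℕ)

section Measurability

variable {d m n : ℕ} {S : Set (EuclideanSpace ℝ (Fin d))}

theorem measurable_surface_index (i : ℕ) (p : S) :
    Measurable fun u : (ℕ → S → ℝ) × (ℕ → ℕ) => u.1 (u.2 i) p :=
  (measurable_from_prod_countable_left (f := fun u : (ℕ → S → ℝ) × ℕ => u.1 u.2 p)
    fun l => by fun_prop).comp
    (by fun_prop : Measurable fun u : (ℕ → S → ℝ) × (ℕ → ℕ) => (u.1, u.2 i))

/-- The table of the values of the realized surfaces, as a function of all surfaces and indices. -/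
def tableOf (x : Fin n → S) (u : (ℕ → S → ℝ) × (ℕ → ℕ)) : Fin n → Fin n → ℝ :=
  fun j i => ((appearance u.2 n)[(j : ℕ)]?).elim 0 fun l => u.1 l (x i)

theorem measurable_tableOf (x : Fin n → S) : Measurable (tableOf x) := by
  have finite_dependence : tableOf x
      = fun u => tableOf x (u.1, extendWord (fun k : Fin n => u.2 k) 0) := funext fun u => by
    unfold tableOf
    rw [appearance_congr (c := u.2) (z := extendWord (fun k : Fin n => u.2 k) 0)
      fun k hk => by simp [extendWord, hk]]
  have meas_fixed (c : ℕ → ℕ) : Measurable fun s : ℕ → S → ℝ => tableOf x (s, c) := by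
    refine measurable_pi_lambda _ fun j => measurable_pi_lambda _ fun i => ?_
    change Measurable fun s : ℕ → S → ℝ => ((appearance c n)[(j : ℕ)]?).elim 0 fun l => s l (x i)
    obtain _ | l := (appearance c n)[(j : ℕ)]?
    · exact measurable_const
    · exact (by fun_prop : Measurable fun s : ℕ → S → ℝ => s l (x i))
  rw [finite_dependence]
  exact (measurable_from_prod_countable_left
    (f := fun u : (ℕ → S → ℝ) × (Fin n → ℕ) => tableOf x (u.1, extendWord u.2 0))
    fun c => meas_fixed (extendWord c 0)).comp
    (by fun_prop : Measurable fun u : (ℕ → S → ℝ) × (ℕ → ℕ) => (u.1, fun k : Fin n => u.2 k))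

theorem measurable_lintegral_baseGP (p : Fin m → S) (k : ℕ)
    {f : Latents d n × (ℕ × EuclideanSpace ℝ (Fin m)) → ENNReal} (hf : Measurable f) :
    Measurable fun c : Latents d n => ∫⁻ u, f (c, (k, u)) ∂baseGP c.1.2 p :=
  measurable_lintegral_of_measurable (κ := fun c : Latents d n => baseGP c.1.2 p)
    ((measurable_baseGP p).comp (by fun_prop)) (f := fun c => f (c.1, (k, c.2))) (by fun_prop)

theorem measurable_lintegral_krigGP (x : Fin n → S) (p : Fin m → S) (j : Fin n)
    {f : Latents d n × (ℕ × EuclideanSpace ℝ (Fin m)) → ENNReal} (hf : Measurable f) :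
    Measurable fun c : Latents d n => ∫⁻ u, f (c, (j, u)) ∂krigGP c.1.2 x (c.2.1 j) p :=
  measurable_lintegral_of_measurable (κ := fun c : Latents d n => krigGP c.1.2 x (c.2.1 j) p)
    ((measurable_krigGP x p).comp (f := fun c : Latents d n => (c.1.2, c.2.1 j)) (by fun_prop))
    (f := fun c => f (c.1, ((j : ℕ), c.2))) (by fun_prop)

end Measurability

namespace Model

variable {d m n K : ℕ} {h : HyperPrior d} {S : Set (EuclideanSpace ℝ (Fin d))}
  {Ω : Type*} [MeasurableSpace Ω] {P : Measure Ω} [IsProbabilityMeasure P]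

/-- The latent quantities behind the first `n` observations. -/
def latents (M : Model h S P) (x : Fin n → S) (ω : Ω) : Latents d n :=
  ((M.first ω, M.second ω), M.table x ω, M.assignments n ω)

/-- The label of the surface of observation `n` and its values at finitely many points. -/
def nextSurface (M : Model h S P) (n : ℕ) (p : Fin m → S) (ω : Ω) :
    ℕ × EuclideanSpace ℝ (Fin m) :=
  (M.assignment n ω, WithLp.toLp 2 fun a => M.latent n (p a) ω)

/-- All random variables of the model but the noise. -/
def noiseless (M : Model h S P) (ω : Ω) : Noiseless S :=
  ((M.first ω, M.second ω), (fun r => M.stick r ω), (fun l p => M.surface l p ω),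
    fun i => M.stickIndex i ω)

theorem measurable_noiseless (M : Model h S P) : Measurable M.noiseless :=
  M.measurable_hyper.prodMk ((measurable_pi_lambda _ M.measurable_stick).prodMk
    ((measurable_pi_lambda _ fun l =>
      measurable_pi_lambda _ fun p => M.measurable_surface l p).prodMk
      (measurable_pi_lambda _ M.measurable_stickIndex)))

theorem measurable_surfaces_indices (M : Model h S P) :
    Measurable fun ω => (M.noiseless ω).2.2 :=
  (measurable_snd.comp measurable_snd).comp M.measurable_noiseless

theorem measurable_assignment (M : Model h S P) (i : ℕ) : Measurable (M.assignment i) :=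
  (measurable_appearanceLabel i).comp (measurable_pi_lambda _ M.measurable_stickIndex)

theorem measurable_assignments (M : Model h S P) (n : ℕ) : Measurable (M.assignments n) :=
  measurable_pi_lambda _ fun i => M.measurable_assignment i

theorem measurable_latent (M : Model h S P) (i : ℕ) (p : S) : Measurable (M.latent i p) :=
  (measurable_surface_index i p).comp M.measurable_surfaces_indices

theorem measurable_table (M : Model h S P) (x : Fin n → S) : Measurable (M.table x) :=
  (measurable_tableOf x).comp M.measurable_surfaces_indices

theorem measurable_latents (M : Model h S P) (x : Fin n → S) : Measurable (M.latents x) :=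
  M.measurable_hyper.prodMk ((M.measurable_table x).prodMk (M.measurable_assignments n))

theorem measurable_nextSurface (M : Model h S P) (n : ℕ) (p : Fin m → S) :
    Measurable (M.nextSurface n p) := by
  have := fun a => M.measurable_latent n (p a)
  have := M.measurable_assignment n
  unfold nextSurface
  fun_prop

theorem table_eq_padRows (M : Model h S P) (x : Fin n → S) (p : Fin m → S) {a : Fin K → ℕ} {ω : Ω}
    (ha : appearance (fun k => M.stickIndex k ω) n = List.ofFn a) :
    M.table x ω = padRows n fun k => leftPart n m (M.values (Fin.append x p) (a k) ω) := by
  funext j i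
  unfold table padRows
  rw [ha, List.getElem?_ofFn]
  by_cases hj : (j : ℕ) < K <;> simp [hj, leftPart, values]

theorem nextSurface_eq_rightPart (M : Model h S P) (x : Fin n → S) (p : Fin m → S) {N l : ℕ}
    {ω : Ω} (hl : M.stickIndex N ω = l) :
    M.nextSurface N p ω
      = (M.assignment N ω, rightPart n m (M.values (Fin.append x p) l ω)) := by
  subst hl
  refine Prod.ext rfl ?_
  ext a
  simp [nextSurface, latent, rightPart, values]

theorem latents_eq_of_letters (M : Model h S P) (x : Fin n → S) (p : Fin m → S) {w : Fin n → ℕ}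
    (hw : appearance (extendWord w 0) n = List.range K) (a : Fin K ↪ ℕ) {ω : Ω}
    (ha : ∀ i : Fin n, M.stickIndex i ω = a (letters hw i)) :
    M.latents x ω = ((M.first ω, M.second ω),
      padRows n fun k => leftPart n m (M.values (Fin.append x p) (a k) ω), w) := by
  have assignments_eq : M.assignments n ω = w := funext fun i =>
    (appearanceLabel_eq_of_letters (c := fun k => M.stickIndex k ω) hw a ha i.2).trans
      (extendWord_coe w 0 i)
  rw [latents, assignments_eq, M.table_eq_padRows x p (appearance_eq_of_letters hw a ha)]

theorem lintegral_latents (M : Model h S P) (x : Fin n → S) (p : Fin m → S) {w : Fin n → ℕ}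
    (hw : appearance (extendWord w 0) n = List.range K)
    {g : Latents d n → ENNReal} (hg : Measurable g) :
    ∫⁻ ω in {ω | ∀ i < n, M.assignment i ω = extendWord w 0 i}, g (M.latents x ω) ∂P
      = ∫⁻ ω, partitionProb (M.second ω).nu (letterCount (letters hw))
          * ∫⁻ e, g ((M.first ω, M.second ω), padRows n fun k => leftPart n m (e k), w)
            ∂baseKernel K (Fin.append x p) (M.second ω) ∂P :=
  M.lintegral_assignment hw (Fin.append x p)
    (g := fun c => g (c.1, padRows n fun k => leftPart n m (c.2 k), w)) (by fun_prop)
    fun a ω ha => by rw [M.latents_eq_of_letters x p hw a ha]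

theorem lintegral_latents_nextSurface (M : Model h S P) (x : Fin n → S) (p : Fin m → S) {j K' : ℕ}
    {w : Fin n → ℕ} (hw : appearance (extendWord w 0) n = List.range K)
    (hz : appearance (extendWord w j) (n + 1) = List.range K') (hK : K ≤ K')
    {f : Latents d n × (ℕ × EuclideanSpace ℝ (Fin m)) → ENNReal} (hf : Measurable f) :
    ∫⁻ ω in {ω | ∀ i < n + 1, M.assignment i ω = extendWord w j i},
        f (M.latents x ω, M.nextSurface n p ω) ∂P
      = ∫⁻ ω, partitionProb (M.second ω).nu (letterCount (letters hz))
          * ∫⁻ e, f (((M.first ω, M.second ω),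
                padRows n fun k => leftPart n m (e (Fin.castLE hK k)), w),
              (j, rightPart n m (e (letters hz (Fin.last n)))))
            ∂baseKernel K' (Fin.append x p) (M.second ω) ∂P := by
  refine M.lintegral_assignment hz (Fin.append x p)
    (g := fun c => f ((c.1, padRows n fun k => leftPart n m (c.2 (Fin.castLE hK k)), w),
      (j, rightPart n m (c.2 (letters hz (Fin.last n)))))) (by fun_prop) fun a ω ha => ?_
  have past : ∀ i : Fin n,
      M.stickIndex i ω = (Fin.castLEEmb hK).trans a (letters hw i) := fun i =>
    (ha i.castSucc).trans (congrArg a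
      (Fin.ext ((extendWord_coe w j i).trans (extendWord_coe w 0 i).symm)))
  have label_eq : M.assignment n ω = j :=
    (appearanceLabel_eq_of_letters (c := fun k => M.stickIndex k ω) hz a ha
      (Nat.lt_succ_self n)).trans (extendWord_last w j)
  have index_eq : M.stickIndex n ω = a (letters hz (Fin.last n)) := ha (Fin.last n)
  rw [M.latents_eq_of_letters x p hw _ past, M.nextSurface_eq_rightPart x p index_eq, label_eq]
  rfl

theorem lintegral_nextSurface_new (M : Model h S P) (x : Fin n → S) (p : Fin m → S)
    {w : Fin n → ℕ} (hw : appearance (extendWord w 0) n = List.range K)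
    {f : Latents d n × (ℕ × EuclideanSpace ℝ (Fin m)) → ENNReal} (hf : Measurable f) :
    ∫⁻ ω in {ω | ∀ i < n + 1, M.assignment i ω = extendWord w K i},
        f (M.latents x ω, M.nextSurface n p ω) ∂P
      = ∫⁻ ω in {ω | ∀ i < n, M.assignment i ω = extendWord w 0 i},
          ENNReal.ofReal ((M.second ω).nu / ((M.second ω).nu + n))
            * ∫⁻ u, f (M.latents x ω, (K, u)) ∂baseGP (M.second ω) p ∂P := by
  have meas_nu := measurable_nu (d := d)
  have meas_inner := measurable_lintegral_baseGP p K hf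
  refine (M.lintegral_latents_nextSurface x p hw (appearance_extendWord_new hw) K.le_succ
    hf).trans (Eq.trans ?_ (M.lintegral_latents x p hw (g := fun c =>
      ENNReal.ofReal (c.1.2.nu / (c.1.2.nu + n)) * ∫⁻ u, f (c, (K, u)) ∂baseGP c.1.2 p)
      (by fun_prop)).symm)
  refine lintegral_congr_ae ?_
  filter_upwards [M.ae_admissible] with ω hω
  have letter_last : letters (appearance_extendWord_new hw) (Fin.last n) = Fin.last K :=
    Fin.ext (extendWord_last w K)
  rw [partitionProb_new hω.1 hw, letter_last, mul_assoc, lintegral_const_mul _ (by fun_prop),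
    ← map_rightPart_baseGP hω x p]
  congr 2
  exact lintegral_pi_castSucc_last (baseGP (M.second ω) (Fin.append x p)) measurable_leftPart
    measurable_rightPart
    (f := fun c => f (((M.first ω, M.second ω), padRows n c.1, w), (K, c.2))) (by fun_prop)

theorem lintegral_nextSurface_realized (M : Model h S P) {x : Fin n → S}
    (hx : Function.Injective x) (p : Fin m → S) {w : Fin n → ℕ}
    (hw : appearance (extendWord w 0) n = List.range K) {j : Fin n} (hj : (j : ℕ) < K)
    {f : Latents d n × (ℕ × EuclideanSpace ℝ (Fin m)) → ENNReal} (hf : Measurable f) :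
    ∫⁻ ω in {ω | ∀ i < n + 1, M.assignment i ω = extendWord w j i},
        f (M.latents x ω, M.nextSurface n p ω) ∂P
      = ∫⁻ ω in {ω | ∀ i < n, M.assignment i ω = extendWord w 0 i},
          ENNReal.ofReal (surfaceCount w j / ((M.second ω).nu + n))
            * ∫⁻ u, f (M.latents x ω, (j, u)) ∂krigGP (M.second ω) x (M.table x ω j) p ∂P := by
  have meas_nu := measurable_nu (d := d)
  have meas_inner := measurable_lintegral_krigGP x p j hf
  refine (M.lintegral_latents_nextSurface x p hw (appearance_extendWord_of_lt hw hj) le_rfl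
    hf).trans (Eq.trans ?_ (M.lintegral_latents x p hw (g := fun c =>
      ENNReal.ofReal (surfaceCount w j / (c.1.2.nu + n))
        * ∫⁻ u, f (c, (j, u)) ∂krigGP c.1.2 x (c.2.1 j) p) (by fun_prop)).symm)
  refine lintegral_congr_ae ?_
  filter_upwards [M.ae_admissible] with ω hω
  have letter_last : letters (appearance_extendWord_of_lt hw hj) (Fin.last n) = ⟨j, hj⟩ :=
    Fin.ext (extendWord_last w j)
  have meas_slice := meas_inner.fun_comp (f := fun e : Fin K → EuclideanSpace ℝ (Fin (n + m)) =>
    ((M.first ω, M.second ω), padRows n fun k => leftPart n m (e k), w)) (by fun_prop)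
  rw [partitionProb_realized hω.1 hw hj, letter_last, mul_assoc,
    lintegral_const_mul _ meas_slice]
  congr 2
  have padRows_apply (t : Fin K → Fin n → ℝ) : padRows n t j = t ⟨j, hj⟩ := by
    funext i
    exact dif_pos hj
  simp only [padRows_apply]
  exact lintegral_of_hasCondDistrib (hasCondDistrib_pi_apply measurable_leftPart
    measurable_rightPart (hasCondDistrib_krigKernel hω hx p) ⟨j, hj⟩)
    (f := fun c => f (((M.first ω, M.second ω), padRows n c.1, w), (j, c.2))) (by fun_prop)

end Model

theorem sum_filter_lt_eq_sum_range {R : Type*} [AddCommMonoid R] {n K : ℕ} (hK : K ≤ n)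
    (g : ℕ → R) :
    ∑ j ∈ Finset.univ.filter (fun j : Fin n => (j : ℕ) < K), g j = ∑ j ∈ Finset.range K, g j := by
  rw [Finset.sum_filter, Fin.sum_univ_eq_sum_range (fun j => if j < K then g j else 0),
    ← Finset.sum_filter]
  congr 1
  ext j
  simp only [Finset.mem_filter, Finset.mem_range]
  omega

theorem le_of_appearance_eq_range {n K : ℕ} {w : Fin n → ℕ}
    (hw : appearance (extendWord w 0) n = List.range K) : K ≤ n :=
  numSurfaces_of_appearance_eq_range hw ▸ Finset.card_image_le.trans_eq (Finset.card_fin n)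

namespace Model

variable {d m n K : ℕ} {h : HyperPrior d} {S : Set (EuclideanSpace ℝ (Fin d))}
  {Ω : Type*} [MeasurableSpace Ω] {P : Measure Ω} [IsProbabilityMeasure P]

theorem assignment_lt_add_one (M : Model h S P) {w : Fin n → ℕ}
    (hw : appearance (extendWord w 0) n = List.range K) {ω : Ω}
    (hω : ∀ i < n, M.assignment i ω = extendWord w 0 i) : M.assignment n ω < K + 1 := by
  have length_eq : (appearance (fun k => M.stickIndex k ω) n).length = K := by
    have labels_eq := appearance_appearanceLabel (c := fun k => M.stickIndex k ω) (n := n)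
    rw [appearance_congr (show ∀ i < n, appearanceLabel _ i = _ from hω), hw] at labels_eq
    simpa using (congrArg List.length labels_eq).symm
  have length_succ_le : (appearance (fun k => M.stickIndex k ω) (n + 1)).length ≤ K + 1 := by
    rw [appearance_succ]
    split_ifs <;> simp [length_eq]
  exact (appearanceLabel_lt_length (Nat.lt_succ_self n)).trans_le length_succ_le

theorem measurableSet_past (M : Model h S P) (N : ℕ) (z : ℕ → ℕ) :
    MeasurableSet {ω | ∀ i < N, M.assignment i ω = z i} := by
  simp only [Set.ofPred_forall]
  exact MeasurableSet.iInter fun i => MeasurableSet.iInter fun _ =>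
    M.measurable_assignment i (measurableSet_singleton _)

theorem setLIntegral_past_eq_sum (M : Model h S P) {w : Fin n → ℕ}
    (hw : appearance (extendWord w 0) n = List.range K) (F : Ω → ENNReal) :
    ∫⁻ ω in {ω | ∀ i < n, M.assignment i ω = extendWord w 0 i}, F ω ∂P
      = ∑ j ∈ Finset.range (K + 1),
          ∫⁻ ω in {ω | ∀ i < n + 1, M.assignment i ω = extendWord w j i}, F ω ∂P := by
  have fiber_eq (j : ℕ) : {ω | M.assignment n ω = j}
      ∩ {ω | ∀ i < n, M.assignment i ω = extendWord w 0 i}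
      = {ω | ∀ i < n + 1, M.assignment i ω = extendWord w j i} := by
    ext ω
    simp only [Set.mem_inter_iff, Set.mem_ofPred_eq, Nat.forall_lt_succ_right, extendWord_last]
    rw [and_comm]
    refine and_congr_left' (forall₂_congr fun i hi => ?_)
    simp [extendWord, hi]
  have meas_fiber (j : ℕ) : MeasurableSet {ω | M.assignment n ω = j} :=
    M.measurable_assignment n (measurableSet_singleton j)
  rw [lintegral_eq_tsum_fiber _ (M.measurable_assignment n)]
  simp only [Measure.restrict_restrict (meas_fiber _), fiber_eq]
  refine tsum_eq_sum fun j hj => ?_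
  have fiber_empty : {ω | ∀ i < n + 1, M.assignment i ω = extendWord w j i} = ∅ := by
    rw [← fiber_eq, Set.eq_empty_iff_forall_notMem]
    rintro ω ⟨rfl, past⟩
    exact hj (Finset.mem_range.2 (M.assignment_lt_add_one hw past))
  rw [fiber_empty, Measure.restrict_empty, lintegral_zero_measure]

theorem lintegral_nextSurface (M : Model h S P) {x : Fin n → S} (hx : Function.Injective x)
    (p : Fin m → S) {w : Fin n → ℕ} (hw : appearance (extendWord w 0) n = List.range K)
    {f : Latents d n × (ℕ × EuclideanSpace ℝ (Fin m)) → ENNReal} (hf : Measurable f) :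
    ∫⁻ ω in {ω | ∀ i < n, M.assignment i ω = extendWord w 0 i},
        f (M.latents x ω, M.nextSurface n p ω) ∂P
      = ∫⁻ ω in {ω | ∀ i < n, M.assignment i ω = extendWord w 0 i},
          ∫⁻ y, f (M.latents x ω, y)
            ∂urnKriging (M.second ω) x (M.table x ω) (M.assignments n ω) p ∂P := by
  have meas_nu := (measurable_nu (d := d)).comp M.measurable_second
  have meas_new := (measurable_lintegral_baseGP p K hf).comp (M.measurable_latents x)
  have meas_realized (j : Fin n) :=
    (measurable_lintegral_krigGP x p j hf).comp (M.measurable_latents x)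
  have urn_eq : Set.EqOn (fun ω => ∫⁻ y, f (M.latents x ω, y)
      ∂urnKriging (M.second ω) x (M.table x ω) (M.assignments n ω) p)
      (fun ω => ENNReal.ofReal ((M.second ω).nu / ((M.second ω).nu + n))
          * ∫⁻ u, f (M.latents x ω, (K, u)) ∂baseGP (M.second ω) p
        + ∑ j ∈ Finset.univ.filter (fun j : Fin n => (j : ℕ) < K),
            ENNReal.ofReal (surfaceCount w j / ((M.second ω).nu + n))
              * ∫⁻ u, f (M.latents x ω, (j, u)) ∂krigGP (M.second ω) x (M.table x ω j) p)
      {ω | ∀ i < n, M.assignment i ω = extendWord w 0 i} := fun ω hω => by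
    have assignments_eq : M.assignments n ω = w :=
      funext fun i => (hω i i.2).trans (extendWord_coe w 0 i)
    simp only [lintegral_urnKriging _ x _ _ p (f := fun y => f (M.latents x ω, y)) (by fun_prop),
      assignments_eq, numSurfaces_of_appearance_eq_range hw]
  rw [setLIntegral_congr_fun (M.measurableSet_past n _) urn_eq,
    lintegral_add_left (by exact Measurable.mul (by fun_prop) meas_new),
    lintegral_finsetSum _ fun j _ => by exact Measurable.mul (by fun_prop) (meas_realized j),
    M.setLIntegral_past_eq_sum hw, Finset.sum_range_succ, add_comm,
    M.lintegral_nextSurface_new x p hw hf,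
    ← sum_filter_lt_eq_sum_range (le_of_appearance_eq_range hw)]
  exact congrArg _ (Finset.sum_congr rfl fun j hj =>
    M.lintegral_nextSurface_realized hx p hw (Finset.mem_filter.1 hj).2 hf)

theorem assignments_appearance (M : Model h S P) (n : ℕ) (ω : Ω) :
    appearance (extendWord (M.assignments n ω) 0) n
      = List.range (appearance (fun k => M.stickIndex k ω) n).length :=
  (appearance_congr fun i hi => by simp [extendWord, hi, assignments, assignment]).trans
    appearance_appearanceLabel

theorem hasCondDistrib_nextSurface (M : Model h S P) {x : Fin n → S} (hx : Function.Injective x)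
    (p : Fin m → S) :
    HasCondDistrib (M.nextSurface n p) (M.latents x)
      ((urnKernel x p).comap urnState measurable_urnState) P := by
  refine hasCondDistrib_of_lintegral (M.measurable_latents x) (M.measurable_nextSurface n p)
    fun f hf => ?_
  simp only [lintegral_eq_tsum_fiber P (M.measurable_assignments n)]
  refine tsum_congr fun w => ?_
  have fiber_eq : {ω | M.assignments n ω = w}
      = {ω | ∀ i < n, M.assignment i ω = extendWord w 0 i} := by
    ext ω
    simp only [Set.mem_ofPred_eq, funext_iff, Fin.forall_iff, assignments]
    exact forall₂_congr fun i hi => by simp [extendWord, hi]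
  obtain fiber_empty | ⟨ω, rfl⟩ := {ω | M.assignments n ω = w}.eq_empty_or_nonempty
  · rw [fiber_empty, Measure.restrict_empty, lintegral_zero_measure, lintegral_zero_measure]
  · rw [fiber_eq]
    exact M.lintegral_nextSurface hx p (M.assignments_appearance n ω) hf

end Model

/-! ### Observations -/

section Kernels

variable {d n : ℕ} {S : Set (EuclideanSpace ℝ (Fin d))}

/-- The law of one noise variable, as a kernel in `Θ⁽¹⁾`. -/
def singleNoiseKernel (d : ℕ) : Kernel (FirstLayer d) ℝ where
  toFun θ := gaussianReal 0 θ.2.toNNReal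
  measurable' := measurable_gaussianReal_toNNReal measurable_const measurable_snd

instance (d : ℕ) : IsMarkovKernel (singleNoiseKernel d) :=
  ⟨fun θ => inferInstanceAs (IsProbabilityMeasure (gaussianReal 0 θ.2.toNNReal))⟩

theorem noiseKernel_succ_map (d n : ℕ) :
    (noiseKernel d (n + 1)).map (fun e => (fun i : Fin n => e i.castSucc, e (Fin.last n)))
      = noiseKernel d n ×ₖ singleNoiseKernel d := by
  ext1 θ
  rw [Kernel.map_apply _ (by fun_prop), Kernel.prod_apply]
  have last_first := measurePreserving_piFinSuccAbove
    (fun _ : Fin (n + 1) => gaussianReal 0 θ.2.toNNReal) (Fin.last n)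
  refine Eq.trans (congrArg (Measure.map · _) ?_)
    (Measure.measurePreserving_swap.comp last_first).map_eq
  ext e
  · simp [MeasurableEquiv.piFinSuccAbove, Fin.init]
  · simp [MeasurableEquiv.piFinSuccAbove]

/-- The value at `x_i` of the surface of observation `i`, read off the table of values `t` and the
assignments `z`. The junk value `0` is taken when `z i` is not a row of the table. -/
def tableEntry (t : Fin n → Fin n → ℝ) (z : Fin n → ℕ) (i : Fin n) : ℝ :=
  if h : z i < n then t ⟨z i, h⟩ i else 0

theorem measurable_tableEntry (i : Fin n) :
    Measurable fun c : (Fin n → Fin n → ℝ) × (Fin n → ℕ) => tableEntry c.1 c.2 i := by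
  refine measurable_from_prod_countable_left fun z => ?_
  change Measurable fun t : Fin n → Fin n → ℝ => tableEntry t z i
  unfold tableEntry
  split_ifs <;> fun_prop

/-- The data as a function of the latents and the noise. -/
def dataOf (x : Fin n → S) (c : Latents d n × (Fin n → ℝ)) : Fin n → S × ℝ := fun i =>
  (x i, inner ℝ c.1.1.1.1 (x i).1 + tableEntry c.1.2.1 c.1.2.2 i + c.2 i)

theorem measurable_dataOf (x : Fin n → S) : Measurable (dataOf (d := d) x) := by
  have meas_entry (i : Fin n) :
      Measurable fun c : Latents d n × (Fin n → ℝ) => tableEntry c.1.2.1 c.1.2.2 i :=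
    (measurable_tableEntry i).comp (measurable_snd.comp measurable_fst)
  unfold dataOf
  fun_prop

end Kernels

namespace Model

variable {d m n : ℕ} {h : HyperPrior d} {S : Set (EuclideanSpace ℝ (Fin d))}
  {Ω : Type*} [MeasurableSpace Ω] {P : Measure Ω} [IsProbabilityMeasure P]

/-- The noise of the first `n` observations. -/
def noises (M : Model h S P) (n : ℕ) (ω : Ω) : Fin n → ℝ := fun i => M.noise i ω

theorem measurable_noises (M : Model h S P) (n : ℕ) : Measurable (M.noises n) :=
  measurable_pi_lambda _ fun i => M.measurable_noise i

theorem tableEntry_table (M : Model h S P) (x : Fin n → S) (i : Fin n) (ω : Ω) :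
    tableEntry (M.table x ω) (M.assignments n ω) i = M.latent i (x i) ω := by
  have label_lt := appearanceLabel_lt_length (c := fun k => M.stickIndex k ω) i.2
  have length_le : (appearance (fun k => M.stickIndex k ω) n).length ≤ n :=
    le_of_appearance_eq_range (M.assignments_appearance n ω)
  have table_row : (appearance (fun k => M.stickIndex k ω) n)[M.assignment i ω]?
      = some (M.stickIndex i ω) :=
    (List.getElem?_eq_getElem label_lt).trans (congrArg some (getElem_appearanceLabel i.2))
  rw [tableEntry, dif_pos (show M.assignments n ω i < n from label_lt.trans_le length_le)]
  simp only [table, assignments, table_row, Option.elim, latent]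

theorem dataOf_eq (M : Model h S P) (x : Fin n → S) (ω : Ω) :
    dataOf x (M.latents x ω, M.noises n ω) = M.data x ω := by
  funext i
  simp only [dataOf, latents, tableEntry_table]
  rfl

theorem hasCondDistrib_noises (M : Model h S P) (n : ℕ) :
    HasCondDistrib (M.noises n) M.noiseless
      ((noiseKernel d n).comap (fun c => c.1.1) (by fun_prop)) P :=
  hasCondDistrib_of_condDistrib_ae_eq M.measurable_noiseless.aemeasurable
    (M.measurable_noises n).aemeasurable (M.law_noise n)

theorem hasCondDistrib_noise (M : Model h S P) (n : ℕ) :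
    HasCondDistrib (M.noise n) (fun ω => (M.noiseless ω, M.noises n ω))
      ((singleNoiseKernel d).comap (fun c => c.1.1.1) (by fun_prop)) P := by
  have kernel_eq : ((noiseKernel d (n + 1)).comap (fun c : Noiseless S => c.1.1)
        (by fun_prop)).map (fun e => (fun i : Fin n => e i.castSucc, e (Fin.last n)))
      = (noiseKernel d n).comap (fun c => c.1.1) (by fun_prop)
        ⊗ₖ ((singleNoiseKernel d).comap (fun c => c.1.1) (by fun_prop)).prodMkRight
          (Fin n → ℝ) := by
    rw [compProd_prodMkRight, ← Kernel.comap_map_comm _ _ (by fun_prop), noiseKernel_succ_map,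
      Kernel.comap_prod]
  exact HasCondDistrib.of_compProd
    (kernel_eq ▸ (M.hasCondDistrib_noises (n + 1)).comp_left (by fun_prop))

theorem hasCondDistrib_obs (M : Model h S P) (x : Fin n → S) (p : S) :
    HasCondDistrib (M.obs n p) (fun ω => (M.data x ω, (M.first ω, M.latent n p ω)))
      ((obsKernel p).prodMkLeft _) P := by
  have meas_surface (i : ℕ) (q : S) :
      Measurable fun c : Noiseless S × (Fin n → ℝ) => c.1.2.2.1 (c.1.2.2.2 i) q :=
    (measurable_surface_index i q).comp (by fun_prop)
  have noise_law : HasCondDistrib (M.noise n)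
      (fun ω => (M.data x ω, (M.first ω, M.latent n p ω)))
      ((singleNoiseKernel d).comap (fun c => c.2.1) (by fun_prop)) P :=
    HasCondDistrib.comp_right (Z := fun ω => (M.noiseless ω, M.noises n ω))
      (f := fun c : Noiseless S × (Fin n → ℝ) => (fun i : Fin n =>
          (x i, inner ℝ c.1.1.1.1 (x i).1 + c.1.2.2.1 (c.1.2.2.2 i) (x i) + c.2 i),
        (c.1.1.1, c.1.2.2.1 (c.1.2.2.2 n) p)))
      (hf := by fun_prop) (M.hasCondDistrib_noise n)
  refine hasCondDistrib_comp_prodMk noise_law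
    (φ := fun c => inner ℝ c.1.2.1.1 p.1 + c.1.2.2 + c.2) (by fun_prop) (.of_forall fun ω => ?_)
  change gaussianReal (inner ℝ p.1 (M.first ω).1 + M.latent n p ω) _
    = (gaussianReal 0 _).map fun e => inner ℝ (M.first ω).1 p.1 + M.latent n p ω + e
  rw [gaussianReal_map_const_add, zero_add, real_inner_comm]

theorem hasCondDistrib_noises_latents_nextSurface (M : Model h S P) (x : Fin n → S)
    (p : Fin m → S) :
    HasCondDistrib (M.noises n) (fun ω => (M.latents x ω, M.nextSurface n p ω))
      (((noiseKernel d n).comap (fun c => c.1.1) (by fun_prop)).prodMkRight _) P :=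
  have meas_table : Measurable fun c : Noiseless S => tableOf x c.2.2 :=
    (measurable_tableOf x).comp (by fun_prop)
  have meas_label (i : ℕ) : Measurable fun c : Noiseless S => appearanceLabel c.2.2.2 i :=
    (measurable_appearanceLabel i).comp (by fun_prop)
  have meas_surface (a : Fin m) : Measurable fun c : Noiseless S => c.2.2.1 (c.2.2.2 n) (p a) :=
    (measurable_surface_index n (p a)).comp (by fun_prop)
  HasCondDistrib.comp_right (Z := M.noiseless)
    (f := fun c : Noiseless S =>
      ((c.1, tableOf x c.2.2, fun i : Fin n => appearanceLabel c.2.2.2 i),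
        (appearanceLabel c.2.2.2 n, WithLp.toLp 2 fun a => c.2.2.1 (c.2.2.2 n) (p a))))
    (hf := by fun_prop) (M.hasCondDistrib_noises n)

theorem hasCondDistrib_noises_latents (M : Model h S P) (x : Fin n → S) (p : Fin m → S) :
    HasCondDistrib (M.noises n) (M.latents x)
      ((noiseKernel d n).comap (fun c => c.1.1) (by fun_prop)) P :=
  HasCondDistrib.comp_right (hf := measurable_fst)
    (M.hasCondDistrib_noises_latents_nextSurface x p)

theorem hasCondDistrib_nextSurface_data (M : Model h S P) {x : Fin n → S}
    (hx : Function.Injective x) (p : Fin m → S) :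
    HasCondDistrib (M.nextSurface n p) (fun ω => (M.data x ω, M.latents x ω))
      (((urnKernel x p).comap urnState measurable_urnState).prodMkLeft _) P := by
  have given_noises := hasCondDistrib_prodMkRight_symm (M.hasCondDistrib_nextSurface hx p)
    (M.hasCondDistrib_noises_latents x p) (M.hasCondDistrib_noises_latents_nextSurface x p)
  have reconstruct : (fun c => (dataOf x c, c.1)) ∘ (fun ω => (M.latents x ω, M.noises n ω))
      = fun ω => (M.data x ω, M.latents x ω) :=
    funext fun ω => congrArg (·, M.latents x ω) (M.dataOf_eq x ω)
  exact reconstruct ▸ HasCondDistrib.comp_right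
    (hf := (measurable_dataOf x).prodMk measurable_fst) given_noises

theorem hasCondDistrib_latent_data (M : Model h S P) {x : Fin n → S}
    (hx : Function.Injective x) (p : S) :
    HasCondDistrib (M.latent n p) (fun ω => (M.data x ω, M.latents x ω))
      (((mixtureKernel x p).comap urnState measurable_urnState).prodMkLeft _) P := by
  refine hasCondDistrib_comp_prodMk (M.hasCondDistrib_nextSurface_data hx fun _ : Fin 1 => p)
    (φ := fun c => c.2.2 0) (by fun_prop) ?_
  filter_upwards [M.ae_admissible] with ω hω
  exact gpMixture_eq_map hω hx _ _ p

theorem condDistrib_obs_data (M : Model h S P) (x : Fin n → S) (p : S) :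
    ∀ᵐ H ∂P.map (M.data x), condDistrib (M.obs n p) (M.data x) P H
      = (condDistrib (fun ω => (M.first ω, M.latent n p ω)) (M.data x) P H).bind
          (obsKernel p) := by
  have obs_law := M.hasCondDistrib_obs x p
  have := condDistrib_ae_eq_bind obs_law.aemeasurable_fst.snd obs_law measurable_snd
  simpa only [Measure.map_id'] using this

theorem condDistrib_first_latent_data (M : Model h S P) {x : Fin n → S}
    (hx : Function.Injective x) (p : S) :
    ∀ᵐ H ∂P.map (M.data x),
      condDistrib (fun ω => (M.first ω, M.latent n p ω)) (M.data x) P H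
        = (condDistrib (M.latents x) (M.data x) P H).bind
            fun c => (mixtureKernel x p (urnState c)).map fun u => (c.1.1, u) :=
  condDistrib_ae_eq_bind (M.measurable_latents x).aemeasurable (M.hasCondDistrib_latent_data hx p)
    (φ := fun c => (c.1.1.1, c.2)) (by fun_prop)

end Model

end InfiniteGP

open InfiniteGP in
theorem proposition1 {d n : ℕ} (h : HyperPrior d) (S : Set (EuclideanSpace ℝ (Fin d)))
    {Ω : Type*} [MeasurableSpace Ω] (P : Measure Ω) [IsProbabilityMeasure P]
    (M : Model h S P) (x : Fin n → S) (hx : Function.Injective x) :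
    -- pointwise at an arbitrary new point `p` in the role of `x_{n+1}`
    (∀ p : S,
      -- term A
      (∀ᵐ c ∂(P.map fun ω => (M.first ω, M.latent n p ω)),
        condDistrib (M.obs n p) (fun ω => (M.first ω, M.latent n p ω)) P c
          = gaussianReal (inner ℝ p.1 c.1.1 + c.2) c.1.2.toNNReal) ∧
      -- term B
      (∀ᵐ c ∂(P.map fun ω => (M.table x ω, M.assignments n ω, M.second ω)),
        condDistrib (M.latent n p) (fun ω => (M.table x ω, M.assignments n ω, M.second ω)) P c
          = gpMixture c.2.2 x c.1 c.2.1 p) ∧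
      -- the predictive distribution as the integral of A against the posterior of `(Θ⁽¹⁾, ξ)`
      (∀ᵐ H ∂(P.map (M.data x)),
        condDistrib (M.obs n p) (M.data x) P H
          = (condDistrib (fun ω => (M.first ω, M.latent n p ω)) (M.data x) P H).bind
              fun c => gaussianReal (inner ℝ p.1 c.1.1 + c.2) c.1.2.toNNReal) ∧
      -- the posterior of `(Θ⁽¹⁾, ξ)` as the integral of B against C
      (∀ᵐ H ∂(P.map (M.data x)),
        condDistrib (fun ω => (M.first ω, M.latent n p ω)) (M.data x) P H
          = (condDistrib
              (fun ω => ((M.first ω, M.second ω), M.table x ω, M.assignments n ω))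
              (M.data x) P H).bind
              fun c => (gpMixture c.1.2 x c.2.1 c.2.2 p).map fun u => (c.1.1, u)) ∧
      -- the predictive distribution as the integral of A and B against C
      (∀ᵐ H ∂(P.map (M.data x)),
        condDistrib (M.obs n p) (M.data x) P H
          = (condDistrib
              (fun ω => ((M.first ω, M.second ω), M.table x ω, M.assignments n ω))
              (M.data x) P H).bind
              fun c => (gpMixture c.1.2 x c.2.1 c.2.2 p).bind
                fun u => gaussianReal (inner ℝ p.1 c.1.1.1 + u) c.1.1.2.toNNReal)) ∧
    -- the same for the new surface as a process over `S`: its label and finite-dimensional laws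
    (∀ (m : ℕ) (p : Fin m → S),
      (∀ᵐ c ∂(P.map fun ω => (M.table x ω, M.assignments n ω, M.second ω)),
        condDistrib
            (fun ω => (M.assignment n ω,
              (WithLp.toLp 2 fun a => M.latent n (p a) ω : EuclideanSpace ℝ (Fin m))))
            (fun ω => (M.table x ω, M.assignments n ω, M.second ω)) P c
          = urnKriging c.2.2 x c.1 c.2.1 p) ∧
      (∀ᵐ H ∂(P.map (M.data x)),
        condDistrib
            (fun ω => (M.first ω, M.assignment n ω,
              (WithLp.toLp 2 fun a => M.latent n (p a) ω : EuclideanSpace ℝ (Fin m))))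
            (M.data x) P H
          = (condDistrib
              (fun ω => ((M.first ω, M.second ω), M.table x ω, M.assignments n ω))
              (M.data x) P H).bind
              fun c => (urnKriging c.1.2 x c.2.1 c.2.2 p).map fun u => (c.1.1, u))) := by
  refine ⟨fun p => ?_, fun m p => ⟨?_, ?_⟩⟩
  · have predictive := M.condDistrib_obs_data x p
    have posterior := M.condDistrib_first_latent_data hx p
    refine ⟨condDistrib_ae_eq_of_hasCondDistrib
        (.comp_right (hf := measurable_snd) (M.hasCondDistrib_obs x p)),
      condDistrib_ae_eq_of_hasCondDistrib (.comp_right (hf := measurable_urnState)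
        (.comp_right (hf := measurable_snd) (M.hasCondDistrib_latent_data hx p))),
      predictive, posterior, ?_⟩
    filter_upwards [predictive, posterior] with H hpredictive hposterior
    rw [hpredictive, hposterior]
    exact bind_map_bind (κ := (mixtureKernel x p).comap urnState measurable_urnState)
      (φ := fun c => (c.1.1.1, c.2)) (by fun_prop) (obsKernel p)
  · exact condDistrib_ae_eq_of_hasCondDistrib
      (.comp_right (hf := measurable_urnState) (M.hasCondDistrib_nextSurface hx p))
  · exact condDistrib_ae_eq_bind (M.measurable_latents x).aemeasurable
      (M.hasCondDistrib_nextSurface_data hx p) (φ := fun c => (c.1.1.1, c.2)) (by fun_prop)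

end
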